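/- Let $\alpha,\beta\in(0,1]$ and $\lambda_0,\xi>0$. Write $E_a(z)=\sum_{m\ge0}\frac{z^m}{\Gamma(am+1)}$, $E_{a,b}(z)=\sum_{m\ge0}\frac{z^m}{\Gamma(am+b)}$, $E_{a,b}^{c}(z)=\sum_{s\ge0}\frac{(c)_s}{s!}\frac{z^s}{\Gamma(as+b)}$, where $(c)_s$ is the Pochhammer symbol, let $\Theta$ be the Heaviside function, and let $\frac{\partial^\beta}{\partial t^\beta}$ be the Caputo derivative with base point $0$ (the ordinary derivative if $\beta=1$). Distributions on $\mathbb R$ are tested against smooth compactly supported functions, $D_x$ is the distributional derivative, and $*$ is the convolution of distributions supported in $[0,\infty)$. For $\lambda>0$ let $G_\lambda(u)=(\lambda+1)\frac{(1-u)^\alpha}{\lambda+(1-u)^\alpha}=\sum_{n\ge 0}[G_\lambda]_nu^n$, and let $p_{\lambda,n}(t)$ be the coefficient of $u^n$ in $E_\beta(-\xi t^\beta G_\lambda(u))$. These are the state probabilities of the space-time Mittag-Leffler process: $p_{\lambda,n}(0)=\delta_{n,0}$ and $\frac{d^\beta}{dt^\beta}p_{\lambda,n}(t)=-\xi\sum_{k=0}^n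 p_{\lambda,k}(t)[G_\lambda]_{n-k}$ for $t>0$. 1. (Limiting state density.) Define the distribution $$\mathcal P(x,t)=\sum_{m=0}^\infty\frac{(-\xi t^\beta)^m}{\Gamma(\beta m+1)}e_{\alpha,0}^m(-\lambda_0,x)=E_\beta(-\xi t^\beta)\,\delta(x)+q(x,t),$$ where $$e^m_{\alpha,0}(-\lambda_0,x)=\delta(x)+\Theta(x)\sum_{s\ge1}\frac{(m)_s(-\lambda_0)^s x^{\alpha s-1}}{s!\,\Gamma(\alpha s)}$$ and $q(\cdot,t)$ is locally integrable and vanishes for $x\le0$. The series of distributions converges when tested against any test function. For every $t\ge0$, as $h\to0+$, the lattice densities $x\mapsto\Theta(x)\,h^{-1}p_{\lambda_0h^\alpha,\lfloor x/h\rfloor}(t)$ converge to $\mathcal P(\cdot,t)$ in the sense of distributions, and pointwise to $q(x,t)$ for every $x>0$. 2. (Laplacian density.) Let $\mathcal W(x)=\lambda_0x^{\alpha-1}E_{\alpha,\alpha}(-\lambda_0x^\alpha)$ for $x>0$ and $\mathcal W(x)=0$ for $x\le0$; it is locally integrable. As $h\to0+$, the lattice densities $\Theta(x)h^{-1}[G_{\lambda_0h^\alpha}]_{\lfloor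 x/h\rfloor}$ converge in the sense of distributions to $$\mathcal G=\delta-\mathcal W=D_x\left[\Theta(x)E_\alpha(-\lambda_0x^\alpha)\right],$$ one has $\mathcal W(x)=-\frac{d}{dx}E_\alpha(-\lambda_0x^\alpha)$ for $x>0$, and the Laplace transform of $\mathcal G$ is $\frac{s^\alpha}{s^\alpha+\lambda_0}$ for $\Re s>0$. 3. (Cauchy problem.) $\mathcal P(\cdot,0)=\delta$, and $\mathcal P(\cdot,t)\to\delta$ in the sense of distributions as $t\to0+$. For every $t>0$ the Caputo derivative of $\mathcal P$ exists in the sense of distributions in $x$ (i.e. tested against every test function), and $$\frac{\partial^\beta}{\partial t^\beta}\mathcal P=-\xi\,\mathcal G*\mathcal P=-\xi\mathcal P+\xi\,\mathcal W*\mathcal P=-\xi D_x\Big[\big(\Theta(x) E_\alpha(-\lambda_0x^\alpha)\big)*\mathcal P\Big]=-\xi\mathcal P+\xi\lambda_0\,\mathfrak E_x(\alpha,\alpha;1;-\lambda_0)\mathcal P,$$ where $\mathfrak E_x(a,b;c;w)$ is Prabhakar's integral operator, i.e. convolution in $x$ with $\Theta(x)x^{b-1}E_{a,b}^c(wx^a)$.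 Moreover, for all $t>0$, $x>0$ one has pointwise $\frac{\partial^\beta}{\partial t^\beta}E_\beta(-\xi t^\beta)=-\xi E_\beta(-\xi t^\beta)$ for the mass of the atom at the origin and $$\frac{\partial^\beta}{\partial t^\beta}q(x,t)=-\xi q(x,t)+\xi\left(E_\beta(-\xi t^\beta)\,\mathcal W(x)+\int_0^x\lambda_0(x-\tau)^{\alpha-1}E_{\alpha,\alpha}\big(-\lambda_0(x-\tau)^\alpha\big)\,q(\tau,t)\,d\tau\right).$$ -/

import Mathlib

open MeasureTheory Filter Topology Set
open scoped Distributions LineDeriv PowerSeries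

noncomputable section

/-! ### Special functions -/

/-- The three-parameter Mittag-Leffler (Prabhakar) function
`E_{a,b}^c(z) = ∑ (c)_s z^s / (s! Γ(a s + b))`, where `(c)_s` is the Pochhammer symbol. -/
def prabhakarFun (a b c z : ℝ) : ℝ :=
  ∑' s : ℕ, (ascPochhammer ℝ s).eval c / (s.factorial : ℝ) * (z ^ s / Real.Gamma (a * s + b))

/-- The generalized Mittag-Leffler function `E_{a,b}(z) = ∑ z^m / Γ(a m + b)`. -/
def mittagLefflerGen (a b z : ℝ) : ℝ :=
  ∑' m : ℕ, z ^ m / Real.Gamma (a * m + b)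

/-- The Mittag-Leffler function `E_a(z) = ∑ z^m / Γ(a m + 1)`. -/
def mittagLeffler (a z : ℝ) : ℝ :=
  ∑' m : ℕ, z ^ m / Real.Gamma (a * m + 1)

/-! ### Caputo derivative -/

/-- `f` has at the time `t` the Caputo derivative `v` of order `b ∈ (0, 1]` (with base point `0`):
`v = Γ(1 - b)⁻¹ ∫_0^t (t - τ)^(-b) f'(τ) dτ` for `b < 1`, and `v = f'(t)` for `b = 1`.
The regularity needed to make sense of this is part of the definition. -/
def HasCaputoDeriv (b : ℝ) (f : ℝ → ℝ) (t v : ℝ) : Prop :=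
  ContinuousOn f (Icc 0 t) ∧
    ((b = 1 ∧ HasDerivAt f v t) ∨
      (b < 1 ∧ DifferentiableOn ℝ f (Ioo 0 t) ∧
        IntervalIntegrable (fun τ => (t - τ) ^ (-b) * deriv f τ) volume 0 t ∧
        v = (Real.Gamma (1 - b))⁻¹ * ∫ τ in (0 : ℝ)..t, (t - τ) ^ (-b) * deriv f τ))

/-! ### The discrete process

An upper triangular circulant matrix `M` on the integer line (`M_{m,n} = M_{0,n-m}`, zero for
`n < m`) is the same thing as the formal power series `∑ M_{0,n} u^n`, matrix products being
products of power series; the Laplacian `1 - T_{-1}` is the series `1 - u`. -/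

/-- The binomial series `(1 - u)^a`, i.e. the fractional Laplacian matrix `(1 - T_{-1})^a`. -/
def fracLaplacian (a : ℝ) : ℝ⟦X⟧ :=
  PowerSeries.mk fun n => (-1) ^ n * Ring.choose a n

/-- The normalized Laplacian `(l + 1) (1 - u)^a / (l + (1 - u)^a)` which generates the discrete
Mittag-Leffler jumps. -/
def discreteLaplacian (a l : ℝ) : ℝ⟦X⟧ :=
  PowerSeries.C (l + 1) * fracLaplacian a * (PowerSeries.C l + fracLaplacian a)⁻¹

/-- The state probabilities `p_n(t)` of the space-time Mittag-Leffler process: the coefficient of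
`u^n` in `E_b(-ξ t^b G(u))`, where `G` is the normalized Laplacian. -/
def stateProb (a b l ξ : ℝ) (n : ℕ) (t : ℝ) : ℝ :=
  ∑' m : ℕ, (-ξ * t ^ b) ^ m / Real.Gamma (b * m + 1) *
    PowerSeries.coeff n (discreteLaplacian a l ^ m)

/-- The density on `ℝ` attached to a sequence `c` sitting on the lattice `h ℕ`, i.e.
`∑ n, c n * δ_h (x - n h)` with the discrete delta `δ_h = h⁻¹ 1_[0,h)`.
Its value at `x ∈ h ℕ` is `h⁻¹ c (x / h)`. -/
def latticeDensity (h : ℝ) (c : ℕ → ℝ) (x : ℝ) : ℝ :=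
  if 0 ≤ x then c ⌊x / h⌋₊ / h else 0

/-! ### Distributions on the real line -/

/-- Real distributions on `ℝ`. -/
abbrev RealDistribution : Type := 𝓓'((⊤ : TopologicalSpace.Opens ℝ), ℝ)

/-- Test functions on `ℝ`. -/
abbrev RealTest : Type := 𝓓((⊤ : TopologicalSpace.Opens ℝ), ℝ)

/-- The distribution `φ ↦ ∫ φ f` given by a locally integrable function `f`. -/
def ofFun (f : ℝ → ℝ) : RealDistribution :=
  TestFunction.integralAgainstBilinCLM (ContinuousLinearMap.mul ℝ ℝ) volume f

/-- Dirac's delta at the origin. -/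
def dirac0 : RealDistribution := Distribution.delta (0 : ℝ)

/-- The translated test function `x ↦ φ (x + y)`. -/
def shiftTest (y : ℝ) (φ : RealTest) : RealTest where
  toFun x := φ (x + y)
  contDiff' := φ.contDiff'.comp (contDiff_id.add contDiff_const)
  hasCompactSupport' := φ.hasCompactSupport'.comp_homeomorph (Homeomorph.addRight y)
  tsupport_subset' := fun _ _ => trivial

/-- `R = S * T` is the convolution of two distributions `S`, `T` supported in `[0, ∞)`:
`R(φ) = S_y (T_x (φ (x + y)))`. The function `y ↦ T_x (φ (x + y))` is smooth and vanishes for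
large `y`; since `S` is supported in `[0, ∞)` it can be applied to any test function `ψ` that
agrees with it on a neighbourhood of `[0, ∞)`. -/
def IsCausalConv (S T R : RealDistribution) : Prop :=
  Distribution.IsVanishingOn S (Iio (0 : ℝ)) ∧ Distribution.IsVanishingOn T (Iio (0 : ℝ)) ∧
    ∀ φ : RealTest, ∃ ψ : RealTest,
      (∃ ε > 0, ∀ y > -ε, ψ y = T (shiftTest y φ)) ∧ R φ = S ψ

/-- The distribution `T = c δ + f`, with `f` locally integrable and zero on `(-∞, 0)`, has an
(absolutely convergent) Laplace transform at `s`, with value `v = c + ∫_0^∞ e^{-s x} f(x) dx`. -/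
def HasLaplaceTransform (T : RealDistribution) (s v : ℂ) : Prop :=
  ∃ (c : ℝ) (f : ℝ → ℝ), LocallyIntegrable f ∧ (∀ x < 0, f x = 0) ∧
    T = c • dirac0 + ofFun f ∧
    IntegrableOn (fun x : ℝ => Complex.exp (-s * x) * (f x : ℂ)) (Ioi 0) ∧
    v = c + ∫ x in Ioi (0 : ℝ), Complex.exp (-s * x) * (f x : ℂ)

/-- The kernel `Θ(x) x^(b-1) E_{a,b}^c(w x^a)` of Prabhakar's integral operator. -/
def prabhakarIntegralKernel (a b c w x : ℝ) : ℝ :=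
  if 0 < x then x ^ (b - 1) * prabhakarFun a b c (w * x ^ a) else 0

/-- `R` is the Prabhakar integral `𝔈(a, b; c; w) T`, i.e.
`∫_0^x (x - τ)^(b-1) E_{a,b}^c(w (x - τ)^a) T(τ) dτ`, of a distribution `T` supported
in `[0, ∞)`. -/
def IsPrabhakarIntegral (a b c w : ℝ) (T R : RealDistribution) : Prop :=
  LocallyIntegrable (prabhakarIntegralKernel a b c w) ∧
    IsCausalConv (ofFun (prabhakarIntegralKernel a b c w)) T R

/-! ### Objects of the diffusion limit -/

/-- The function `Θ(x) E_a(-l x^a)`. -/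
def survivalFun (a l x : ℝ) : ℝ :=
  if 0 ≤ x then mittagLeffler a (-l * x ^ a) else 0

/-- The Mittag-Leffler density `W(x) = l x^(a-1) E_{a,a}(-l x^a)`, `x > 0`. -/
def mlDensity (a l x : ℝ) : ℝ :=
  if 0 < x then l * x ^ (a - 1) * mittagLefflerGen a a (-l * x ^ a) else 0

/-- The Laplacian density `𝒢 = δ - W`. -/
def laplacianDensity (a l : ℝ) : RealDistribution :=
  dirac0 - ofFun (mlDensity a l)

/-- The part on `x > 0` of the Prabhakar kernel `e_{a,0}^c(z, x)`:
`∑_{s ≥ 1} (c)_s z^s x^(a s - 1) / (s! Γ(a s))`. -/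
def prabhakarKernelReg (a c z x : ℝ) : ℝ :=
  if 0 < x then
    ∑' s : ℕ, (ascPochhammer ℝ (s + 1)).eval c / ((s + 1).factorial : ℝ) * z ^ (s + 1) *
      (x ^ (a * ((s : ℝ) + 1) - 1) / Real.Gamma (a * ((s : ℝ) + 1)))
  else 0

/-- The Prabhakar kernel `e_{a,0}^c(z, ·)`. -/
def prabhakarKernel (a c z : ℝ) : RealDistribution :=
  dirac0 + ofFun (prabhakarKernelReg a c z)

/-- The part on `x > 0` of the state density,
`∑_m (-ξ t^b)^m / Γ(b m + 1) e_{a,0}^m(-l, x)`. -/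
def stateDensityReg (a b l ξ t x : ℝ) : ℝ :=
  ∑' m : ℕ, (-ξ * t ^ b) ^ m / Real.Gamma (b * m + 1) * prabhakarKernelReg a m (-l) x

/-- The state density `𝒫(·, t)`, an atom of mass `E_b(-ξ t^b)` at the origin plus a density. -/
def stateDensity (a b l ξ t : ℝ) : RealDistribution :=
  mittagLeffler b (-ξ * t ^ b) • dirac0 + ofFun (stateDensityReg a b l ξ t)

end

/-!
Every function in sight is a fractional power series `∑ f_s x^(a s + b - 1) / Γ(a s + b)` with
exponentially bounded coefficients. By the beta integral, convolving with the Riemann–Liouville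
kernel `x^(p - 1) / Γ(p)` only raises `b` by `p`, so a Caputo derivative in time shifts the
coefficients of a series `∑_m (-ξ t^b)^m / Γ(b m + 1) y_m` by one place. This solves the evolution
equations as soon as the shifted coefficients are recognised.

For the state probabilities they are the powers of the power series `G`, and shifting multiplies by
`G`. For the limit they are the Prabhakar kernels `e^m`, and the semigroup law `e^m * e^n = e^(m+n)`
(Chu–Vandermonde for the coefficients) turns the shift into a convolution with `e^1 = δ - W`.

The two are linked by the binomial series
`G^m = (l + 1)^m ∑_s (m)_s / s! (-l)^s (1 - u)^(-a s)`: the coefficients of `(-l)^s (1 - u)^(-a s)`,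
with `l = λ₀ h^a` and divided by `h`, tend to the kernels `(-λ₀)^s x^(a s - 1) / Γ(a s)`.
Bounds uniform in the lattice point and geometric in `m` justify the interchange of limit and sum,
both pointwise and against test functions.

The Laplace transform of `W` on the real axis follows from the Volterra equation
`W + λ₀ x^(a - 1) / Γ(a) * W = λ₀ x^(a - 1) / Γ(a)`, and extends to the half-plane by analytic
continuation.
-/

noncomputable section
/-! ### Riemann–Liouville kernels -/

lemma rpow_mul_exp_neg_le_Gamma_add_one {T y : ℝ} (hT : 0 ≤ T) (hy : 0 ≤ y) :
    T ^ y * Real.exp (-T) ≤ Real.Gamma (y + 1) := by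
  have hint := Real.GammaIntegral_convergent (show 0 < y + 1 by linarith)
  have hsub : Ioi T ⊆ Ioi (0 : ℝ) := Ioi_subset_Ioi hT
  calc T ^ y * Real.exp (-T)
      = ∫ u in Ioi T, T ^ y * Real.exp (-u) := by
        rw [integral_const_mul, integral_exp_neg_Ioi]
    _ ≤ ∫ u in Ioi T, Real.exp (-u) * u ^ (y + 1 - 1) := by
        refine setIntegral_mono_on ((integrableOn_exp_neg_Ioi T).const_mul _)
          (hint.mono_set hsub) measurableSet_Ioi fun u hu => ?_
        rw [mul_comm, add_sub_cancel_right]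
        have hTu : T ≤ u := le_of_lt hu
        gcongr
    _ ≤ ∫ u in Ioi 0, Real.exp (-u) * u ^ (y + 1 - 1) := by
        refine setIntegral_mono_set hint ?_ hsub.eventuallyLE
        filter_upwards [ae_restrict_mem measurableSet_Ioi] with u hu
        exact mul_nonneg (Real.exp_pos _).le (Real.rpow_nonneg (le_of_lt hu) _)
    _ = Real.Gamma (y + 1) := (Real.Gamma_eq_integral (by linarith)).symm

lemma exists_inv_Gamma_le_mul_rpow {ρ : ℝ} (hρ : 0 < ρ) :
    ∃ C : ℝ, 0 ≤ C ∧ ∀ y : ℝ, 0 < y → (Real.Gamma y)⁻¹ ≤ C * ρ ^ y := by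
  set T : ℝ := Real.exp 1 / ρ with hT
  refine ⟨Real.exp T, (Real.exp_pos _).le, fun y hy => ?_⟩
  have hΓ : T ^ y * Real.exp (-T) ≤ y * Real.Gamma y := by
    rw [← Real.Gamma_add_one hy.ne']
    exact rpow_mul_exp_neg_le_Gamma_add_one (by positivity) hy.le
  have hTy : T ^ y = Real.exp y * (ρ ^ y)⁻¹ := by
    rw [hT, Real.div_rpow (Real.exp_pos _).le hρ.le, Real.exp_one_rpow, div_eq_mul_inv]
  have hy_exp : y ≤ Real.exp y := by linarith [Real.add_one_le_exp y]
  have := Real.Gamma_pos_of_pos hy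
  have hmain : Real.exp y * ((ρ ^ y)⁻¹ * Real.exp (-T)) ≤ Real.exp y * Real.Gamma y := by
    rw [← mul_assoc, ← hTy]
    exact hΓ.trans (by gcongr)
  have hinv := le_of_mul_le_mul_left hmain (Real.exp_pos y)
  calc (Real.Gamma y)⁻¹ ≤ ((ρ ^ y)⁻¹ * Real.exp (-T))⁻¹ := by gcongr
    _ = Real.exp T * ρ ^ y := by rw [mul_inv, inv_inv, Real.exp_neg, inv_inv, mul_comm]

/-- The Riemann–Liouville kernel `x ^ (p - 1) / Γ(p)` of the fractional integral of order `p`,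
used on `x ≥ 0` only. -/
def rlKernel (p x : ℝ) : ℝ := x ^ (p - 1) / Real.Gamma p

section RiemannLiouville

variable {p q x : ℝ}

lemma rlKernel_nonneg (hp : 0 ≤ p) (hx : 0 ≤ x) : 0 ≤ rlKernel p x :=
  div_nonneg (Real.rpow_nonneg hx _) (Real.Gamma_nonneg_of_nonneg hp)

lemma rlKernel_pos (hp : 0 < p) (hx : 0 < x) : 0 < rlKernel p x :=
  div_pos (Real.rpow_pos_of_pos hx _) (Real.Gamma_pos_of_pos hp)

lemma hasDerivAt_rlKernel_add_one (hp : 0 < p) (hx : 0 < x) :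
    HasDerivAt (rlKernel (p + 1)) (rlKernel p x) x := by
  have h := (Real.hasDerivAt_rpow_const (p := p + 1 - 1) (Or.inl hx.ne')).div_const
    (Real.Gamma (p + 1))
  rw [Real.Gamma_add_one hp.ne', add_sub_cancel_right, mul_div_mul_left _ _ hp.ne',
    ← Real.Gamma_add_one hp.ne'] at h
  refine h.congr_of_eventuallyEq (.of_forall fun y => ?_)
  rw [rlKernel, add_sub_cancel_right]

lemma continuousAt_rlKernel (p : ℝ) (hx : 0 < x) : ContinuousAt (rlKernel p) x :=
  (Real.continuousAt_rpow_const _ _ (Or.inl hx.ne')).div_const _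

lemma continuous_rlKernel (hp : 1 ≤ p) : Continuous (rlKernel p) :=
  (Real.continuous_rpow_const (sub_nonneg.2 hp)).div_const _

lemma monotoneOn_rlKernel (hp : 1 ≤ p) : MonotoneOn (rlKernel p) (Ici 0) := fun x hx y _ hxy => by
  have hx0 : 0 ≤ x := hx
  have := Real.Gamma_pos_of_pos (one_pos.trans_le hp)
  unfold rlKernel
  gcongr

lemma integral_rpow_sub_mul_rpow (hp : 0 < p) (hq : 0 < q) (hx : 0 < x) :
    ∫ τ in (0 : ℝ)..x, (x - τ) ^ (p - 1) * τ ^ (q - 1) =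
      x ^ (p + q - 1) * (Real.Gamma p * Real.Gamma q / Real.Gamma (p + q)) := by
  have hbeta := Complex.betaIntegral_scaled (q : ℂ) (p : ℂ) hx
  rw [Complex.betaIntegral_eq_Gamma_mul_div _ _ (by simpa using hq) (by simpa using hp)] at hbeta
  rw [← Complex.ofReal_inj, ← intervalIntegral.integral_ofReal]
  calc ∫ τ in (0 : ℝ)..x, (((x - τ) ^ (p - 1) * τ ^ (q - 1) : ℝ) : ℂ)
      = ∫ τ in (0 : ℝ)..x, (τ : ℂ) ^ ((q : ℂ) - 1) * ((x : ℂ) - τ) ^ ((p : ℂ) - 1) := by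
        rw [intervalIntegral.integral_of_le hx.le, intervalIntegral.integral_of_le hx.le]
        refine setIntegral_congr_fun measurableSet_Ioc fun τ hτ => ?_
        rw [Complex.ofReal_mul, Complex.ofReal_cpow (sub_nonneg.2 hτ.2),
          Complex.ofReal_cpow hτ.1.le]
        push_cast
        ring
    _ = ((x ^ (p + q - 1) * (Real.Gamma p * Real.Gamma q / Real.Gamma (p + q)) : ℝ) : ℂ) := by
        rw [hbeta, Complex.ofReal_mul, Complex.ofReal_cpow hx.le]
        push_cast [← Complex.Gamma_ofReal]
        ring_nf

lemma intervalIntegrable_rpow_sub_mul_rpow (hp : 0 < p) (hq : 0 < q) (hx : 0 < x) :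
    IntervalIntegrable (fun τ => (x - τ) ^ (p - 1) * τ ^ (q - 1)) volume 0 x := by
  -- a function with a nonzero Bochner integral is integrable
  by_contra hundef
  have := Real.Gamma_pos_of_pos hp
  have := Real.Gamma_pos_of_pos hq
  have := Real.Gamma_pos_of_pos (add_pos hp hq)
  exact (integral_rpow_sub_mul_rpow hp hq hx ▸ (by positivity :
    x ^ (p + q - 1) * (Real.Gamma p * Real.Gamma q / Real.Gamma (p + q)) ≠ 0))
    (intervalIntegral.integral_undef hundef)

lemma intervalIntegrable_rlKernel_conv (hp : 0 < p) (hq : 0 < q) (hx : 0 < x) :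
    IntervalIntegrable (fun τ => rlKernel p (x - τ) * rlKernel q τ) volume 0 x := by
  refine ((intervalIntegrable_rpow_sub_mul_rpow hp hq hx).div_const
    (Real.Gamma p * Real.Gamma q)).congr fun τ _ => ?_
  exact (div_mul_div_comm _ _ _ _).symm

lemma integral_rlKernel_conv (hp : 0 < p) (hq : 0 < q) (hx : 0 < x) :
    ∫ τ in (0 : ℝ)..x, rlKernel p (x - τ) * rlKernel q τ = rlKernel (p + q) x := by
  have hΓp := (Real.Gamma_pos_of_pos hp).ne'
  have hΓq := (Real.Gamma_pos_of_pos hq).ne'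
  simp only [rlKernel, div_mul_div_comm, intervalIntegral.integral_div,
    integral_rpow_sub_mul_rpow hp hq hx]
  field_simp

end RiemannLiouville

/-! ### Fractional power series -/

/-- The sequence `f` grows at most exponentially; for such coefficients all the fractional power
series below converge. -/
def ExpBounded (f : ℕ → ℝ) : Prop := ∃ C K : ℝ, 0 ≤ C ∧ 0 < K ∧ ∀ s, |f s| ≤ C * K ^ s

/-- The fractional power series `∑ f_s x^(a s + b - 1) / Γ(a s + b)`. It comprises the functions of
Mittag-Leffler type: `fracSeries a b (z ^ ·)` is `x^(b - 1) E_{a,b}(z x^a)`. -/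
def fracSeries (a b : ℝ) (f : ℕ → ℝ) (x : ℝ) : ℝ :=
  ∑' s : ℕ, f s * rlKernel (a * s + b) x

namespace ExpBounded

variable {f g : ℕ → ℝ}

lemma comp_succ (hf : ExpBounded f) : ExpBounded fun s => f (s + 1) := by
  obtain ⟨C, K, hC, hK, hbound⟩ := hf
  refine ⟨C * K, K, by positivity, hK, fun s => ?_⟩
  rw [mul_assoc, ← pow_succ']
  exact hbound _

lemma of_abs_le_pow {K : ℝ} (hK : 0 ≤ K) (hf : ∀ s, |f s| ≤ K ^ s) : ExpBounded f :=
  ⟨1, K + 1, zero_le_one, by positivity, fun s =>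
    (hf s).trans (by rw [one_mul]; gcongr; linarith)⟩

lemma pow (z : ℝ) : ExpBounded (z ^ ·) := .of_abs_le_pow (abs_nonneg z) fun s => (abs_pow z s).le

lemma one : ExpBounded fun _ => 1 := by simpa only [one_pow] using pow 1

lemma mul (hf : ExpBounded f) (hg : ExpBounded g) : ExpBounded fun s => f s * g s := by
  obtain ⟨C, K, hC, hK, hbound⟩ := hf
  obtain ⟨C', K', hC', hK', hbound'⟩ := hg
  refine ⟨C * C', K * K', by positivity, by positivity, fun s => ?_⟩
  rw [abs_mul, mul_pow, mul_mul_mul_comm]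
  exact mul_le_mul (hbound s) (hbound' s) (abs_nonneg _) (by positivity)

lemma const_mul (hf : ExpBounded f) (c : ℝ) : ExpBounded fun s => c * f s :=
  mul ⟨|c|, 1, abs_nonneg c, one_pos, fun s => by rw [one_pow, mul_one]⟩ hf

lemma add (hf : ExpBounded f) (hg : ExpBounded g) : ExpBounded fun s => f s + g s := by
  obtain ⟨C, K, hC, hK, hbound⟩ := hf
  obtain ⟨C', K', hC', hK', hbound'⟩ := hg
  refine ⟨C + C', max K K', by positivity, lt_max_of_lt_left hK, fun s => ?_⟩
  rw [add_mul]
  refine (abs_add_le _ _).trans (add_le_add ((hbound s).trans ?_) ((hbound' s).trans ?_))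
  · gcongr; exact le_max_left _ _
  · gcongr; exact le_max_right _ _

end ExpBounded

section FracSeries

variable {a b d x R : ℝ} {f g : ℕ → ℝ}

lemma rlKernel_mul_natCast_add (a b : ℝ) (s : ℕ) (hx : 0 < x) :
    rlKernel (a * s + b) x = x ^ (b - 1) * (x ^ a) ^ s / Real.Gamma (a * s + b) := by
  rw [rlKernel, ← Real.rpow_natCast, ← Real.rpow_mul hx.le, ← Real.rpow_add hx]
  ring_nf

/-- The reciprocal Gamma function decays faster than any exponential, so the terms are dominated
by a geometric series of ratio `1 / 2`, whatever the growth rate of `f` and the radius `R`. -/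
lemma exists_abs_mul_rlKernel_le (ha : 0 < a) (hb : 0 < b) (hR : 0 < R) (hf : ExpBounded f) :
    ∃ M : ℝ, 0 ≤ M ∧ ∀ x ∈ Ioc 0 R, ∀ s : ℕ,
      |f s * rlKernel (a * s + b) x| ≤ M * x ^ (b - 1) * (1 / 2) ^ s := by
  obtain ⟨C, K, hC, hK, hbound⟩ := hf
  set ρ : ℝ := (2 * K * R ^ a)⁻¹ ^ a⁻¹
  have hρ : 0 < ρ := by positivity
  have hρa : ρ ^ a = (2 * K * R ^ a)⁻¹ := Real.rpow_inv_rpow (by positivity) ha.ne'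
  obtain ⟨C', hC', hΓ⟩ := exists_inv_Gamma_le_mul_rpow hρ
  refine ⟨C * C' * ρ ^ b, by positivity, fun x ⟨hx, hxR⟩ s => ?_⟩
  have hsb : 0 < a * s + b := by positivity
  have := Real.Gamma_pos_of_pos hsb
  have hρs : ρ ^ (a * s + b) = ρ ^ b * (ρ ^ a) ^ s := by
    rw [← Real.rpow_natCast, ← Real.rpow_mul hρ.le, ← Real.rpow_add hρ, add_comm]
  calc |f s * rlKernel (a * s + b) x|
      = |f s| * (x ^ (b - 1) * (x ^ a) ^ s * (Real.Gamma (a * s + b))⁻¹) := by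
        rw [abs_mul, abs_of_pos (rlKernel_pos hsb hx), rlKernel_mul_natCast_add a b s hx,
          div_eq_mul_inv]
    _ ≤ C * K ^ s * (x ^ (b - 1) * (R ^ a) ^ s * (C' * (ρ ^ b * (ρ ^ a) ^ s))) := by
        rw [← hρs]
        gcongr
        exacts [hbound s, hΓ _ hsb]
    _ = C * C' * ρ ^ b * x ^ (b - 1) * (K * R ^ a * ρ ^ a) ^ s := by
        rw [mul_pow, mul_pow]; ring
    _ = C * C' * ρ ^ b * x ^ (b - 1) * (1 / 2) ^ s := by
        rw [hρa]
        congr 2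
        field_simp

lemma summable_abs_mul_rlKernel (ha : 0 < a) (hb : 0 < b) (hx : 0 < x) (hf : ExpBounded f) :
    Summable fun s : ℕ => |f s * rlKernel (a * s + b) x| := by
  obtain ⟨M, -, hM⟩ := exists_abs_mul_rlKernel_le ha hb hx hf
  exact .of_nonneg_of_le (fun _ => abs_nonneg _) (hM x (right_mem_Ioc.2 hx))
    (summable_geometric_two.mul_left _)

lemma hasSum_fracSeries (ha : 0 < a) (hb : 0 < b) (hx : 0 < x) (hf : ExpBounded f) :
    HasSum (fun s : ℕ => f s * rlKernel (a * s + b) x) (fracSeries a b f x) :=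
  (summable_abs_mul_rlKernel ha hb hx hf).of_abs.hasSum

lemma exists_abs_fracSeries_le (ha : 0 < a) (hb : 0 < b) (hR : 0 < R) (hf : ExpBounded f) :
    ∃ M : ℝ, ∀ x ∈ Ioc 0 R, |fracSeries a b f x| ≤ M * x ^ (b - 1) := by
  obtain ⟨M, -, hM⟩ := exists_abs_mul_rlKernel_le ha hb hR hf
  refine ⟨M * 2, fun x hx => ?_⟩
  rw [mul_right_comm]
  exact tsum_of_norm_bounded (f := fun s => f s * rlKernel (a * s + b) x)
    (hasSum_geometric_two.mul_left (M * x ^ (b - 1))) (hM x hx)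

lemma fracSeries_eq_rpow_mul (hx : 0 < x) :
    fracSeries a b f x = x ^ (b - 1) * ∑' s : ℕ, f s * ((x ^ a) ^ s / Real.Gamma (a * s + b)) := by
  rw [fracSeries, ← tsum_mul_left]
  refine tsum_congr fun s => ?_
  rw [rlKernel_mul_natCast_add a b s hx]
  ring

lemma rpow_le_rpow_add_rpow {p q y : ℝ} (hp : 0 < p) (hpy : p ≤ y) (hyq : y ≤ q) (e : ℝ) :
    y ^ e ≤ p ^ e + q ^ e := by
  have hy : 0 < y := hp.trans_le hpy
  have hq : 0 < q := hy.trans_le hyq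
  rcases le_total 0 e with he | he
  · exact (Real.rpow_le_rpow hy.le hyq he).trans (le_add_of_nonneg_left (by positivity))
  · exact (Real.rpow_le_rpow_of_nonpos hp hpy he).trans (le_add_of_nonneg_right (by positivity))

lemma exists_summable_abs_mul_rlKernel_le (ha : 0 < a) (hb : 0 < b) (hx : 0 < x)
    (hf : ExpBounded f) : ∃ u : ℕ → ℝ, Summable u ∧
      ∀ s : ℕ, ∀ y ∈ Ioo (x / 2) (2 * x), |f s * rlKernel (a * s + b) y| ≤ u s := by
  obtain ⟨M, hM0, hM⟩ := exists_abs_mul_rlKernel_le ha hb (show 0 < 2 * x by positivity) hf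
  refine ⟨fun s => M * ((x / 2) ^ (b - 1) + (2 * x) ^ (b - 1)) * (1 / 2) ^ s,
    summable_geometric_two.mul_left _, fun s y hy => ?_⟩
  refine (hM y ⟨by linarith [hy.1], hy.2.le⟩ s).trans ?_
  beta_reduce
  gcongr
  exact rpow_le_rpow_add_rpow (by positivity) hy.1.le hy.2.le _

lemma hasDerivAt_fracSeries_add_one (ha : 0 < a) (hb : 0 < b) (hx : 0 < x) (hf : ExpBounded f) :
    HasDerivAt (fracSeries a (b + 1) f) (fracSeries a b f x) x := by
  obtain ⟨u, hu, hbound⟩ := exists_summable_abs_mul_rlKernel_le ha hb hx hf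
  have hmem : x ∈ Ioo (x / 2) (2 * x) := ⟨by linarith, by linarith⟩
  refine hasDerivAt_tsum_of_isPreconnected
    (g := fun (s : ℕ) y => f s * rlKernel (a * s + (b + 1)) y)
    (g' := fun (s : ℕ) y => f s * rlKernel (a * s + b) y)
    hu isOpen_Ioo isPreconnected_Ioo (fun s y hy => ?_) hbound hmem
    (summable_abs_mul_rlKernel ha (by positivity) hx hf).of_abs hmem
  rw [← add_assoc]
  exact (hasDerivAt_rlKernel_add_one (by positivity) (by linarith [hy.1])).const_mul _

lemma continuousOn_fracSeries (ha : 0 < a) (hb : 0 < b) (hf : ExpBounded f) :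
    ContinuousOn (fracSeries a b f) (Ioi 0) := by
  intro x hx
  have hx0 : 0 < x := hx
  obtain ⟨u, hu, hbound⟩ := exists_summable_abs_mul_rlKernel_le ha hb hx0 hf
  have hcont : ContinuousOn (fracSeries a b f) (Ioo (x / 2) (2 * x)) :=
    continuousOn_tsum (fun s y hy => ((continuousAt_rlKernel _
      (by linarith [hy.1])).const_mul _).continuousWithinAt) hu hbound
  exact (hcont.continuousAt (Ioo_mem_nhds (by linarith) (by linarith))).continuousWithinAt

lemma continuousOn_Icc_fracSeries (ha : 0 < a) (hb : 1 ≤ b) (hR : 0 < R) (hf : ExpBounded f) :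
    ContinuousOn (fracSeries a b f) (Icc 0 R) := by
  have hexp (s : ℕ) : 1 ≤ a * s + b := le_add_of_nonneg_of_le (by positivity) hb
  refine continuousOn_tsum (fun s => ((continuous_rlKernel (hexp s)).const_mul _).continuousOn)
    (summable_abs_mul_rlKernel ha (one_pos.trans_le hb) hR hf) fun s x hx => ?_
  have hpos : 0 ≤ a * s + b := by linarith [hexp s]
  rw [Real.norm_eq_abs, abs_mul, abs_mul, abs_of_nonneg (rlKernel_nonneg hpos hx.1),
    abs_of_nonneg (rlKernel_nonneg hpos hR.le)]
  gcongr
  exact monotoneOn_rlKernel (hexp s) hx.1 hR.le hx.2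

lemma fracSeries_eq_add_comp_succ (ha : 0 < a) (hb : 0 < b) (hx : 0 < x) (hf : ExpBounded f) :
    fracSeries a b f x = f 0 * rlKernel b x + fracSeries a (a + b) (fun s => f (s + 1)) x := by
  rw [fracSeries, (summable_abs_mul_rlKernel ha hb hx hf).of_abs.tsum_eq_zero_add]
  push_cast
  simp only [mul_zero, zero_add, fracSeries, mul_add, mul_one, add_assoc]

lemma hasDerivAt_fracSeries_one (ha : 0 < a) (hx : 0 < x) (hf : ExpBounded f) :
    HasDerivAt (fracSeries a 1 f) (fracSeries a a (fun s => f (s + 1)) x) x := by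
  refine ((hasDerivAt_fracSeries_add_one ha ha hx hf.comp_succ).const_add
    (f 0)).congr_of_eventuallyEq ?_
  filter_upwards [lt_mem_nhds hx] with y hy
  rw [fracSeries_eq_add_comp_succ ha one_pos hy hf, rlKernel]
  simp only [sub_self, Real.rpow_zero, Real.Gamma_one, div_one, mul_one]

lemma fracSeries_add (ha : 0 < a) (hb : 0 < b) (hx : 0 < x) (hf : ExpBounded f)
    (hg : ExpBounded g) :
    fracSeries a b (fun s => f s + g s) x = fracSeries a b f x + fracSeries a b g x := by
  rw [← ((hasSum_fracSeries ha hb hx hf).add (hasSum_fracSeries ha hb hx hg)).tsum_eq]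
  simp only [fracSeries, add_mul]

lemma fracSeries_const_mul (c : ℝ) :
    fracSeries a b (fun s => c * f s) x = c * fracSeries a b f x := by
  simp only [fracSeries, mul_assoc, tsum_mul_left]

end FracSeries

section Convolution

variable {a b d x : ℝ} {f g : ℕ → ℝ}

lemma intervalIntegrable_fracSeries_conv (ha : 0 < a) (hb : 0 < b) (hd : 0 < d) (hx : 0 < x)
    (hf : ExpBounded f) (hg : ExpBounded g) :
    IntervalIntegrable (fun τ => fracSeries a b f (x - τ) * fracSeries a d g τ) volume 0 x := by
  obtain ⟨M, hM⟩ := exists_abs_fracSeries_le ha hb hx hf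
  obtain ⟨M', hM'⟩ := exists_abs_fracSeries_le ha hd hx hg
  have hdom := (intervalIntegrable_rpow_sub_mul_rpow hb hd hx).const_mul (M * M')
  rw [intervalIntegrable_iff_integrableOn_Ioo_of_le hx.le] at hdom ⊢
  refine hdom.mono' (ContinuousOn.aestronglyMeasurable (.mul ?_ ?_) measurableSet_Ioo) ?_
  · exact (continuousOn_fracSeries ha hb hf).comp (by fun_prop) fun τ hτ => sub_pos.2 hτ.2
  · exact (continuousOn_fracSeries ha hd hg).mono Ioo_subset_Ioi_self
  · filter_upwards [ae_restrict_mem measurableSet_Ioo] with τ hτ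
    have hleft := hM (x - τ) ⟨sub_pos.2 hτ.2, by linarith [hτ.1]⟩
    rw [norm_mul, mul_mul_mul_comm]
    exact mul_le_mul hleft (hM' τ ⟨hτ.1, hτ.2.le⟩) (abs_nonneg _) ((abs_nonneg _).trans hleft)

lemma summable_abs_mul_abs_mul_rlKernel_add (ha : 0 < a) (hb : 0 < b) (hx : 0 < x)
    (hf : ExpBounded f) (hg : ExpBounded g) :
    Summable fun p : ℕ × ℕ => |f p.1| * |g p.2| * rlKernel (a * (p.1 + p.2 : ℕ) + b) x := by
  obtain ⟨C, K, hC, hK, hbound⟩ := hf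
  obtain ⟨C', K', hC', hK', hbound'⟩ := hg
  obtain ⟨M, -, hM⟩ := exists_abs_mul_rlKernel_le ha hb hx
    ((ExpBounded.pow (K + K')).const_mul (C * C'))
  have hker (n : ℕ) : 0 ≤ rlKernel (a * n + b) x := rlKernel_nonneg (by positivity) hx.le
  have hgeom : Summable fun p : ℕ × ℕ => ((1 : ℝ) / 2) ^ p.1 * (1 / 2) ^ p.2 :=
    summable_geometric_two.mul_of_nonneg summable_geometric_two
      (fun _ => by positivity) (fun _ => by positivity)
  refine .of_nonneg_of_le (fun p => mul_nonneg (by positivity) (hker _)) (fun p => ?_)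
    (hgeom.mul_left (M * x ^ (b - 1)))
  calc |f p.1| * |g p.2| * rlKernel (a * (p.1 + p.2 : ℕ) + b) x
      ≤ C * (K + K') ^ p.1 * (C' * (K + K') ^ p.2) * rlKernel (a * (p.1 + p.2 : ℕ) + b) x := by
        have := hker (p.1 + p.2)
        gcongr
        · exact (hbound _).trans (by gcongr; linarith)
        · exact (hbound' _).trans (by gcongr; linarith)
    _ = C * C' * (K + K') ^ (p.1 + p.2) * rlKernel (a * (p.1 + p.2 : ℕ) + b) x := by ring
    _ ≤ M * x ^ (b - 1) * (1 / 2) ^ (p.1 + p.2) :=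
        (le_abs_self _).trans (hM x (right_mem_Ioc.2 hx) (p.1 + p.2))
    _ = M * x ^ (b - 1) * ((1 / 2) ^ p.1 * (1 / 2) ^ p.2) := by rw [pow_add]

lemma hasSum_sum_antidiagonal {F : ℕ × ℕ → ℝ} {S : ℝ} (h : HasSum F S) :
    HasSum (fun n => ∑ p ∈ Finset.HasAntidiagonal.antidiagonal n, F p) S := by
  refine ((Finset.HasAntidiagonal.sigmaAntidiagonalEquivProd.hasSum_iff (f := F)).2 h).sigma
    fun n => ?_
  rw [← Finset.sum_coe_sort]
  exact hasSum_fintype _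

lemma hasSum_integral_rlKernel_conv (ha : 0 < a) (hb : 0 < b) (hd : 0 < d) (hx : 0 < x)
    (hf : ExpBounded f) (hg : ExpBounded g) :
    HasSum (fun p : ℕ × ℕ => f p.1 * g p.2 * rlKernel (a * (p.1 + p.2 : ℕ) + (b + d)) x)
      (∫ τ in Ioo 0 x, ∑' p : ℕ × ℕ,
        f p.1 * rlKernel (a * p.1 + b) (x - τ) * (g p.2 * rlKernel (a * p.2 + d) τ)) := by
  set F : ℕ × ℕ → ℝ → ℝ := fun p τ =>
    f p.1 * rlKernel (a * p.1 + b) (x - τ) * (g p.2 * rlKernel (a * p.2 + d) τ)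
  have hpos {e : ℝ} (he : 0 < e) (n : ℕ) : 0 < a * n + e := by positivity
  have hker (p : ℕ × ℕ) : IntegrableOn (fun τ =>
      rlKernel (a * p.1 + b) (x - τ) * rlKernel (a * p.2 + d) τ) (Ioo 0 x) := by
    rw [← intervalIntegrable_iff_integrableOn_Ioo_of_le hx.le]
    exact intervalIntegrable_rlKernel_conv (hpos hb _) (hpos hd _) hx
  have hval (p : ℕ × ℕ) : ∫ τ in Ioo 0 x,
      rlKernel (a * p.1 + b) (x - τ) * rlKernel (a * p.2 + d) τ =
        rlKernel (a * (p.1 + p.2 : ℕ) + (b + d)) x := by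
    rw [← integral_Ioc_eq_integral_Ioo, ← intervalIntegral.integral_of_le hx.le,
      integral_rlKernel_conv (hpos hb _) (hpos hd _) hx]
    congr 1
    push_cast
    ring
  have hF_eq (p : ℕ × ℕ) : F p = fun τ => f p.1 * g p.2 *
      (rlKernel (a * p.1 + b) (x - τ) * rlKernel (a * p.2 + d) τ) :=
    funext fun τ => mul_mul_mul_comm ..
  have hnorm (p : ℕ × ℕ) : ∫ τ in Ioo 0 x, ‖F p τ‖ =
      |f p.1| * |g p.2| * rlKernel (a * (p.1 + p.2 : ℕ) + (b + d)) x := by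
    rw [← hval, ← integral_const_mul]
    refine setIntegral_congr_fun measurableSet_Ioo fun τ hτ => ?_
    simp only [hF_eq, norm_mul, Real.norm_eq_abs]
    rw [abs_of_nonneg (rlKernel_nonneg (hpos hb _).le (sub_pos.2 hτ.2).le),
      abs_of_nonneg (rlKernel_nonneg (hpos hd _).le hτ.1.le)]
  have hsum := hasSum_integral_of_summable_integral_norm (μ := volume.restrict (Ioo 0 x)) (F := F)
    (fun p => by rw [hF_eq]; exact (hker p).const_mul _)
    (by simpa only [hnorm] using
      summable_abs_mul_abs_mul_rlKernel_add ha (add_pos hb hd) hx hf hg)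
  have hint (p : ℕ × ℕ) : ∫ τ in Ioo 0 x, F p τ =
      f p.1 * g p.2 * rlKernel (a * (p.1 + p.2 : ℕ) + (b + d)) x := by
    rw [hF_eq, integral_const_mul, hval]
  simpa only [hint] using hsum

/-- The kernels form a convolution semigroup, so fractional power series convolve like ordinary
power series multiply. -/
theorem integral_fracSeries_conv (ha : 0 < a) (hb : 0 < b) (hd : 0 < d) (hx : 0 < x)
    (hf : ExpBounded f) (hg : ExpBounded g) :
    ∫ τ in (0 : ℝ)..x, fracSeries a b f (x - τ) * fracSeries a d g τ =
      fracSeries a (b + d)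
        (fun n => ∑ p ∈ Finset.HasAntidiagonal.antidiagonal n, f p.1 * g p.2) x := by
  have hprod : ∫ τ in (0 : ℝ)..x, fracSeries a b f (x - τ) * fracSeries a d g τ =
      ∫ τ in Ioo 0 x, ∑' p : ℕ × ℕ,
        f p.1 * rlKernel (a * p.1 + b) (x - τ) * (g p.2 * rlKernel (a * p.2 + d) τ) := by
    rw [intervalIntegral.integral_of_le hx.le, integral_Ioc_eq_integral_Ioo]
    refine setIntegral_congr_fun measurableSet_Ioo fun τ hτ => ?_
    exact tsum_mul_tsum_of_summable_norm (summable_abs_mul_rlKernel ha hb (sub_pos.2 hτ.2) hf)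
      (summable_abs_mul_rlKernel ha hd hτ.1 hg)
  rw [hprod, ← (hasSum_sum_antidiagonal
    (hasSum_integral_rlKernel_conv ha hb hd hx hf hg)).tsum_eq, fracSeries]
  refine tsum_congr fun n => ?_
  rw [Finset.sum_mul]
  refine Finset.sum_congr rfl fun p hp => ?_
  rw [Finset.HasAntidiagonal.mem_antidiagonal.1 hp]

lemma fracSeries_single_zero (a b x : ℝ) :
    fracSeries a b (Pi.single 0 1) x = rlKernel b x := by
  rw [fracSeries, tsum_eq_single 0 fun s hs => by rw [Pi.single_eq_of_ne hs, zero_mul]]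
  simp only [Pi.single_eq_same, one_mul, Nat.cast_zero, mul_zero, zero_add]

lemma ExpBounded.single_zero : ExpBounded (Pi.single 0 1) :=
  .of_abs_le_pow zero_le_one fun s => by
    rw [one_pow]
    rcases eq_or_ne s 0 with rfl | hs
    · rw [Pi.single_eq_same, abs_one]
    · rw [Pi.single_eq_of_ne hs, abs_zero]
      exact zero_le_one

lemma sum_antidiagonal_single_zero_mul (g : ℕ → ℝ) (n : ℕ) :
    ∑ p ∈ Finset.HasAntidiagonal.antidiagonal n, (Pi.single 0 1 : ℕ → ℝ) p.1 * g p.2 = g n := by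
  rw [Finset.sum_eq_single (0, n)]
  · rw [Pi.single_eq_same, one_mul]
  · rintro ⟨i, j⟩ hp hne
    have hi : i ≠ 0 := by
      rintro rfl
      exact hne (by rw [← Finset.HasAntidiagonal.mem_antidiagonal.1 hp, zero_add])
    rw [Pi.single_eq_of_ne hi, zero_mul]
  · exact fun h => absurd (Finset.HasAntidiagonal.mem_antidiagonal.2 (zero_add n)) h

lemma intervalIntegrable_rlKernel_conv_fracSeries (ha : 0 < a) (hb : 0 < b) (hd : 0 < d)
    (hx : 0 < x) (hg : ExpBounded g) :
    IntervalIntegrable (fun τ => rlKernel b (x - τ) * fracSeries a d g τ) volume 0 x := by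
  simpa only [fracSeries_single_zero] using
    intervalIntegrable_fracSeries_conv ha hb hd hx .single_zero hg

lemma integral_rlKernel_conv_fracSeries (ha : 0 < a) (hb : 0 < b) (hd : 0 < d) (hx : 0 < x)
    (hg : ExpBounded g) :
    ∫ τ in (0 : ℝ)..x, rlKernel b (x - τ) * fracSeries a d g τ = fracSeries a (b + d) g x := by
  simpa only [fracSeries_single_zero, sum_antidiagonal_single_zero_mul] using
    integral_fracSeries_conv ha hb hd hx .single_zero hg

end Convolution

/-! ### Caputo derivatives and the state probabilities -/

section Caputo

variable {b t : ℝ}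

lemma HasCaputoDeriv.congr {f g : ℝ → ℝ} {v : ℝ} (h : HasCaputoDeriv b f t v) (ht : 0 < t)
    (hfg : ∀ r, 0 ≤ r → g r = f r) : HasCaputoDeriv b g t v := by
  have heq {r : ℝ} (hr : 0 < r) : g =ᶠ[𝓝 r] f := by
    filter_upwards [lt_mem_nhds hr] with s hs using hfg s hs.le
  obtain ⟨hcont, ⟨hb, hderiv⟩ | ⟨hb, hdiff, hint, hval⟩⟩ := h
  · exact ⟨hcont.congr fun r hr => hfg r hr.1,
      .inl ⟨hb, hderiv.congr_of_eventuallyEq (heq ht)⟩⟩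
  have hintegrand : EqOn (fun τ => (t - τ) ^ (-b) * deriv f τ)
      (fun τ => (t - τ) ^ (-b) * deriv g τ) (Ioc 0 t) := fun τ hτ => by
    simp only [(heq hτ.1).deriv_eq]
  refine ⟨hcont.congr fun r hr => hfg r hr.1,
    .inr ⟨hb, hdiff.congr fun r hr => hfg r hr.1.le, hint.congr ?_, ?_⟩⟩
  · rwa [uIoc_of_le ht.le]
  · rw [hval, intervalIntegral.integral_of_le ht.le, intervalIntegral.integral_of_le ht.le,
      setIntegral_congr_fun measurableSet_Ioc hintegrand]

/-- The derivative of the series is `fracSeries b b`, and the Riemann-Liouville integral of order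
`1 - b` raises the second index back to `1`. -/
lemma hasCaputoDeriv_fracSeries_one {f : ℕ → ℝ} (hb : 0 < b) (hb1 : b ≤ 1) (ht : 0 < t)
    (hf : ExpBounded f) :
    HasCaputoDeriv b (fracSeries b 1 f) t (fracSeries b 1 (fun m => f (m + 1)) t) := by
  refine ⟨continuousOn_Icc_fracSeries hb le_rfl ht hf, ?_⟩
  rcases hb1.eq_or_lt with rfl | hb1
  · exact .inl ⟨rfl, hasDerivAt_fracSeries_one hb ht hf⟩
  have hkernel : EqOn
      (fun τ => Real.Gamma (1 - b) *
        (rlKernel (1 - b) (t - τ) * fracSeries b b (fun m => f (m + 1)) τ))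
      (fun τ => (t - τ) ^ (-b) * deriv (fracSeries b 1 f) τ) (Ioc 0 t) := fun τ hτ => by
    have hΓ : Real.Gamma (1 - b) ≠ 0 := (Real.Gamma_pos_of_pos (sub_pos.2 hb1)).ne'
    simp only [(hasDerivAt_fracSeries_one hb hτ.1 hf).deriv, rlKernel, sub_sub_cancel_left]
    field_simp
  refine .inr ⟨hb1, fun r hr =>
    (hasDerivAt_fracSeries_one hb hr.1 hf).differentiableAt.differentiableWithinAt, ?_, ?_⟩
  · refine IntervalIntegrable.congr ?_ ((intervalIntegrable_rlKernel_conv_fracSeries hb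
      (sub_pos.2 hb1) hb ht hf.comp_succ).const_mul (Real.Gamma (1 - b)))
    rwa [uIoc_of_le ht.le]
  · rw [intervalIntegral.integral_of_le ht.le, ← setIntegral_congr_fun measurableSet_Ioc hkernel,
      integral_const_mul, ← intervalIntegral.integral_of_le ht.le,
      integral_rlKernel_conv_fracSeries hb (sub_pos.2 hb1) hb ht hf.comp_succ, sub_add_cancel,
      inv_mul_cancel_left₀ (Real.Gamma_pos_of_pos (sub_pos.2 hb1)).ne']

end Caputo

section MittagLefflerCoeff

variable {b ξ t : ℝ} {y : ℕ → ℝ}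

/-- The terms `(-ξ t^b)^m / Γ(b m + 1)` of the Mittag-Leffler series of `E_b(-ξ t^b)`. -/
def mlCoeff (b ξ t : ℝ) (m : ℕ) : ℝ := (-ξ * t ^ b) ^ m / Real.Gamma (b * m + 1)

lemma mlCoeff_eq (ht : 0 ≤ t) (m : ℕ) : mlCoeff b ξ t m = (-ξ) ^ m * rlKernel (b * m + 1) t := by
  rw [mlCoeff, rlKernel, mul_pow, add_sub_cancel_right, Real.rpow_mul_natCast ht, mul_div_assoc]

lemma mlCoeff_zero (hb : 0 < b) (m : ℕ) : mlCoeff b ξ 0 m = if m = 0 then 1 else 0 := by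
  rw [mlCoeff, Real.zero_rpow hb.ne', mul_zero]
  split_ifs with hm
  · rw [hm, pow_zero, Nat.cast_zero, mul_zero, zero_add, Real.Gamma_one, div_one]
  · rw [zero_pow hm, zero_div]

lemma tsum_mlCoeff_zero_mul (hb : 0 < b) : ∑' m, mlCoeff b ξ 0 m * y m = y 0 := by
  rw [tsum_eq_single 0 fun m hm => by rw [mlCoeff_zero hb, if_neg hm, zero_mul],
    mlCoeff_zero hb, if_pos rfl, one_mul]

lemma tsum_mlCoeff_mul (ht : 0 ≤ t) :
    ∑' m, mlCoeff b ξ t m * y m = fracSeries b 1 (fun m => (-ξ) ^ m * y m) t :=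
  tsum_congr fun m => by rw [mlCoeff_eq ht, mul_right_comm]

lemma summable_abs_mlCoeff_mul (hb : 0 < b) (ht : 0 ≤ t) (hy : ExpBounded y) :
    Summable fun m => |mlCoeff b ξ t m * y m| := by
  rcases ht.eq_or_lt with rfl | ht
  · refine summable_of_ne_finset_zero (s := {0}) fun m hm => ?_
    rw [mlCoeff_zero hb, if_neg (by simpa using hm), zero_mul, abs_zero]
  · simpa only [mlCoeff_eq ht.le, mul_right_comm] using
      summable_abs_mul_rlKernel hb one_pos ht ((ExpBounded.pow (-ξ)).mul hy)

/-- Termwise, the Caputo derivative of order `b` shifts the terms of `E_b(-ξ t^b)`. -/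
theorem hasCaputoDeriv_tsum_mlCoeff_mul (hb : 0 < b) (hb1 : b ≤ 1) (ht : 0 < t)
    (hy : ExpBounded y) :
    HasCaputoDeriv b (fun r => ∑' m, mlCoeff b ξ r m * y m) t
      (-ξ * ∑' m, mlCoeff b ξ t m * y (m + 1)) := by
  have hvalue : -ξ * ∑' m, mlCoeff b ξ t m * y (m + 1) =
      fracSeries b 1 (fun m => (-ξ) ^ (m + 1) * y (m + 1)) t := by
    rw [tsum_mlCoeff_mul ht.le, ← fracSeries_const_mul]
    congr 1
    ext m
    ring
  rw [hvalue]
  exact (hasCaputoDeriv_fracSeries_one hb hb1 ht ((ExpBounded.pow (-ξ)).mul hy)).congr ht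
    fun r hr => tsum_mlCoeff_mul hr

lemma mittagLeffler_eq_tsum_mlCoeff (b ξ t : ℝ) :
    mittagLeffler b (-ξ * t ^ b) = ∑' m, mlCoeff b ξ t m * 1 := by
  simp only [mul_one, mittagLeffler, mlCoeff]

theorem hasCaputoDeriv_mittagLeffler (hb : 0 < b) (hb1 : b ≤ 1) (ht : 0 < t) :
    HasCaputoDeriv b (fun r => mittagLeffler b (-ξ * r ^ b)) t
      (-ξ * mittagLeffler b (-ξ * t ^ b)) := by
  simp only [mittagLeffler_eq_tsum_mlCoeff]
  exact hasCaputoDeriv_tsum_mlCoeff_mul hb hb1 ht .one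

end MittagLefflerCoeff

section StateProb

variable {a b l ξ t : ℝ}

lemma sum_abs_coeff_mul_le (F G : ℝ⟦X⟧) (n : ℕ) :
    ∑ k ∈ Finset.range n, |PowerSeries.coeff k (F * G)| ≤
      (∑ k ∈ Finset.range n, |PowerSeries.coeff k F|) *
        ∑ k ∈ Finset.range n, |PowerSeries.coeff k G| := by
  calc ∑ k ∈ Finset.range n, |PowerSeries.coeff k (F * G)|
      ≤ ∑ k ∈ Finset.range n, ∑ i ∈ Finset.range (k + 1),
          |PowerSeries.coeff i F| * |PowerSeries.coeff (k - i) G| := by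
        refine Finset.sum_le_sum fun k _ => ?_
        rw [PowerSeries.coeff_mul, Finset.Nat.sum_antidiagonal_eq_sum_range_succ
          (fun i j => PowerSeries.coeff i F * PowerSeries.coeff j G)]
        refine (Finset.abs_sum_le_sum_abs _ _).trans_eq ?_
        simp only [abs_mul]
    _ = ∑ i ∈ Finset.range n, ∑ j ∈ Finset.range (n - i),
          |PowerSeries.coeff i F| * |PowerSeries.coeff j G| :=
        Finset.sum_range_diag_flip n
          fun i j => |PowerSeries.coeff i F| * |PowerSeries.coeff j G|
    _ ≤ _ := by
        rw [Finset.sum_mul_sum]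
        exact Finset.sum_le_sum fun i _ => Finset.sum_le_sum_of_subset_of_nonneg
          (Finset.range_subset_range.2 (Nat.sub_le _ _)) fun _ _ _ => by positivity

lemma abs_coeff_pow_le (F : ℝ⟦X⟧) (n m : ℕ) :
    |PowerSeries.coeff n (F ^ m)| ≤
      (∑ k ∈ Finset.range (n + 1), |PowerSeries.coeff k F|) ^ m := by
  suffices h : ∑ k ∈ Finset.range (n + 1), |PowerSeries.coeff k (F ^ m)| ≤
      (∑ k ∈ Finset.range (n + 1), |PowerSeries.coeff k F|) ^ m from
    (Finset.single_le_sum (f := fun k => |PowerSeries.coeff k (F ^ m)|)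
      (fun _ _ => abs_nonneg _) (Finset.self_mem_range_succ n)).trans h
  induction m with
  | zero =>
    simp only [pow_zero, PowerSeries.coeff_one, apply_ite abs, abs_one, abs_zero,
      Finset.sum_ite_eq', Finset.mem_range, Nat.succ_pos, if_true, le_refl]
  | succ m ih =>
    rw [pow_succ, pow_succ]
    exact (sum_abs_coeff_mul_le _ _ _).trans (by gcongr)

lemma ExpBounded.coeff_pow (F : ℝ⟦X⟧) (n : ℕ) :
    ExpBounded fun m => PowerSeries.coeff n (F ^ m) :=
  .of_abs_le_pow (Finset.sum_nonneg fun _ _ => abs_nonneg _) (abs_coeff_pow_le F n)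

lemma stateProb_eq_tsum_mlCoeff (a b l ξ : ℝ) (n : ℕ) :
    stateProb a b l ξ n =
      fun t => ∑' m, mlCoeff b ξ t m * PowerSeries.coeff n (discreteLaplacian a l ^ m) := rfl

theorem stateProb_zero (hb : 0 < b) (n : ℕ) :
    stateProb a b l ξ n 0 = if n = 0 then 1 else 0 := by
  rw [stateProb_eq_tsum_mlCoeff]
  beta_reduce
  rw [tsum_mlCoeff_zero_mul hb, pow_zero, PowerSeries.coeff_one]

theorem hasCaputoDeriv_stateProb (hb : 0 < b) (hb1 : b ≤ 1) (ht : 0 < t) (n : ℕ) :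
    HasCaputoDeriv b (stateProb a b l ξ n) t
      (-ξ * ∑ k ∈ Finset.range (n + 1), stateProb a b l ξ k t *
          PowerSeries.coeff (n - k) (discreteLaplacian a l)) := by
  set G := discreteLaplacian a l with hG
  have hsum : HasSum (fun m => mlCoeff b ξ t m * PowerSeries.coeff n (G ^ (m + 1)))
      (∑ k ∈ Finset.range (n + 1), stateProb a b l ξ k t * PowerSeries.coeff (n - k) G) := by
    have hterm (m : ℕ) : mlCoeff b ξ t m * PowerSeries.coeff n (G ^ (m + 1)) =
        ∑ k ∈ Finset.range (n + 1), mlCoeff b ξ t m * PowerSeries.coeff k (G ^ m) *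
          PowerSeries.coeff (n - k) G := by
      rw [pow_succ, PowerSeries.coeff_mul, Finset.Nat.sum_antidiagonal_eq_sum_range_succ
        (fun i j => PowerSeries.coeff i (G ^ m) * PowerSeries.coeff j G), Finset.mul_sum]
      simp only [mul_assoc]
    simp only [hterm]
    exact hasSum_sum fun k _ => ((summable_abs_mlCoeff_mul hb ht.le
      (.coeff_pow G k)).of_abs.hasSum).mul_right _
  rw [← hsum.tsum_eq, stateProb_eq_tsum_mlCoeff, ← hG]
  exact hasCaputoDeriv_tsum_mlCoeff_mul hb hb1 ht (.coeff_pow G n)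

end StateProb

/-! ### Coefficients of powers of the normalized Laplacian -/

section Multichoose

lemma multichoose_eq_ascPochhammer_div (r : ℝ) (n : ℕ) :
    Ring.multichoose r n = (ascPochhammer ℝ n).eval r / n.factorial := by
  rw [← Polynomial.ascPochhammer_smeval_eq_eval,
    ← Ring.factorial_nsmul_multichoose_eq_ascPochhammer, nsmul_eq_mul,
    mul_div_cancel_left₀ _ (Nat.cast_ne_zero.2 n.factorial_ne_zero)]

lemma multichoose_succ_eq_mul_div (r : ℝ) (n : ℕ) :
    Ring.multichoose r (n + 1) = Ring.multichoose r n * ((r + n) / (n + 1)) := by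
  have : (n.factorial : ℝ) ≠ 0 := Nat.cast_ne_zero.2 n.factorial_ne_zero
  rw [multichoose_eq_ascPochhammer_div, multichoose_eq_ascPochhammer_div, ascPochhammer_succ_eval,
    Nat.factorial_succ]
  push_cast
  field_simp

lemma multichoose_nonneg {r : ℝ} (hr : 0 ≤ r) (n : ℕ) : 0 ≤ Ring.multichoose r n := by
  induction n with
  | zero => rw [Ring.multichoose_zero_right]; exact zero_le_one
  | succ n ih => rw [multichoose_succ_eq_mul_div]; positivity

lemma multichoose_le_multichoose {r r' : ℝ} (hr : 0 ≤ r) (h : r ≤ r') (n : ℕ) :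
    Ring.multichoose r n ≤ Ring.multichoose r' n := by
  induction n with
  | zero => rw [Ring.multichoose_zero_right, Ring.multichoose_zero_right]
  | succ n ih =>
    rw [multichoose_succ_eq_mul_div, multichoose_succ_eq_mul_div]
    have := multichoose_nonneg hr n
    have := multichoose_nonneg (hr.trans h) n
    gcongr

lemma multichoose_neg_succ_nonpos {a : ℝ} (ha : 0 ≤ a) (ha1 : a ≤ 1) (n : ℕ) :
    Ring.multichoose (-a) (n + 1) ≤ 0 := by
  induction n with
  | zero => rwa [zero_add, Ring.multichoose_one_right, neg_nonpos]
  | succ n ih =>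
    rw [multichoose_succ_eq_mul_div]
    refine mul_nonpos_of_nonpos_of_nonneg ih (div_nonneg ?_ (by positivity))
    push_cast
    linarith [n.cast_nonneg (α := ℝ)]

lemma multichoose_natCast_le_two_pow (m s : ℕ) :
    Ring.multichoose (m : ℝ) s ≤ 2 ^ (m + s) := by
  induction m generalizing s with
  | zero => cases s with
    | zero => norm_num
    | succ s => rw [Nat.cast_zero, Ring.multichoose_zero_succ]; positivity
  | succ m ihm => induction s with
    | zero => rw [Ring.multichoose_zero_right]; exact one_le_pow₀ one_le_two
    | succ s ihs =>
      rw [Nat.cast_succ, Ring.multichoose_succ_succ, ← Nat.cast_succ]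
      calc Ring.multichoose (m : ℝ) (s + 1) + Ring.multichoose ((m + 1 : ℕ) : ℝ) s
          ≤ 2 ^ (m + (s + 1)) + 2 ^ (m + 1 + s) := add_le_add (ihm _) ihs
        _ = 2 ^ (m + 1 + (s + 1)) := by ring

lemma multichoose_mul_natCast_le {a : ℝ} (ha : 0 ≤ a) (ha1 : a ≤ 1) (s n : ℕ) :
    Ring.multichoose (a * s) n ≤ 2 ^ (s + n) :=
  (multichoose_le_multichoose (by positivity)
    (mul_le_of_le_one_left (Nat.cast_nonneg s) ha1) n).trans (multichoose_natCast_le_two_pow s n)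

end Multichoose

section FracLaplacian

lemma coeff_fracLaplacian (a : ℝ) (n : ℕ) :
    PowerSeries.coeff n (fracLaplacian a) = Ring.multichoose (-a) n := by
  have hchoose := Ring.choose_neg' (-a) n
  rw [neg_neg, Units.smul_def, zsmul_eq_mul, Int.cast_negOnePow_natCast] at hchoose
  rw [fracLaplacian, PowerSeries.coeff_mk, hchoose, ← mul_assoc, ← mul_pow, neg_one_mul, neg_neg,
    one_pow, one_mul]

lemma fracLaplacian_add (a b : ℝ) :
    fracLaplacian (a + b) = fracLaplacian a * fracLaplacian b := by
  have hbinomial (a : ℝ) : fracLaplacian a =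
      PowerSeries.rescale (-1 : ℝ) (PowerSeries.binomialSeries ℝ a) := by
    ext n
    rw [fracLaplacian, PowerSeries.coeff_mk, PowerSeries.coeff_rescale,
      PowerSeries.binomialSeries_coeff, smul_eq_mul, mul_one]
  rw [hbinomial, hbinomial, hbinomial, PowerSeries.binomialSeries_add, map_mul]

lemma constantCoeff_fracLaplacian (a : ℝ) : PowerSeries.constantCoeff (fracLaplacian a) = 1 := by
  rw [← PowerSeries.coeff_zero_eq_constantCoeff_apply, coeff_fracLaplacian,
    Ring.multichoose_zero_right]

lemma fracLaplacian_zero : fracLaplacian 0 = 1 := by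
  ext n
  rw [coeff_fracLaplacian, neg_zero, PowerSeries.coeff_one]
  cases n with
  | zero => rw [Ring.multichoose_zero_right, if_pos rfl]
  | succ n => rw [Ring.multichoose_zero_succ, if_neg n.succ_ne_zero]

lemma sum_multichoose_mul_multichoose (a b : ℝ) (n : ℕ) :
    ∑ p ∈ Finset.HasAntidiagonal.antidiagonal n,
      Ring.multichoose a p.1 * Ring.multichoose b p.2 = Ring.multichoose (a + b) n := by
  have hcoeff := congrArg (PowerSeries.coeff n) (fracLaplacian_add (-a) (-b))
  simp only [PowerSeries.coeff_mul, coeff_fracLaplacian, neg_add_rev, neg_neg] at hcoeff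
  rw [add_comm a b, hcoeff]

end FracLaplacian

section DiscreteLaplacian

variable {a l : ℝ}

lemma constantCoeff_C_add_fracLaplacian (a l : ℝ) :
    PowerSeries.constantCoeff (PowerSeries.C l + fracLaplacian a) = l + 1 := by
  rw [map_add, constantCoeff_fracLaplacian, PowerSeries.constantCoeff_C]

lemma C_add_fracLaplacian_mul_inv (hl : 0 < l) :
    (PowerSeries.C l + fracLaplacian a) * (PowerSeries.C l + fracLaplacian a)⁻¹ = 1 :=
  PowerSeries.mul_inv_cancel _ (by rw [constantCoeff_C_add_fracLaplacian]; positivity)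

lemma constantCoeff_discreteLaplacian (hl : 0 < l) :
    PowerSeries.constantCoeff (discreteLaplacian a l) = 1 := by
  rw [discreteLaplacian, map_mul, map_mul, PowerSeries.constantCoeff_inv,
    constantCoeff_C_add_fracLaplacian, PowerSeries.constantCoeff_C, constantCoeff_fracLaplacian]
  field_simp

lemma coeff_zero_discreteLaplacian_pow (hl : 0 < l) (m : ℕ) :
    PowerSeries.coeff 0 (discreteLaplacian a l ^ m) = 1 := by
  rw [PowerSeries.coeff_zero_eq_constantCoeff_apply, map_pow, constantCoeff_discreteLaplacian hl,
    one_pow]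

lemma coeff_inv_C_add_fracLaplacian_nonneg (ha : 0 ≤ a) (ha1 : a ≤ 1) (hl : 0 < l) (n : ℕ) :
    0 ≤ PowerSeries.coeff n (PowerSeries.C l + fracLaplacian a)⁻¹ := by
  induction n using Nat.strong_induction_on with | _ n ih
  rw [PowerSeries.coeff_inv, constantCoeff_C_add_fracLaplacian]
  split_ifs with hn
  · positivity
  rw [neg_mul, ← mul_neg, ← Finset.sum_neg_distrib]
  refine mul_nonneg (by positivity) (Finset.sum_nonneg fun p hp => ?_)
  split_ifs with hlt
  · obtain ⟨k, hk⟩ : ∃ k, p.1 = k + 1 :=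
      Nat.exists_eq_add_one.2 (by have := Finset.HasAntidiagonal.mem_antidiagonal.1 hp; omega)
    rw [map_add, hk, coeff_fracLaplacian, PowerSeries.coeff_C, if_neg k.succ_ne_zero, zero_add,
      ← neg_mul]
    exact mul_nonneg (neg_nonneg.2 (multichoose_neg_succ_nonpos ha ha1 k)) (ih _ hlt)
  · rw [neg_zero]

lemma coeff_succ_discreteLaplacian_nonpos (ha : 0 ≤ a) (ha1 : a ≤ 1) (hl : 0 < l) (n : ℕ) :
    PowerSeries.coeff (n + 1) (discreteLaplacian a l) ≤ 0 := by
  have hquot : fracLaplacian a * (PowerSeries.C l + fracLaplacian a)⁻¹ =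
      1 - PowerSeries.C l * (PowerSeries.C l + fracLaplacian a)⁻¹ := by
    rw [← C_add_fracLaplacian_mul_inv hl]
    ring
  have hinv := coeff_inv_C_add_fracLaplacian_nonneg ha ha1 hl (n + 1)
  rw [discreteLaplacian, mul_assoc, hquot, PowerSeries.coeff_C_mul, map_sub,
    PowerSeries.coeff_C_mul, PowerSeries.coeff_one, if_neg n.succ_ne_zero, zero_sub, mul_neg]
  exact neg_nonpos.2 (by positivity)

lemma summable_multichoose_mul_multichoose (ha : 0 ≤ a) (ha1 : a ≤ 1) (hl : 0 < l)
    (hl4 : l < 1 / 4) (m n : ℕ) :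
    Summable fun s : ℕ => Ring.multichoose (m : ℝ) s * (-l) ^ s * Ring.multichoose (a * s) n := by
  refine Summable.of_norm_bounded (g := fun s : ℕ => 2 ^ (m + n) * (4 * l) ^ s)
    ((summable_geometric_of_lt_one (by positivity) (by linarith)).mul_left _) fun s => ?_
  have hm := multichoose_nonneg m.cast_nonneg s
  have hn := multichoose_nonneg (show 0 ≤ a * s by positivity) n
  calc ‖Ring.multichoose (m : ℝ) s * (-l) ^ s * Ring.multichoose (a * s) n‖
      = Ring.multichoose (m : ℝ) s * l ^ s * Ring.multichoose (a * s) n := by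
        rw [norm_mul, norm_mul, norm_pow, norm_neg, Real.norm_of_nonneg hm,
          Real.norm_of_nonneg hl.le, Real.norm_of_nonneg hn]
    _ ≤ 2 ^ (m + s) * l ^ s * 2 ^ (s + n) := by
        gcongr
        · exact multichoose_natCast_le_two_pow m s
        · exact multichoose_mul_natCast_le ha ha1 s n
    _ = 2 ^ (m + n) * (4 * l) ^ s := by
        rw [show (4 : ℝ) * l = 2 * 2 * l by ring, mul_pow, mul_pow]
        ring

/-- The power series of `(1 + l (1 - u)^(-a))^(-m)`, expanded in powers of `l` by the binomial
theorem (meaningful for `|l| < 1 / 4`, where the expansions of the coefficients converge). -/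
def prabhakarSeries (a l : ℝ) (m : ℕ) : ℝ⟦X⟧ :=
  PowerSeries.mk fun n =>
    ∑' s : ℕ, Ring.multichoose (m : ℝ) s * (-l) ^ s * Ring.multichoose (a * s) n

lemma prabhakarSeries_zero (a l : ℝ) : prabhakarSeries a l 0 = 1 := by
  ext n
  rw [prabhakarSeries, PowerSeries.coeff_mk, ← fracLaplacian_zero, coeff_fracLaplacian,
    tsum_eq_single 0]
  · simp only [Nat.cast_zero, Ring.multichoose_zero_right, pow_zero, mul_one, mul_zero, one_mul,
      neg_zero]
  · intro s hs
    obtain ⟨k, rfl⟩ := Nat.exists_eq_succ_of_ne_zero hs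
    rw [Nat.cast_zero, Ring.multichoose_zero_succ, zero_mul, zero_mul]

lemma coeff_fracLaplacian_neg_mul_prabhakarSeries (ha : 0 ≤ a) (ha1 : a ≤ 1) (hl : 0 < l)
    (hl4 : l < 1 / 4) (m n : ℕ) :
    HasSum (fun s : ℕ => Ring.multichoose (m : ℝ) s * (-l) ^ s *
        Ring.multichoose (a * (s + 1 : ℕ)) n)
      (PowerSeries.coeff n (fracLaplacian (-a) * prabhakarSeries a l m)) := by
  simp only [PowerSeries.coeff_mul, prabhakarSeries, PowerSeries.coeff_mk, coeff_fracLaplacian,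
    neg_neg]
  refine (hasSum_sum fun p _ => ((summable_multichoose_mul_multichoose ha ha1 hl hl4 m
    p.2).hasSum.mul_left (Ring.multichoose a p.1))).congr_fun fun s => ?_
  rw [Nat.cast_succ, mul_add, mul_one, add_comm, ← sum_multichoose_mul_multichoose, Finset.mul_sum]
  exact Finset.sum_congr rfl fun p _ => by ring

/-- Pascal's rule for the binomial coefficients of the exponents `m` and `m + 1`. -/
lemma one_add_mul_prabhakarSeries_succ (ha : 0 ≤ a) (ha1 : a ≤ 1) (hl : 0 < l) (hl4 : l < 1 / 4)
    (m : ℕ) :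
    (1 + PowerSeries.C l * fracLaplacian (-a)) * prabhakarSeries a l (m + 1) =
      prabhakarSeries a l m := by
  ext n
  have hsum (m : ℕ) := summable_multichoose_mul_multichoose ha ha1 hl hl4 m n
  have hshift := coeff_fracLaplacian_neg_mul_prabhakarSeries ha ha1 hl hl4 (m + 1) n
  rw [add_mul, one_mul, map_add, mul_assoc, PowerSeries.coeff_C_mul, ← hshift.tsum_eq,
    prabhakarSeries, prabhakarSeries, PowerSeries.coeff_mk, PowerSeries.coeff_mk,
    (hsum (m + 1)).tsum_eq_zero_add, (hsum m).tsum_eq_zero_add, add_assoc, ← tsum_mul_left,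
    ← ((summable_nat_add_iff 1).2 (hsum (m + 1))).tsum_add (hshift.summable.mul_left _)]
  congr 1
  · rw [Ring.multichoose_zero_right, Ring.multichoose_zero_right]
  · refine tsum_congr fun s => ?_
    rw [Nat.cast_succ m, Ring.multichoose_succ_succ, pow_succ]
    ring

lemma prabhakarSeries_eq_pow (ha : 0 ≤ a) (ha1 : a ≤ 1) (hl : 0 < l) (hl4 : l < 1 / 4) (m : ℕ) :
    prabhakarSeries a l m = (fracLaplacian a * (PowerSeries.C l + fracLaplacian a)⁻¹) ^ m := by
  have hcancel : fracLaplacian a * (PowerSeries.C l + fracLaplacian a)⁻¹ *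
      (1 + PowerSeries.C l * fracLaplacian (-a)) = 1 := by
    have hneg : fracLaplacian a * fracLaplacian (-a) = 1 := by
      rw [← fracLaplacian_add, add_neg_cancel, fracLaplacian_zero]
    linear_combination C_add_fracLaplacian_mul_inv (a := a) hl +
      PowerSeries.C l * (PowerSeries.C l + fracLaplacian a)⁻¹ * hneg
  induction m with
  | zero => rw [prabhakarSeries_zero, pow_zero]
  | succ m ih =>
    rw [pow_succ', ← ih, ← one_add_mul_prabhakarSeries_succ ha ha1 hl hl4 m, ← mul_assoc, hcancel,
      one_mul]

lemma coeff_discreteLaplacian_pow (ha : 0 ≤ a) (ha1 : a ≤ 1) (hl : 0 < l) (hl4 : l < 1 / 4)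
    (m : ℕ) {n : ℕ} (hn : n ≠ 0) :
    PowerSeries.coeff n (discreteLaplacian a l ^ m) = (l + 1) ^ m *
      ∑' s : ℕ, Ring.multichoose (m : ℝ) (s + 1) * (-l) ^ (s + 1) *
        Ring.multichoose (a * (s + 1 : ℕ)) n := by
  obtain ⟨k, rfl⟩ := Nat.exists_eq_succ_of_ne_zero hn
  rw [discreteLaplacian, mul_assoc, mul_pow, ← prabhakarSeries_eq_pow ha ha1 hl hl4, ← map_pow,
    PowerSeries.coeff_C_mul, prabhakarSeries, PowerSeries.coeff_mk,
    (summable_multichoose_mul_multichoose ha ha1 hl hl4 m _).tsum_eq_zero_add, Nat.cast_zero,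
    mul_zero, Ring.multichoose_zero_succ, mul_zero, zero_add]

end DiscreteLaplacian

/-! ### Lattice asymptotics -/

section MultichooseGamma

variable {a p x : ℝ} {n : ℕ}

/-- Log-convexity of `Γ` at the point `x + p` of the segment from `x` to `x + p + 1`. -/
lemma Gamma_add_le_rpow_mul_Gamma (hx : 0 < x) (hp : 0 < p) :
    Real.Gamma (x + p) ≤ (x + p) ^ p * Real.Gamma x := by
  have hΓ : 0 < Real.Gamma (x + p) := Real.Gamma_pos_of_pos (by positivity)
  have hΓx : 0 < Real.Gamma x := Real.Gamma_pos_of_pos hx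
  have hconv := Real.Gamma_mul_add_mul_le_rpow_Gamma_mul_rpow_Gamma (s := x) (t := x + p + 1)
    (a := 1 / (p + 1)) (b := p / (p + 1)) hx (by positivity) (by positivity) (by positivity)
    (by field_simp; ring)
  rw [show 1 / (p + 1) * x + p / (p + 1) * (x + p + 1) = x + p by field_simp; ring,
    Real.Gamma_add_one (by positivity)] at hconv
  have hpow := Real.rpow_le_rpow hΓ.le hconv (show 0 ≤ p + 1 by positivity)
  rw [Real.mul_rpow (by positivity) (by positivity), ← Real.rpow_mul hΓx.le,
    ← Real.rpow_mul (by positivity), one_div_mul_cancel (by positivity),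
    div_mul_cancel₀ _ (by positivity), Real.rpow_one, Real.mul_rpow (by positivity) hΓ.le,
    Real.rpow_add_one hΓ.ne'] at hpow
  refine le_of_mul_le_mul_left ?_ (Real.rpow_pos_of_pos hΓ p)
  linarith

lemma multichoose_eq_Gamma_div (hp : 0 < p) (n : ℕ) :
    Ring.multichoose p n = Real.Gamma (n + p) / (Real.Gamma p * n.factorial) := by
  have := Real.Gamma_pos_of_pos hp
  induction n with
  | zero => simp [this.ne']
  | succ n ih =>
    have : (n.factorial : ℝ) ≠ 0 := Nat.cast_ne_zero.2 n.factorial_ne_zero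
    rw [multichoose_succ_eq_mul_div, ih, Nat.factorial_succ, Nat.cast_succ, add_right_comm,
      Real.Gamma_add_one (by positivity)]
    push_cast
    field_simp
    ring

lemma multichoose_le_rpow_div (hp : 0 < p) (hn : n ≠ 0) :
    Ring.multichoose p n ≤ (n + p) ^ p / (n * Real.Gamma p) := by
  have := Real.Gamma_pos_of_pos hp
  have hn' : (0 : ℝ) < n := by positivity
  have hfact : (n.factorial : ℝ) = n * Real.Gamma n := by
    rw [← Real.Gamma_add_one hn'.ne', Real.Gamma_nat_eq_factorial]
  have := Real.Gamma_pos_of_pos hn'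
  rw [multichoose_eq_Gamma_div hp, hfact, div_le_div_iff₀ (by positivity) (by positivity)]
  calc Real.Gamma (n + p) * (n * Real.Gamma p)
      ≤ (n + p) ^ p * Real.Gamma n * (n * Real.Gamma p) := by
        gcongr; exact Gamma_add_le_rpow_mul_Gamma hn' hp
    _ = _ := by ring

lemma add_mul_rpow_div_Gamma_le {c h R : ℝ} (hp : 0 < p) (hc : 0 < c) (hh : 0 ≤ h) (hR : 0 ≤ R)
    (hch : c * h ≤ 1) :
    (R + p * h) ^ p / Real.Gamma p ≤ p * Real.exp (c * R) * (Real.exp 1 / c) ^ p := by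
  have hΓ := Real.Gamma_pos_of_pos hp
  have hbase := rpow_mul_exp_neg_le_Gamma_add_one (T := c * (R + p * h)) (by positivity) hp.le
  rw [Real.Gamma_add_one hp.ne', Real.exp_neg, ← div_eq_mul_inv, div_le_iff₀ (Real.exp_pos _),
    Real.mul_rpow hc.le (by positivity)] at hbase
  have hexp : Real.exp (c * (R + p * h)) ≤ Real.exp (c * R) * Real.exp 1 ^ p := by
    rw [← Real.exp_mul, ← Real.exp_add]
    gcongr
    nlinarith
  rw [div_le_iff₀ hΓ, Real.div_rpow (Real.exp_pos _).le hc.le, mul_div_assoc',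
    div_mul_eq_mul_div, le_div_iff₀' (by positivity)]
  calc c ^ p * (R + p * h) ^ p ≤ p * Real.Gamma p * Real.exp (c * (R + p * h)) := hbase
    _ ≤ p * Real.Gamma p * (Real.exp (c * R) * Real.exp 1 ^ p) := by gcongr
    _ = _ := by ring

lemma add_mul_rpow_le {h R : ℝ} (ha : 0 ≤ a) (ha1 : a ≤ 1) (hap : a ≤ p) (hp : 0 ≤ p)
    (hh : 0 < h) (hhx : h ≤ x) (hxR : x ≤ R) :
    (x + p * h) ^ p ≤ x ^ a * (1 + p) * (R ^ (-a) * (R + p * h) ^ p) := by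
  have hx : 0 < x := hh.trans_le hhx
  have hR : 0 < R := hx.trans_le hxR
  have hph : 0 ≤ p * h := by positivity
  have hlow : (x + p * h) ^ a ≤ x ^ a * (1 + p) := by
    calc (x + p * h) ^ a ≤ (x * (1 + p)) ^ a := by gcongr; nlinarith
      _ = x ^ a * (1 + p) ^ a := Real.mul_rpow hx.le (by positivity)
      _ ≤ x ^ a * (1 + p) := by
        gcongr; exact Real.rpow_le_self_of_one_le (by linarith) ha1
  have hhigh : (R + p * h) ^ (p - a) ≤ R ^ (-a) * (R + p * h) ^ p := by
    rw [sub_eq_neg_add, Real.rpow_add (by positivity)]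
    exact mul_le_mul_of_nonneg_right
      (Real.rpow_le_rpow_of_nonpos hR (by linarith) (by linarith)) (by positivity)
  calc (x + p * h) ^ p = (x + p * h) ^ a * (x + p * h) ^ (p - a) := by
        rw [← Real.rpow_add (by positivity), add_sub_cancel]
    _ ≤ x ^ a * (1 + p) * (R + p * h) ^ (p - a) := by gcongr
    _ ≤ _ := by gcongr

lemma rpow_mul_multichoose_div_le {c h R : ℝ} (ha : 0 ≤ a) (ha1 : a ≤ 1) (hap : a ≤ p)
    (hp : 0 < p) (hc : 0 < c) (hh : 0 < h) (hch : c * h ≤ 1) (hn : n ≠ 0) (hnR : n * h ≤ R) :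
    h ^ p * Ring.multichoose p n / h ≤
      2 * R ^ (-a) * Real.exp (c * R) * (Real.exp 2 / c) ^ p * (n * h) ^ (a - 1) := by
  have := Real.Gamma_pos_of_pos hp
  have hx : 0 < n * h := by positivity
  have hR : 0 < R := hx.trans_le hnR
  have hhx : h ≤ n * h :=
    le_mul_of_one_le_left hh.le (Nat.one_le_cast.2 (Nat.one_le_iff_ne_zero.2 hn))
  have hpoly : (1 + p) * p ≤ 2 * Real.exp 1 ^ p := by
    rw [← Real.exp_mul, one_mul]
    linarith [Real.quadratic_le_exp_of_nonneg hp.le]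
  have hexp : (Real.exp 2 / c) ^ p = (Real.exp 1 / c) ^ p * Real.exp 1 ^ p := by
    rw [← Real.mul_rpow (by positivity) (by positivity), div_mul_eq_mul_div, ← Real.exp_add,
      one_add_one_eq_two]
  calc h ^ p * Ring.multichoose p n / h
      ≤ h ^ p * ((n + p) ^ p / (n * Real.Gamma p)) / h := by
        gcongr; exact multichoose_le_rpow_div hp hn
    _ = (n * h + p * h) ^ p / Real.Gamma p / (n * h) := by
        rw [← add_mul, Real.mul_rpow (by positivity) hh.le]
        field_simp
    _ ≤ (n * h) ^ a * (1 + p) * (R ^ (-a) * (R + p * h) ^ p) / Real.Gamma p / (n * h) := by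
        gcongr; exact add_mul_rpow_le ha ha1 hap hp.le hh hhx hnR
    _ = R ^ (-a) * (n * h) ^ (a - 1) * (1 + p) * ((R + p * h) ^ p / Real.Gamma p) := by
        rw [Real.rpow_sub_one hx.ne']
        ring
    _ ≤ R ^ (-a) * (n * h) ^ (a - 1) * (1 + p) *
          (p * Real.exp (c * R) * (Real.exp 1 / c) ^ p) := by
        gcongr; exact add_mul_rpow_div_Gamma_le hp hc hh.le hR.le hch
    _ = R ^ (-a) * (n * h) ^ (a - 1) * Real.exp (c * R) * (Real.exp 1 / c) ^ p *
          ((1 + p) * p) := by ring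
    _ ≤ R ^ (-a) * (n * h) ^ (a - 1) * Real.exp (c * R) * (Real.exp 1 / c) ^ p *
          (2 * Real.exp 1 ^ p) := by gcongr
    _ = _ := by rw [hexp]; ring

end MultichooseGamma

section Lattice

variable {a b l ξ t x R : ℝ}

/-- The decay rate `ρ` is arbitrary because `c` is: the bound for exponent `a s` at scale `c`
carries the factor `(l (e² / c)^a)^s`. -/
lemma exists_eventually_multichoose_lattice_le (ha : 0 < a) (ha1 : a ≤ 1) (hl : 0 < l)
    (hR : 0 < R) {ρ : ℝ} (hρ : 0 < ρ) :
    ∃ C : ℝ, 0 ≤ C ∧ ∀ᶠ h : ℝ in 𝓝[>] 0, ∀ n : ℕ, n ≠ 0 → n * h ≤ R → ∀ s : ℕ, s ≠ 0 →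
      (l * h ^ a) ^ s * Ring.multichoose (a * s) n / h ≤ C * ρ ^ s * (n * h) ^ (a - 1) := by
  set c : ℝ := Real.exp 2 / (ρ / l) ^ a⁻¹
  have hc : 0 < c := by positivity
  have hscale : l * (Real.exp 2 / c) ^ a = ρ := by
    rw [div_div_cancel₀ (Real.exp_ne_zero 2), Real.rpow_inv_rpow (by positivity) ha.ne',
      mul_div_cancel₀ _ hl.ne']
  refine ⟨2 * R ^ (-a) * Real.exp (c * R), by positivity, ?_⟩
  have hsmall : ∀ᶠ h : ℝ in 𝓝[>] 0, c * h < 1 :=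
    ((continuous_const_mul c).tendsto' 0 0 (mul_zero c)).mono_left nhdsWithin_le_nhds
      |>.eventually_lt_const one_pos
  filter_upwards [hsmall, self_mem_nhdsWithin] with h hch (hh : 0 < h) n hn hnR s hs
  have hs1 : (1 : ℝ) ≤ s := Nat.one_le_cast.2 (Nat.one_le_iff_ne_zero.2 hs)
  have hbound := rpow_mul_multichoose_div_le (p := a * s) ha.le ha1
    (le_mul_of_one_le_right ha.le hs1) (by positivity) hc hh hch.le hn hnR
  calc (l * h ^ a) ^ s * Ring.multichoose (a * s) n / h
      = l ^ s * (h ^ (a * s) * Ring.multichoose (a * s) n / h) := by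
        rw [mul_pow, Real.rpow_mul hh.le, Real.rpow_natCast]
        ring
    _ ≤ l ^ s * (2 * R ^ (-a) * Real.exp (c * R) * (Real.exp 2 / c) ^ (a * s) *
          (n * h) ^ (a - 1)) := by gcongr
    _ = _ := by
        rw [← hscale, mul_pow, Real.rpow_mul (by positivity), Real.rpow_natCast]
        ring

lemma prod_range_add_natCast (a : ℝ) (n : ℕ) :
    ∏ j ∈ Finset.range n, (a + j) = n.factorial * Ring.multichoose a n := by
  induction n with
  | zero => simp
  | succ n ih =>
    rw [Finset.prod_range_succ, ih, multichoose_succ_eq_mul_div, Nat.factorial_succ]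
    push_cast
    field_simp

lemma tendsto_multichoose_mul_rpow (ha : 0 < a) :
    Tendsto (fun n : ℕ => Ring.multichoose a n * (n : ℝ) ^ (1 - a)) atTop
      (𝓝 (Real.Gamma a)⁻¹) := by
  have hlim := (tendsto_natCast_div_add_atTop a).mul
    ((Real.GammaSeq_tendsto_Gamma a).inv₀ (Real.Gamma_pos_of_pos ha).ne')
  rw [one_mul] at hlim
  refine hlim.congr' ?_
  filter_upwards [eventually_gt_atTop 0] with n hn
  have hn' : (0 : ℝ) < n := Nat.cast_pos.2 hn
  have hfact : (n.factorial : ℝ) ≠ 0 := Nat.cast_ne_zero.2 n.factorial_ne_zero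
  rw [Real.GammaSeq, Finset.prod_range_succ, prod_range_add_natCast, Real.rpow_sub hn',
    Real.rpow_one, inv_div, add_comm a]
  field_simp

lemma tendsto_floor_div_mul (hx : 0 < x) :
    Tendsto (fun h : ℝ => (⌊x / h⌋₊ : ℝ) * h) (𝓝[>] 0) (𝓝 x) :=
  ((tendsto_nat_floor_mul_div_atTop hx.le).comp tendsto_inv_nhdsGT_zero).congr fun h => by
    rw [Function.comp_apply, div_inv_eq_mul, div_eq_mul_inv x]

lemma tendsto_floor_div_atTop (hx : 0 < x) :
    Tendsto (fun h : ℝ => ⌊x / h⌋₊) (𝓝[>] 0) atTop :=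
  tendsto_nat_floor_atTop.comp (tendsto_inv_nhdsGT_zero.const_mul_atTop hx)

lemma tendsto_rpow_mul_multichoose_floor (ha : 0 < a) (hx : 0 < x) :
    Tendsto (fun h : ℝ => h ^ (a - 1) * Ring.multichoose a ⌊x / h⌋₊) (𝓝[>] 0)
      (𝓝 (rlKernel a x)) := by
  refine (((tendsto_floor_div_mul hx).rpow_const (p := a - 1) (Or.inl hx.ne')).mul
    ((tendsto_multichoose_mul_rpow ha).comp (tendsto_floor_div_atTop hx))).congr' ?_
  filter_upwards [(tendsto_floor_div_atTop hx).eventually_gt_atTop 0, self_mem_nhdsWithin]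
    with h hn (hh : 0 < h)
  have hn' : (0 : ℝ) < ⌊x / h⌋₊ := Nat.cast_pos.2 hn
  rw [Function.comp_apply, Real.mul_rpow hn'.le hh.le, ← neg_sub a 1, Real.rpow_neg hn'.le]
  field_simp

end Lattice

section LatticeLimit

variable {a b l ξ t x R z : ℝ}

lemma tendsto_mul_rpow_nhdsGT (l : ℝ) (ha : 0 < a) :
    Tendsto (fun h : ℝ => l * h ^ a) (𝓝[>] 0) (𝓝 0) :=
  (((Real.continuous_rpow_const ha.le).const_mul l).tendsto' 0 0
    (by rw [Real.zero_rpow ha.ne', mul_zero])).mono_left nhdsWithin_le_nhds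

lemma eventually_mul_rpow_lt (l : ℝ) {ε : ℝ} (ha : 0 < a) (hε : 0 < ε) :
    ∀ᶠ h : ℝ in 𝓝[>] 0, l * h ^ a < ε :=
  (tendsto_mul_rpow_nhdsGT l ha).eventually_lt_const hε

lemma eventually_floor_div (hx : 0 < x) (p : ℝ) :
    ∀ᶠ h : ℝ in 𝓝[>] 0, ⌊x / h⌋₊ ≠ 0 ∧ ⌊x / h⌋₊ * h ≤ x ∧
      ((⌊x / h⌋₊ : ℝ) * h) ^ p ≤ x ^ p + 1 := by
  filter_upwards [(tendsto_floor_div_atTop hx).eventually_ne_atTop 0, self_mem_nhdsWithin,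
    ((tendsto_floor_div_mul hx).rpow_const (Or.inl hx.ne')).eventually_le_const
      (lt_add_one (x ^ p))] with h hn (hh : 0 < h) hpow
  exact ⟨hn, (le_div_iff₀ hh).1 (Nat.floor_le (by positivity)), hpow⟩

lemma exists_eventually_multichoose_term_le (ha : 0 < a) (ha1 : a ≤ 1) (hl : 0 < l)
    (hR : 0 < R) :
    ∃ C : ℝ, 0 ≤ C ∧ ∀ᶠ h : ℝ in 𝓝[>] 0, ∀ n : ℕ, n ≠ 0 → n * h ≤ R → ∀ m s : ℕ,
      ‖Ring.multichoose (m : ℝ) (s + 1) * (-(l * h ^ a)) ^ (s + 1) *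
        Ring.multichoose (a * (s + 1 : ℕ)) n / h‖ ≤
      2 ^ m * C * (n * h) ^ (a - 1) * (1 / 2) ^ s := by
  obtain ⟨C, hC, hev⟩ :=
    exists_eventually_multichoose_lattice_le ha ha1 hl hR (show (0 : ℝ) < 1 / 4 by norm_num)
  refine ⟨C, hC, ?_⟩
  filter_upwards [hev, self_mem_nhdsWithin] with h hbound (hh : 0 < h) n hn hnR m s
  have h₁ := multichoose_nonneg m.cast_nonneg (s + 1) (r := (m : ℝ))
  have h₂ := multichoose_nonneg (show 0 ≤ a * (s + 1 : ℕ) by positivity) n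
  rw [mul_assoc, mul_div_assoc, norm_mul, norm_div, norm_mul, norm_pow, norm_neg,
    Real.norm_of_nonneg h₁, Real.norm_of_nonneg h₂,
    Real.norm_of_nonneg (show 0 ≤ l * h ^ a by positivity), Real.norm_of_nonneg hh.le]
  calc _ ≤ 2 ^ (m + (s + 1)) * (C * (1 / 4) ^ (s + 1) * (n * h) ^ (a - 1)) := by
        gcongr
        exacts [multichoose_natCast_le_two_pow m (s + 1), hbound n hn hnR (s + 1) s.succ_ne_zero]
    _ = 2 ^ m * C * (n * h) ^ (a - 1) * (1 / 2) ^ (s + 1) := by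
        rw [pow_add, show (1 / 2 : ℝ) = 2 * (1 / 4) by norm_num, mul_pow]
        ring
    _ ≤ _ := by
        gcongr _ * ?_
        exact pow_le_pow_of_le_one (by norm_num) (by norm_num) s.le_succ

lemma exists_eventually_coeff_discreteLaplacian_pow_le (ha : 0 < a) (ha1 : a ≤ 1) (hl : 0 < l)
    (hR : 0 < R) :
    ∃ C : ℝ, 0 ≤ C ∧ ∀ᶠ h : ℝ in 𝓝[>] 0, ∀ n : ℕ, n ≠ 0 → n * h ≤ R → ∀ m : ℕ,
      |PowerSeries.coeff n (discreteLaplacian a (l * h ^ a) ^ m) / h| ≤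
        C * 4 ^ m * (n * h) ^ (a - 1) := by
  obtain ⟨C, hC, hev⟩ := exists_eventually_multichoose_term_le ha ha1 hl hR
  refine ⟨C * 2, by positivity, ?_⟩
  filter_upwards [hev, self_mem_nhdsWithin, eventually_mul_rpow_lt l ha (ε := 1 / 4) (by norm_num)]
    with h hterm (hh : 0 < h) hsmall n hn hnR m
  have hseries := tsum_of_norm_bounded (hasSum_geometric_two.mul_left
    (2 ^ m * C * (n * h) ^ (a - 1))) (hterm n hn hnR m)
  have hpow : (l * h ^ a + 1) ^ m ≤ 2 ^ m := pow_le_pow_left₀ (by positivity) (by linarith) m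
  rw [coeff_discreteLaplacian_pow ha.le ha1 (by positivity) hsmall m hn, mul_div_assoc,
    ← tsum_div_const, abs_mul, abs_of_nonneg (by positivity)]
  calc _ ≤ (2 : ℝ) ^ m * (2 ^ m * C * (n * h) ^ (a - 1) * 2) := by gcongr; exact hseries
    _ = _ := by rw [show (4 : ℝ) = 2 * 2 by norm_num, mul_pow]; ring

lemma prabhakarKernelReg_of_pos (m : ℕ) (hx : 0 < x) :
    prabhakarKernelReg a m z x =
      fracSeries a a (fun s => Ring.multichoose (m : ℝ) (s + 1) * z ^ (s + 1)) x := by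
  rw [prabhakarKernelReg, if_pos hx]
  refine tsum_congr fun s => ?_
  beta_reduce
  rw [multichoose_eq_ascPochhammer_div, rlKernel, ← mul_add_one]

lemma prabhakarKernelReg_of_nonpos (c : ℝ) (hx : x ≤ 0) : prabhakarKernelReg a c z x = 0 :=
  if_neg hx.not_gt

lemma exists_abs_prabhakarKernelReg_le (ha : 0 < a) (z : ℝ) (hR : 0 < R) :
    ∃ C : ℝ, 0 ≤ C ∧ ∀ x ∈ Ioc 0 R, ∀ m : ℕ,
      |prabhakarKernelReg a m z x| ≤ C * 2 ^ m * x ^ (a - 1) := by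
  obtain ⟨M, hM0, hM⟩ := exists_abs_mul_rlKernel_le ha ha hR (ExpBounded.pow (2 * |z|)).comp_succ
  refine ⟨M * 2, by positivity, fun x hx m => ?_⟩
  have hx0 := hx.1
  have hterm (s : ℕ) : ‖Ring.multichoose (m : ℝ) (s + 1) * z ^ (s + 1) * rlKernel (a * s + a) x‖ ≤
      2 ^ m * (M * x ^ (a - 1)) * (1 / 2) ^ s := by
    have hker : 0 ≤ rlKernel (a * s + a) x := rlKernel_nonneg (by positivity) hx0.le
    have hbound := (le_abs_self _).trans (hM x hx s)
    rw [norm_mul, norm_mul, norm_pow, Real.norm_of_nonneg hker, Real.norm_eq_abs z,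
      Real.norm_of_nonneg (multichoose_nonneg m.cast_nonneg _)]
    calc _ ≤ 2 ^ (m + (s + 1)) * |z| ^ (s + 1) * rlKernel (a * s + a) x := by
          gcongr; exact multichoose_natCast_le_two_pow m (s + 1)
      _ = 2 ^ m * ((2 * |z|) ^ (s + 1) * rlKernel (a * s + a) x) := by ring
      _ ≤ 2 ^ m * (M * x ^ (a - 1) * (1 / 2) ^ s) := by gcongr
      _ = _ := by ring
  rw [prabhakarKernelReg_of_pos m hx0]
  exact (tsum_of_norm_bounded (hasSum_geometric_two.mul_left _) hterm).trans_eq (by ring)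

lemma tendsto_multichoose_term_floor (ha : 0 < a) (hx : 0 < x) (m s : ℕ) :
    Tendsto (fun h : ℝ => Ring.multichoose (m : ℝ) (s + 1) * (-(l * h ^ a)) ^ (s + 1) *
        Ring.multichoose (a * (s + 1 : ℕ)) ⌊x / h⌋₊ / h) (𝓝[>] 0)
      (𝓝 (Ring.multichoose (m : ℝ) (s + 1) * (-l) ^ (s + 1) * rlKernel (a * s + a) x)) := by
  rw [show a * (s : ℝ) + a = a * (s + 1 : ℕ) by push_cast; ring]
  refine ((tendsto_rpow_mul_multichoose_floor (by positivity) hx).const_mul _).congr' ?_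
  filter_upwards [self_mem_nhdsWithin] with h (hh : 0 < h)
  rw [Real.rpow_sub_one hh.ne', Real.rpow_mul hh.le, Real.rpow_natCast, ← neg_mul, mul_pow]
  ring

lemma tendsto_coeff_discreteLaplacian_pow_floor (ha : 0 < a) (ha1 : a ≤ 1) (hl : 0 < l)
    (hx : 0 < x) (m : ℕ) :
    Tendsto (fun h : ℝ =>
        PowerSeries.coeff ⌊x / h⌋₊ (discreteLaplacian a (l * h ^ a) ^ m) / h)
      (𝓝[>] 0) (𝓝 (prabhakarKernelReg a m (-l) x)) := by
  obtain ⟨C, hC, hev⟩ := exists_eventually_multichoose_term_le ha ha1 hl hx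
  have hseries : Tendsto (fun h : ℝ => ∑' s : ℕ,
      Ring.multichoose (m : ℝ) (s + 1) * (-(l * h ^ a)) ^ (s + 1) *
        Ring.multichoose (a * (s + 1 : ℕ)) ⌊x / h⌋₊ / h) (𝓝[>] 0)
      (𝓝 (prabhakarKernelReg a m (-l) x)) := by
    rw [prabhakarKernelReg_of_pos m hx]
    refine tendsto_tsum_of_dominated_convergence
      (summable_geometric_two.mul_left (2 ^ m * C * (x ^ (a - 1) + 1)))
      (tendsto_multichoose_term_floor ha hx m) ?_
    filter_upwards [hev, eventually_floor_div hx (a - 1)] with h hterm ⟨hn, hnx, hpow⟩ s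
    exact (hterm _ hn hnx m s).trans (by gcongr)
  have hprefactor : Tendsto (fun h : ℝ => (l * h ^ a + 1) ^ m) (𝓝[>] 0) (𝓝 1) := by
    simpa only [zero_add, one_pow] using ((tendsto_mul_rpow_nhdsGT l ha).add_const 1).pow m
  have hprod := hprefactor.mul hseries
  rw [one_mul] at hprod
  refine hprod.congr' ?_
  filter_upwards [self_mem_nhdsWithin, eventually_floor_div hx 1,
    eventually_mul_rpow_lt l ha (ε := 1 / 4) (by norm_num)] with h (hh : 0 < h) ⟨hn, _⟩ hsmall
  rw [coeff_discreteLaplacian_pow ha.le ha1 (by positivity) hsmall m hn, mul_div_assoc,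
    ← tsum_div_const]

lemma summable_abs_mlCoeff_mul_pow (hb : 0 < b) (ht : 0 ≤ t) {K : ℝ} (hK : 0 ≤ K) :
    Summable fun m => |mlCoeff b ξ t m| * K ^ m :=
  (summable_abs_mlCoeff_mul hb ht (.pow K)).congr fun m => by
    rw [abs_mul, abs_of_nonneg (pow_nonneg hK m)]

lemma stateDensityReg_eq_tsum_mlCoeff (a b l ξ t x : ℝ) :
    stateDensityReg a b l ξ t x =
      ∑' m : ℕ, mlCoeff b ξ t m * prabhakarKernelReg a m (-l) x := rfl

lemma exists_eventually_stateProb_le (ha : 0 < a) (ha1 : a ≤ 1) (hb : 0 < b) (hl : 0 < l)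
    (ht : 0 ≤ t) (hR : 0 < R) :
    ∃ C : ℝ, ∀ᶠ h : ℝ in 𝓝[>] 0, ∀ n : ℕ, n ≠ 0 → n * h ≤ R →
      |stateProb a b (l * h ^ a) ξ n t / h| ≤ C * (n * h) ^ (a - 1) := by
  obtain ⟨C, -, hev⟩ := exists_eventually_coeff_discreteLaplacian_pow_le ha ha1 hl hR
  have hsum := summable_abs_mlCoeff_mul_pow (ξ := ξ) hb ht (K := 4) (by norm_num)
  refine ⟨(∑' m, |mlCoeff b ξ t m| * 4 ^ m) * C, ?_⟩
  filter_upwards [hev] with h hcoeff n hn hnR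
  rw [stateProb_eq_tsum_mlCoeff, ← tsum_div_const, ← Real.norm_eq_abs, mul_assoc]
  refine tsum_of_norm_bounded (hsum.hasSum.mul_right _) fun m => ?_
  rw [mul_div_assoc, norm_mul, Real.norm_eq_abs, Real.norm_eq_abs, mul_assoc]
  gcongr
  exact (hcoeff n hn hnR m).trans_eq (by ring)

theorem tendsto_stateProb_floor (ha : 0 < a) (ha1 : a ≤ 1) (hb : 0 < b) (hl : 0 < l)
    (ht : 0 ≤ t) (hx : 0 < x) :
    Tendsto (fun h : ℝ => stateProb a b (l * h ^ a) ξ ⌊x / h⌋₊ t / h)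
      (𝓝[>] 0) (𝓝 (stateDensityReg a b l ξ t x)) := by
  obtain ⟨C, hC, hev⟩ := exists_eventually_coeff_discreteLaplacian_pow_le ha ha1 hl hx
  simp only [stateProb_eq_tsum_mlCoeff, ← tsum_div_const, stateDensityReg_eq_tsum_mlCoeff]
  refine tendsto_tsum_of_dominated_convergence
    (bound := fun m => |mlCoeff b ξ t m| * 4 ^ m * (C * (x ^ (a - 1) + 1)))
    ((summable_abs_mlCoeff_mul_pow hb ht (by norm_num)).mul_right _) (fun m => ?_) ?_
  · simp only [mul_div_assoc]
    exact (tendsto_coeff_discreteLaplacian_pow_floor ha ha1 hl hx m).const_mul _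
  · filter_upwards [hev, eventually_floor_div hx (a - 1)] with h hcoeff ⟨hn, hnx, hpow⟩ m
    rw [mul_div_assoc, norm_mul, Real.norm_eq_abs, Real.norm_eq_abs, mul_assoc]
    gcongr
    calc _ ≤ C * 4 ^ m * ((⌊x / h⌋₊ : ℝ) * h) ^ (a - 1) := hcoeff _ hn hnx m
      _ ≤ C * 4 ^ m * (x ^ (a - 1) + 1) := by gcongr
      _ = _ := by ring

lemma stateProb_index_zero (hl : 0 < l) :
    stateProb a b l ξ 0 t = mittagLeffler b (-ξ * t ^ b) := by
  simp only [stateProb_eq_tsum_mlCoeff, mittagLeffler_eq_tsum_mlCoeff,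
    coeff_zero_discreteLaplacian_pow hl]

lemma mlDensity_of_pos (hx : 0 < x) :
    mlDensity a l x = fracSeries a a (fun s => -(-l) ^ (s + 1)) x := by
  rw [fracSeries_eq_rpow_mul hx, mlDensity, if_pos hx, mittagLefflerGen, mul_comm l, mul_assoc,
    ← tsum_mul_left]
  congr 1
  refine tsum_congr fun s => ?_
  rw [mul_pow, pow_succ]
  ring

lemma mlDensity_of_nonpos (hx : x ≤ 0) : mlDensity a l x = 0 := if_neg hx.not_gt

lemma prabhakarKernelReg_one (a l x : ℝ) :
    prabhakarKernelReg a (1 : ℕ) (-l) x = -mlDensity a l x := by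
  rcases lt_or_ge 0 x with hx | hx
  · rw [prabhakarKernelReg_of_pos 1 hx, mlDensity_of_pos hx]
    simp only [fracSeries, ← tsum_neg, Nat.cast_one, Ring.multichoose_one, one_mul, neg_mul,
      neg_neg]
  · rw [prabhakarKernelReg_of_nonpos _ hx, mlDensity_of_nonpos hx, neg_zero]

lemma mlDensity_nonneg (ha : 0 < a) (ha1 : a ≤ 1) (hl : 0 < l) (x : ℝ) : 0 ≤ mlDensity a l x := by
  rcases lt_or_ge 0 x with hx | hx
  · have hlim := tendsto_coeff_discreteLaplacian_pow_floor ha ha1 hl hx 1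
    rw [prabhakarKernelReg_one] at hlim
    refine neg_nonpos.1 (le_of_tendsto hlim ?_)
    filter_upwards [self_mem_nhdsWithin, eventually_floor_div hx 1] with h (hh : 0 < h) ⟨hn, _⟩
    obtain ⟨k, hk⟩ := Nat.exists_eq_succ_of_ne_zero hn
    rw [hk, pow_one]
    exact div_nonpos_of_nonpos_of_nonneg
      (coeff_succ_discreteLaplacian_nonpos ha.le ha1 (by positivity) k) hh.le
  · exact (mlDensity_of_nonpos hx).ge

end LatticeLimit

/-! ### Causal locally integrable functions -/

/-- The locally integrable functions supported in `[0, ∞)`, i.e. the regular parts of the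
distributions of this file. -/
structure CausalLocInt (f : ℝ → ℝ) : Prop where
  locallyIntegrable : LocallyIntegrable f
  eq_zero : ∀ x < 0, f x = 0

lemma ofFun_apply {f : ℝ → ℝ} (hf : LocallyIntegrable f) (φ : RealTest) :
    ofFun f φ = ∫ x, φ x * f x :=
  TestFunction.integralAgainstBilinCLM_eq_integral (hf.locallyIntegrableOn _)

lemma integrable_test_mul {f : ℝ → ℝ} (hf : LocallyIntegrable f) (φ : RealTest) :
    Integrable fun x => φ x * f x :=
  φ.integrable_bilin (ContinuousLinearMap.mul ℝ ℝ) (hf.locallyIntegrableOn _)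

lemma CausalLocInt.of_bound {f : ℝ → ℝ} {e : ℝ} (he : -1 < e) (h0 : ∀ x < 0, f x = 0)
    (hmeas : AEStronglyMeasurable f (volume.restrict (Ioi 0)))
    (hb : ∀ R > 0, ∃ M : ℝ, ∀ x ∈ Ioc 0 R, |f x| ≤ M * x ^ e) : CausalLocInt f := by
  refine ⟨locallyIntegrable_iff.2 fun K hK => ?_, h0⟩
  obtain ⟨R, hR, hKR⟩ := hK.isBounded.subset_closedBall_lt 0 0
  obtain ⟨M, hM⟩ := hb R hR
  have h_neg : IntegrableOn f (Iio 0) :=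
    (integrableOn_congr_fun h0 measurableSet_Iio).2 integrableOn_zero
  have h_pos : IntegrableOn f (Ioc 0 R) := by
    have hpow := (intervalIntegral.intervalIntegrable_rpow' (a := 0) (b := R) he).const_mul M
    rw [intervalIntegrable_iff_integrableOn_Ioc_of_le hR.le] at hpow
    exact Integrable.mono' hpow (hmeas.mono_set Ioc_subset_Ioi_self)
      ((ae_restrict_iff' measurableSet_Ioc).2 (.of_forall hM))
  have h_zero : IntegrableOn f {(0 : ℝ)} := integrableOn_singleton (hx := by simp)
  refine ((h_neg.union h_zero).union h_pos).mono_set fun x hx => ?_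
  have hxR := hKR hx
  rw [Metric.mem_closedBall, dist_zero_right, Real.norm_eq_abs] at hxR
  rcases lt_trichotomy x 0 with h | h | h
  · exact .inl (.inl h)
  · exact .inl (.inr h)
  · exact .inr ⟨h, (le_abs_self x).trans hxR⟩

lemma causalLocInt_indicator_rpow {e : ℝ} (he : -1 < e) :
    CausalLocInt ((Ioi 0).indicator fun x => x ^ e) := by
  refine .of_bound he (fun x hx => indicator_of_notMem hx.not_gt _)
    ((measurable_id.pow_const e).indicator measurableSet_Ioi).aestronglyMeasurable
    fun R _ => ⟨1, ?_⟩
  rintro x ⟨hx : 0 < x, -⟩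
  rw [indicator_of_mem (mem_Ioi.2 hx), one_mul, abs_of_nonneg (by positivity)]

section MittagLefflerFunctions

variable {a b : ℝ}

lemma causalLocInt_of_eq_fracSeries {f : ℝ → ℝ} {c : ℕ → ℝ} (ha : 0 < a) (hb : 0 < b)
    (hc : ExpBounded c) (h0 : ∀ x < 0, f x = 0) (hf : ∀ x > 0, f x = fracSeries a b c x) :
    CausalLocInt f := by
  refine .of_bound (e := b - 1) (by linarith) h0 (((continuousOn_fracSeries ha hb hc).congr
    hf).aestronglyMeasurable measurableSet_Ioi) fun R hR => ?_
  obtain ⟨M, hM⟩ := exists_abs_fracSeries_le ha hb hR hc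
  exact ⟨M, fun x hx => (hf x hx.1) ▸ hM x hx⟩

lemma expBounded_neg_neg_pow_succ (l : ℝ) : ExpBounded fun s => -(-l) ^ (s + 1) := by
  simpa only [neg_mul, one_mul] using (ExpBounded.pow (-l)).comp_succ.const_mul (-1)

lemma causalLocInt_mlDensity (ha : 0 < a) (l : ℝ) : CausalLocInt (mlDensity a l) :=
  causalLocInt_of_eq_fracSeries ha ha (expBounded_neg_neg_pow_succ l)
    (fun _ hx => mlDensity_of_nonpos hx.le) fun _ hx => mlDensity_of_pos hx

lemma survivalFun_of_nonneg {l x : ℝ} (hx : 0 ≤ x) :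
    survivalFun a l x = fracSeries a 1 (fun s => (-l) ^ s) x := by
  rw [survivalFun, if_pos hx, mittagLeffler_eq_tsum_mlCoeff, tsum_mlCoeff_mul hx]
  simp only [mul_one]

lemma causalLocInt_survivalFun (ha : 0 < a) (l : ℝ) : CausalLocInt (survivalFun a l) :=
  causalLocInt_of_eq_fracSeries ha one_pos (ExpBounded.pow (-l))
    (fun _ hx => if_neg hx.not_ge) fun _ hx => survivalFun_of_nonneg hx.le

lemma expBounded_multichoose_natCast (m : ℕ) : ExpBounded fun s => Ring.multichoose (m : ℝ) s := by
  refine ⟨2 ^ m, 2, by positivity, by norm_num, fun s => ?_⟩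
  rw [abs_of_nonneg (multichoose_nonneg (Nat.cast_nonneg m) s), ← pow_add]
  exact multichoose_natCast_le_two_pow m s

lemma causalLocInt_prabhakarKernelReg (ha : 0 < a) (m : ℕ) (z : ℝ) :
    CausalLocInt (prabhakarKernelReg a m z) :=
  causalLocInt_of_eq_fracSeries ha ha
    ((expBounded_multichoose_natCast m).mul (ExpBounded.pow z)).comp_succ
    (fun _ hx => prabhakarKernelReg_of_nonpos _ hx.le) fun _ hx => prabhakarKernelReg_of_pos m hx

end MittagLefflerFunctions

/-! ### Limits of lattice densities in the sense of distributions -/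

lemma measurable_latticeDensity (h : ℝ) (c : ℕ → ℝ) : Measurable (latticeDensity h c) :=
  Measurable.ite measurableSet_Ici (((measurable_from_nat (f := c)).comp
    (Nat.measurable_floor.comp (measurable_id.div_const h))).div_const h) measurable_const

lemma tendsto_inv_mul_integral_test (φ : RealTest) :
    Tendsto (fun h : ℝ => h⁻¹ * ∫ x in (0 : ℝ)..h, φ x) (𝓝[>] 0) (𝓝 (φ 0)) := by
  have hderiv := intervalIntegral.integral_hasDerivAt_right (a := 0) (b := 0)
    (φ.continuous.intervalIntegrable 0 0) (φ.continuous.stronglyMeasurableAtFilter _ _)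
    φ.continuous.continuousAt
  simpa using hderiv.tendsto_slope_zero_right

lemma rpow_floor_mul_le {a h x : ℝ} (ha : 0 ≤ a) (ha1 : a ≤ 1) (hh : 0 < h) (hx : h ≤ x) :
    ((⌊x / h⌋₊ : ℝ) * h) ^ (a - 1) ≤ 2 * x ^ (a - 1) := by
  have hx0 : 0 < x := hh.trans_le hx
  have hn : (1 : ℝ) ≤ ⌊x / h⌋₊ := by
    exact_mod_cast (Nat.one_le_floor_iff _).2 ((one_le_div hh).2 hx)
  have h_half : x / 2 ≤ (⌊x / h⌋₊ : ℝ) * h := by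
    have := (Nat.lt_floor_add_one (x / h)).le
    rw [div_le_iff₀ hh] at this
    nlinarith
  have h_two : (2 : ℝ) ^ (-(a - 1)) ≤ 2 := by
    simpa using Real.rpow_le_rpow_of_exponent_le one_le_two (show -(a - 1) ≤ 1 by linarith)
  calc ((⌊x / h⌋₊ : ℝ) * h) ^ (a - 1) ≤ (x / 2) ^ (a - 1) :=
        Real.rpow_le_rpow_of_nonpos (by positivity) h_half (by linarith)
    _ = 2 ^ (-(a - 1)) * x ^ (a - 1) := by
        rw [Real.div_rpow hx0.le zero_le_two, div_eq_mul_inv, mul_comm, Real.rpow_neg zero_le_two]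
    _ ≤ 2 * x ^ (a - 1) := by gcongr

lemma latticeDensity_eq_add {h : ℝ} (hh : 0 < h) (c : ℕ → ℝ) (x : ℝ) :
    latticeDensity h c x = (Ico 0 h).indicator (fun _ => c 0 / h) x +
      latticeDensity h (Function.update c 0 0) x := by
  rcases lt_or_ge x 0 with hx | hx
  · simp [latticeDensity, hx.not_ge]
  rcases lt_or_ge x h with hxh | hxh
  · have : ⌊x / h⌋₊ = 0 := Nat.floor_eq_zero.2 ((div_lt_one hh).2 hxh)
    simp [latticeDensity, hx, hxh, this]
  · have : ⌊x / h⌋₊ ≠ 0 := (Nat.floor_pos.2 ((one_le_div hh).2 hxh)).ne'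
    simp [latticeDensity, hx, hxh.not_gt, this]

lemma locallyIntegrable_latticeDensity {h : ℝ} (hh : 0 < h) (c : ℕ → ℝ) :
    LocallyIntegrable (latticeDensity h c) := by
  refine locallyIntegrable_iff.2 fun K hK => ?_
  obtain ⟨R, hKR⟩ := hK.bddAbove
  refine Measure.integrableOn_of_bounded (M := ∑ n ∈ Finset.range (⌊R / h⌋₊ + 1), |c n / h|)
    hK.measure_lt_top.ne (measurable_latticeDensity h c).aestronglyMeasurable
    ((ae_restrict_iff' hK.measurableSet).2 (.of_forall fun x hx => ?_))
  rw [latticeDensity]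
  split_ifs
  · refine Finset.single_le_sum (f := fun n => |c n / h|) (fun _ _ => abs_nonneg _)
      (Finset.mem_range_succ_iff.2 (Nat.floor_le_floor ?_))
    gcongr
    exact hKR hx
  · rw [norm_zero]
    positivity

section LatticeLimit

variable {a : ℝ}

lemma abs_latticeDensity_le {h C R x : ℝ} {c : ℕ → ℝ} (ha : 0 ≤ a) (ha1 : a ≤ 1) (hh : 0 < h)
    (hC : 0 ≤ C) (h0 : c 0 = 0)
    (hb : ∀ n : ℕ, n ≠ 0 → n * h ≤ R → |c n / h| ≤ C * (n * h) ^ (a - 1)) (hx : x ≤ R) :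
    |latticeDensity h c x| ≤ 2 * C * (Ioi 0).indicator (fun x => x ^ (a - 1)) x := by
  have h_nonneg : 0 ≤ 2 * C * (Ioi 0).indicator (fun x => x ^ (a - 1)) x :=
    mul_nonneg (by positivity) (indicator_nonneg (fun y (hy : 0 < y) => by positivity) x)
  rcases lt_or_ge x h with hxh | hxh
  · simpa [latticeDensity, Nat.floor_eq_zero.2 ((div_lt_one hh).2 hxh), h0] using h_nonneg
  have hx0 : 0 < x := hh.trans_le hxh
  have hn : ⌊x / h⌋₊ ≠ 0 := (Nat.floor_pos.2 ((one_le_div hh).2 hxh)).ne'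
  have hnR : (⌊x / h⌋₊ : ℝ) * h ≤ R :=
    ((le_div_iff₀ hh).1 (Nat.floor_le (by positivity))).trans hx
  rw [latticeDensity, if_pos hx0.le, indicator_of_mem (mem_Ioi.2 hx0)]
  calc |c ⌊x / h⌋₊ / h| ≤ C * ((⌊x / h⌋₊ : ℝ) * h) ^ (a - 1) := hb _ hn hnR
    _ ≤ C * (2 * x ^ (a - 1)) := by gcongr; exact rpow_floor_mul_le ha ha1 hh hxh
    _ = 2 * C * x ^ (a - 1) := by ring

variable {c : ℝ → ℕ → ℝ} {f : ℝ → ℝ}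

lemma tendsto_integral_latticeDensity_of_zero (ha : 0 < a) (ha1 : a ≤ 1) (h0 : ∀ h, c h 0 = 0)
    (hf0 : ∀ x ≤ 0, f x = 0)
    (hlim : ∀ x > 0, Tendsto (fun h : ℝ => c h ⌊x / h⌋₊ / h) (𝓝[>] 0) (𝓝 (f x)))
    (hb : ∀ R > 0, ∃ C : ℝ, ∀ᶠ h : ℝ in 𝓝[>] 0, ∀ n : ℕ, n ≠ 0 → n * h ≤ R →
      |c h n / h| ≤ C * (n * h) ^ (a - 1)) (φ : RealTest) :
    Tendsto (fun h : ℝ => ∫ x, latticeDensity h (c h) x * φ x) (𝓝[>] 0)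
      (𝓝 (∫ x, φ x * f x)) := by
  obtain ⟨R, hR, hφR⟩ := φ.hasCompactSupport.exists_pos_le_norm
  obtain ⟨C, hC⟩ := hb R hR
  refine tendsto_integral_filter_of_dominated_convergence
    (fun x => ‖φ x * (2 * |C| * (Ioi 0).indicator (fun x => x ^ (a - 1)) x)‖) ?_ ?_ ?_
    (.of_forall fun x => ?_)
  · exact .of_forall fun h =>
      (measurable_latticeDensity h (c h)).aestronglyMeasurable.mul φ.aestronglyMeasurable
  · filter_upwards [hC, self_mem_nhdsWithin] with h hCh (hh : 0 < h)
    refine .of_forall fun x => ?_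
    rcases le_or_gt R |x| with hx | hx
    · simp [hφR x hx]
    rw [norm_mul, norm_mul, mul_comm]
    refine mul_le_mul_of_nonneg_left (le_trans ?_ (le_abs_self _)) (norm_nonneg _)
    refine abs_latticeDensity_le ha.le ha1 hh (abs_nonneg C) (h0 h) (fun n hn hnR => ?_)
      ((le_abs_self x).trans hx.le)
    exact (hCh n hn hnR).trans (by gcongr; exact le_abs_self C)
  · exact (integrable_test_mul ((causalLocInt_indicator_rpow
      (show -1 < a - 1 by linarith)).locallyIntegrable.smul (2 * |C|)) φ).norm
  · rw [mul_comm]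
    refine Tendsto.mul_const (φ x) ?_
    rcases lt_trichotomy x 0 with hx | rfl | hx
    · simpa only [latticeDensity, if_neg hx.not_ge, hf0 x hx.le] using tendsto_const_nhds
    · simp [latticeDensity, h0, hf0]
    · simpa only [latticeDensity, if_pos hx.le] using hlim x hx

theorem tendsto_integral_latticeDensity {A : ℝ} (ha : 0 < a) (ha1 : a ≤ 1)
    (h0 : ∀ᶠ h : ℝ in 𝓝[>] 0, c h 0 = A) (hf0 : ∀ x ≤ 0, f x = 0)
    (hlim : ∀ x > 0, Tendsto (fun h : ℝ => c h ⌊x / h⌋₊ / h) (𝓝[>] 0) (𝓝 (f x)))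
    (hb : ∀ R > 0, ∃ C : ℝ, ∀ᶠ h : ℝ in 𝓝[>] 0, ∀ n : ℕ, n ≠ 0 → n * h ≤ R →
      |c h n / h| ≤ C * (n * h) ^ (a - 1)) (φ : RealTest) :
    Tendsto (fun h : ℝ => ∫ x, latticeDensity h (c h) x * φ x) (𝓝[>] 0)
      (𝓝 (A * φ 0 + ∫ x, φ x * f x)) := by
  have h_tail := tendsto_integral_latticeDensity_of_zero (c := fun h => Function.update (c h) 0 0)
    ha ha1 (fun _ => Function.update_self ..) hf0 (fun x hx => (hlim x hx).congr' ?_)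
    (fun R hR => ?_) φ
  · refine (((tendsto_inv_mul_integral_test φ).const_mul A).add h_tail).congr' ?_
    filter_upwards [h0, self_mem_nhdsWithin] with h hA (hh : 0 < h)
    have h_atom : Integrable fun x => (Ico 0 h).indicator (fun x => A * h⁻¹ * φ x) x :=
      IntegrableOn.integrable_indicator ((φ.continuous.integrableOn_Icc.mono_set
        Ico_subset_Icc_self).const_mul _) measurableSet_Ico
    have h_rest : Integrable fun x => latticeDensity h (Function.update (c h) 0 0) x * φ x := by
      simpa only [mul_comm] using integrable_test_mul (locallyIntegrable_latticeDensity hh _) φ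
    rw [intervalIntegral.integral_of_le hh.le, ← integral_Ico_eq_integral_Ioc, ← mul_assoc,
      ← integral_const_mul, ← integral_indicator measurableSet_Ico, ← integral_add h_atom h_rest]
    simp only [latticeDensity_eq_add hh (c h), hA, div_eq_mul_inv, add_mul, indicator_mul_left]
  · filter_upwards [eventually_floor_div hx 1] with h ⟨hn, _⟩
    rw [Function.update_of_ne hn]
  · obtain ⟨C, hC⟩ := hb R hR
    refine ⟨C, hC.mono fun h hCh n hn hnR => ?_⟩
    rw [Function.update_of_ne hn]
    exact hCh n hn hnR

end LatticeLimit

/-! ### Series of Prabhakar kernels -/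

section PrabhakarSeries

variable {a : ℝ}

lemma prabhakarKernel_apply (ha : 0 < a) (m : ℕ) (z : ℝ) (φ : RealTest) :
    prabhakarKernel a m z φ = φ 0 + ∫ x, φ x * prabhakarKernelReg a m z x := by
  rw [← ofFun_apply (causalLocInt_prabhakarKernelReg ha m z).locallyIntegrable]
  rfl

lemma exists_integral_norm_mul_prabhakarKernelReg_le (ha : 0 < a) (z : ℝ) (φ : RealTest) :
    ∃ C : ℝ, 0 ≤ C ∧ ∀ m : ℕ, ∫ x, ‖φ x * prabhakarKernelReg a m z x‖ ≤ C * 2 ^ m := by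
  obtain ⟨R, hR, hφR⟩ := φ.hasCompactSupport.exists_pos_le_norm
  obtain ⟨C, hC, hb⟩ := exists_abs_prabhakarKernelReg_le ha z hR
  set p : ℝ → ℝ := (Ioi 0).indicator fun x => x ^ (a - 1)
  have hp := (causalLocInt_indicator_rpow (show -1 < a - 1 by linarith)).locallyIntegrable
  refine ⟨C * ∫ x, ‖φ x * p x‖, mul_nonneg hC (integral_nonneg fun _ => norm_nonneg _),
    fun m => ?_⟩
  rw [mul_right_comm, ← integral_const_mul]
  refine integral_mono_of_nonneg (.of_forall fun _ => norm_nonneg _)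
    ((integrable_test_mul hp φ).norm.const_mul _) (.of_forall fun x => ?_)
  simp only [norm_mul]
  rcases le_or_gt x 0 with hx | hx
  · rw [prabhakarKernelReg_of_nonpos _ hx, norm_zero, mul_zero]
    positivity
  rcases le_or_gt R |x| with hxR | hxR
  · simp [hφR x hxR]
  rw [mul_left_comm]
  refine mul_le_mul_of_nonneg_left ?_ (norm_nonneg _)
  calc ‖prabhakarKernelReg a m z x‖ ≤ C * 2 ^ m * x ^ (a - 1) :=
        hb x ⟨hx, (le_abs_self x).trans hxR.le⟩ m
    _ ≤ C * 2 ^ m * ‖p x‖ := by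
        rw [show p x = x ^ (a - 1) from indicator_of_mem (mem_Ioi.2 hx) _]
        gcongr
        exact le_abs_self _

lemma expBounded_prabhakarKernel_apply (ha : 0 < a) (z : ℝ) (φ : RealTest) :
    ExpBounded fun m => prabhakarKernel a m z φ := by
  obtain ⟨C, hC, hb⟩ := exists_integral_norm_mul_prabhakarKernelReg_le ha z φ
  refine ⟨|φ 0| + C, 2, by positivity, two_pos, fun m => ?_⟩
  simp only [prabhakarKernel_apply ha, add_mul]
  refine (abs_add_le _ _).trans (add_le_add ?_ ?_)
  · exact le_mul_of_one_le_right (abs_nonneg _) (one_le_pow₀ one_le_two)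
  · exact (norm_integral_le_integral_norm _).trans (hb m)

section Series

variable {ι : Type*} {c : ι → ℝ} {n : ι → ℕ}

lemma summable_of_abs_mul_two_pow (hc : Summable fun i => |c i| * 2 ^ n i) : Summable c :=
  .of_norm_bounded hc fun i => le_mul_of_one_le_right (abs_nonneg (c i)) (one_le_pow₀ one_le_two)

lemma summable_mul_prabhakarKernelReg (ha : 0 < a) (z : ℝ)
    (hc : Summable fun i => |c i| * 2 ^ n i) (x : ℝ) :
    Summable fun i => c i * prabhakarKernelReg a (n i) z x := by
  rcases le_or_gt x 0 with hx | hx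
  · simpa only [prabhakarKernelReg_of_nonpos _ hx, mul_zero] using summable_zero
  obtain ⟨C, -, hb⟩ := exists_abs_prabhakarKernelReg_le ha z hx
  refine .of_norm_bounded (hc.mul_right (C * x ^ (a - 1))) fun i => ?_
  calc ‖c i * prabhakarKernelReg a (n i) z x‖ = |c i| * |prabhakarKernelReg a (n i) z x| :=
        norm_mul _ _
    _ ≤ |c i| * (C * 2 ^ n i * x ^ (a - 1)) := by gcongr; exact hb x ⟨hx, le_rfl⟩ (n i)
    _ = |c i| * 2 ^ n i * (C * x ^ (a - 1)) := by ring

variable [Countable ι]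

lemma causalLocInt_tsum_mul_prabhakarKernelReg (ha : 0 < a) (z : ℝ)
    (hc : Summable fun i => |c i| * 2 ^ n i) :
    CausalLocInt fun x => ∑' i, c i * prabhakarKernelReg a (n i) z x := by
  refine .of_bound (e := a - 1) (by linarith) (fun x hx => ?_) ?_ fun R hR => ?_
  · simp only [prabhakarKernelReg_of_nonpos _ hx.le, mul_zero, tsum_zero]
  · refine AEStronglyMeasurable.restrict ?_
    refine aestronglyMeasurable_of_tendsto_ae (u := atTop) (f := fun (s : Finset ι) x =>
      ∑ i ∈ s, c i * prabhakarKernelReg a (n i) z x) (fun s => ?_)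
      (.of_forall fun x => (summable_mul_prabhakarKernelReg ha z hc x).hasSum)
    exact Finset.aestronglyMeasurable_fun_sum s fun i _ => ((causalLocInt_prabhakarKernelReg ha
      (n i) z).locallyIntegrable.aestronglyMeasurable).const_mul (c i)
  · obtain ⟨C, -, hb⟩ := exists_abs_prabhakarKernelReg_le ha z hR
    refine ⟨(∑' i, |c i| * 2 ^ n i) * C, fun x hx => ?_⟩
    rw [mul_assoc]
    rw [← Real.norm_eq_abs]
    refine tsum_of_norm_bounded (hc.hasSum.mul_right (C * x ^ (a - 1))) fun i => ?_
    calc ‖c i * prabhakarKernelReg a (n i) z x‖ = |c i| * |prabhakarKernelReg a (n i) z x| :=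
          norm_mul _ _
      _ ≤ |c i| * (C * 2 ^ n i * x ^ (a - 1)) := by gcongr; exact hb x hx (n i)
      _ = |c i| * 2 ^ n i * (C * x ^ (a - 1)) := by ring

lemma hasSum_mul_prabhakarKernel_apply (ha : 0 < a) (z : ℝ)
    (hc : Summable fun i => |c i| * 2 ^ n i) (φ : RealTest) :
    HasSum (fun i => c i * prabhakarKernel a (n i) z φ)
      ((∑' i, c i) * φ 0 + ∫ x, φ x * ∑' i, c i * prabhakarKernelReg a (n i) z x) := by
  obtain ⟨C, -, hb⟩ := exists_integral_norm_mul_prabhakarKernelReg_le ha z φ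
  have h_norm : Summable fun i => ∫ x, ‖c i * (φ x * prabhakarKernelReg a (n i) z x)‖ := by
    refine .of_nonneg_of_le (fun i => integral_nonneg fun _ => norm_nonneg _) (fun i => ?_)
      (hc.mul_right C)
    simp only [norm_mul (c i)]
    rw [integral_const_mul, Real.norm_eq_abs (c i), mul_assoc, mul_comm _ C]
    exact mul_le_mul_of_nonneg_left (hb (n i)) (abs_nonneg _)
  have h_reg := hasSum_integral_of_summable_integral_norm (fun i => (integrable_test_mul
    (causalLocInt_prabhakarKernelReg ha (n i) z).locallyIntegrable φ).const_mul (c i)) h_norm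
  have h_sum := ((summable_of_abs_mul_two_pow hc).hasSum.mul_right (φ 0)).add h_reg
  simp only [integral_const_mul, ← mul_add, ← prabhakarKernel_apply ha] at h_sum
  simpa only [mul_left_comm (c _), tsum_mul_left] using h_sum

end Series

end PrabhakarSeries

/-! ### The convolution semigroup of the Prabhakar kernels -/

section Semigroup

variable {a : ℝ}

lemma expBounded_multichoose_mul_pow (m : ℕ) (z : ℝ) :
    ExpBounded fun s => Ring.multichoose (m : ℝ) s * z ^ s :=
  (expBounded_multichoose_natCast m).mul (ExpBounded.pow z)

lemma intervalIntegral_congr_Ioo {f g : ℝ → ℝ} {x : ℝ} (hx : 0 ≤ x) (h : EqOn f g (Ioo 0 x)) :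
    ∫ τ in (0 : ℝ)..x, f τ = ∫ τ in (0 : ℝ)..x, g τ := by
  simp only [intervalIntegral.integral_of_le hx, integral_Ioc_eq_integral_Ioo]
  exact setIntegral_congr_fun measurableSet_Ioo h

lemma sum_antidiagonal_multichoose_succ_mul_pow (r t z : ℝ) (s : ℕ) :
    ∑ p ∈ Finset.HasAntidiagonal.antidiagonal s,
        Ring.multichoose r (p.1 + 1) * z ^ (p.1 + 1) *
          (Ring.multichoose t (p.2 + 1) * z ^ (p.2 + 1)) =
      (Ring.multichoose (r + t) (s + 2) - Ring.multichoose r (s + 2) -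
        Ring.multichoose t (s + 2)) * z ^ (s + 2) := by
  have h_vandermonde := sum_multichoose_mul_multichoose r t (s + 2)
  rw [Finset.Nat.sum_antidiagonal_succ, Finset.Nat.sum_antidiagonal_succ'] at h_vandermonde
  simp only [Ring.multichoose_zero_right, one_mul, mul_one] at h_vandermonde
  rw [← h_vandermonde, sub_sub, ← add_assoc, add_comm (Ring.multichoose t _), add_sub_cancel_left,
    Finset.sum_mul]
  refine Finset.sum_congr rfl fun p hp => ?_
  rw [← Finset.HasAntidiagonal.mem_antidiagonal.1 hp]
  ring

theorem prabhakarKernelReg_add (ha : 0 < a) (m n : ℕ) (z : ℝ) {x : ℝ} (hx : 0 < x) :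
    prabhakarKernelReg a (m + n : ℕ) z x = prabhakarKernelReg a m z x +
      prabhakarKernelReg a n z x + ∫ τ in (0 : ℝ)..x,
        prabhakarKernelReg a m z (x - τ) * prabhakarKernelReg a n z τ := by
  have hexp (k : ℕ) := (expBounded_multichoose_mul_pow k z).comp_succ
  rw [intervalIntegral_congr_Ioo hx.le fun τ hτ => by
      rw [prabhakarKernelReg_of_pos m (sub_pos.2 hτ.2), prabhakarKernelReg_of_pos n hτ.1],
    integral_fracSeries_conv ha ha ha hx (hexp m) (hexp n)]
  simp only [prabhakarKernelReg_of_pos _ hx]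
  rw [fracSeries_eq_add_comp_succ ha ha hx (hexp (m + n)),
    fracSeries_eq_add_comp_succ ha ha hx (hexp m), fracSeries_eq_add_comp_succ ha ha hx (hexp n)]
  have hconv : ∀ s, ∑ p ∈ Finset.HasAntidiagonal.antidiagonal s,
      Ring.multichoose (m : ℝ) (p.1 + 1) * z ^ (p.1 + 1) *
        (Ring.multichoose (n : ℝ) (p.2 + 1) * z ^ (p.2 + 1)) =
      Ring.multichoose ((m + n : ℕ) : ℝ) (s + 2) * z ^ (s + 2) +
        (-1) * (Ring.multichoose (m : ℝ) (s + 2) * z ^ (s + 2) +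
          Ring.multichoose (n : ℝ) (s + 2) * z ^ (s + 2)) := fun s => by
    rw [sum_antidiagonal_multichoose_succ_mul_pow, Nat.cast_add]
    ring
  have hexp' (k : ℕ) := (hexp k).comp_succ
  have haa : 0 < a + a := add_pos ha ha
  simp only [hconv]
  rw [fracSeries_add ha haa hx (hexp' _) (((hexp' m).add (hexp' n)).const_mul _),
    fracSeries_const_mul, fracSeries_add ha haa hx (hexp' m) (hexp' n)]
  simp only [zero_add, Ring.multichoose_one_right, Nat.cast_add]
  ring

lemma exists_abs_prabhakarKernelReg_conv_le (ha : 0 < a) (m : ℕ) (z : ℝ) {x : ℝ} (hx : 0 < x) :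
    ∃ D : ℝ, ∀ τ ∈ Ioc 0 x, ∀ k : ℕ,
      |prabhakarKernelReg a m z (x - τ) * prabhakarKernelReg a k z τ| ≤
        2 ^ k * (D * ((x - τ) ^ (a - 1) * τ ^ (a - 1))) := by
  obtain ⟨C, hC, hb⟩ := exists_abs_prabhakarKernelReg_le ha z hx
  refine ⟨C * 2 ^ m * C, fun τ hτ k => ?_⟩
  have h_left : |prabhakarKernelReg a m z (x - τ)| ≤ C * 2 ^ m * (x - τ) ^ (a - 1) := by
    rcases hτ.2.eq_or_lt with rfl | hτx
    · rw [sub_self, prabhakarKernelReg_of_nonpos _ le_rfl, abs_zero]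
      positivity
    · exact hb _ ⟨sub_pos.2 hτx, sub_le_self x hτ.1.le⟩ m
  rw [abs_mul]
  refine (mul_le_mul h_left (hb τ hτ k) (abs_nonneg _) ((abs_nonneg _).trans h_left)).trans_eq ?_
  ring

lemma hasSum_prabhakarKernelReg_conv {ι : Type*} [Countable ι] {c : ι → ℝ} {n : ι → ℕ}
    (ha : 0 < a) (m : ℕ) (z : ℝ) {x : ℝ} (hx : 0 < x)
    (hc : Summable fun i => |c i| * 2 ^ n i) :
    IntervalIntegrable (fun τ => prabhakarKernelReg a m z (x - τ) *
      ∑' i, c i * prabhakarKernelReg a (n i) z τ) volume 0 x ∧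
    HasSum (fun i => c i * ∫ τ in (0 : ℝ)..x,
        prabhakarKernelReg a m z (x - τ) * prabhakarKernelReg a (n i) z τ)
      (∫ τ in (0 : ℝ)..x, prabhakarKernelReg a m z (x - τ) *
        ∑' i, c i * prabhakarKernelReg a (n i) z τ) := by
  obtain ⟨D, hD⟩ := exists_abs_prabhakarKernelReg_conv_le ha m z hx
  have h_left : AEStronglyMeasurable (fun τ => prabhakarKernelReg a m z (x - τ)) :=
    (causalLocInt_prabhakarKernelReg ha m z).locallyIntegrable.aestronglyMeasurable
      |>.comp_measurePreserving (Measure.measurePreserving_sub_left volume x)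
  have h_bound (τ : ℝ) (hτ : τ ∈ Ioc 0 x) (i : ι) :
      ‖c i * (prabhakarKernelReg a m z (x - τ) * prabhakarKernelReg a (n i) z τ)‖ ≤
        |c i| * 2 ^ n i * (D * ((x - τ) ^ (a - 1) * τ ^ (a - 1))) := by
    rw [norm_mul, mul_assoc]
    exact mul_le_mul_of_nonneg_left (hD τ hτ (n i)) (abs_nonneg _)
  have h_dom := ((intervalIntegrable_rpow_sub_mul_rpow ha ha hx).const_mul D).const_mul
    (∑' i, |c i| * 2 ^ n i)
  have h_sum (τ : ℝ) : ∑' i, c i * (prabhakarKernelReg a m z (x - τ) *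
      prabhakarKernelReg a (n i) z τ) = prabhakarKernelReg a m z (x - τ) *
        ∑' i, c i * prabhakarKernelReg a (n i) z τ := by
    simp only [mul_left_comm (c _), tsum_mul_left]
  constructor
  · refine h_dom.mono_fun' (h_left.mul (causalLocInt_tsum_mul_prabhakarKernelReg ha z
      hc).locallyIntegrable.aestronglyMeasurable).restrict ?_
    refine (ae_restrict_iff' measurableSet_uIoc).2 (.of_forall fun τ hτ => ?_)
    rw [uIoc_of_le hx.le] at hτ
    beta_reduce
    rw [← h_sum]
    exact tsum_of_norm_bounded (hc.hasSum.mul_right _) (h_bound τ hτ)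
  · simp only [← intervalIntegral.integral_const_mul]
    refine intervalIntegral.hasSum_integral_of_dominated_convergence
      (fun i τ => |c i| * 2 ^ n i * (D * ((x - τ) ^ (a - 1) * τ ^ (a - 1)))) (fun i => ?_)
      (fun i => .of_forall fun τ hτ => h_bound τ (uIoc_of_le hx.le ▸ hτ) i)
      (.of_forall fun τ _ => hc.mul_right _) (by simpa only [tsum_mul_right] using h_dom)
      (.of_forall fun τ _ => h_sum τ ▸ ?_)
    · exact ((h_left.mul (causalLocInt_prabhakarKernelReg ha
        (n i) z).locallyIntegrable.aestronglyMeasurable).const_mul (c i)).restrict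
    · simp only [mul_left_comm (c _)]
      exact ((summable_mul_prabhakarKernelReg ha z hc τ).mul_left _).hasSum

theorem tsum_mul_prabhakarKernelReg_add {ι : Type*} [Countable ι] {c : ι → ℝ} {n : ι → ℕ}
    (ha : 0 < a) (m : ℕ) (z : ℝ) {x : ℝ} (hx : 0 < x)
    (hc : Summable fun i => |c i| * 2 ^ n i) :
    ∑' i, c i * prabhakarKernelReg a (m + n i : ℕ) z x =
      (∑' i, c i) * prabhakarKernelReg a m z x + ∑' i, c i * prabhakarKernelReg a (n i) z x +
        ∫ τ in (0 : ℝ)..x, prabhakarKernelReg a m z (x - τ) *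
          ∑' i, c i * prabhakarKernelReg a (n i) z τ := by
  have h_sum := (((summable_of_abs_mul_two_pow hc).hasSum.mul_right
    (prabhakarKernelReg a m z x)).add
    (summable_mul_prabhakarKernelReg ha z hc x).hasSum).add
      (hasSum_prabhakarKernelReg_conv ha m z hx hc).2
  simp only [prabhakarKernelReg_add ha m _ z hx, mul_add]
  rw [h_sum.tsum_eq]

end Semigroup

/-! ### Convolution of causal distributions -/

section CausalConvolution

open scoped Convolution

variable {c : ℝ} {k f : ℝ → ℝ}

lemma atom_add_ofFun_apply (hf : LocallyIntegrable f) (c : ℝ) (φ : RealTest) :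
    (c • dirac0 + ofFun f) φ = c * φ 0 + ∫ x, φ x * f x := by
  rw [← ofFun_apply hf]
  rfl

/-- The function `y ↦ (c δ + f)_x (φ (x + y))` to which the left factor of a convolution is
applied. -/
def shiftPairing (c : ℝ) (f φ : ℝ → ℝ) (y : ℝ) : ℝ := c * φ y + ∫ x, φ (x + y) * f x

lemma atom_add_ofFun_shiftTest (hf : LocallyIntegrable f) (c : ℝ) (φ : RealTest) (y : ℝ) :
    (c • dirac0 + ofFun f) (shiftTest y φ) = shiftPairing c f φ y := by
  have h_shift (x : ℝ) : shiftTest y φ x = φ (x + y) := rfl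
  simp only [atom_add_ofFun_apply hf, shiftPairing, h_shift, zero_add]

lemma shiftPairing_eq_add_convolution (c : ℝ) (f φ : ℝ → ℝ) :
    shiftPairing c f φ = fun y => c * φ y + (f ⋆ fun z => φ (-z)) (-y) := by
  ext y
  simp only [shiftPairing, convolution_lsmul, smul_eq_mul, mul_comm (f _), neg_sub, sub_neg_eq_add]

lemma hasCompactSupport_comp_neg {φ : ℝ → ℝ} (hφ : HasCompactSupport φ) :
    HasCompactSupport fun z => φ (-z) :=
  hφ.comp_homeomorph (Homeomorph.neg ℝ)

lemma contDiff_shiftPairing (hf : LocallyIntegrable f) (c : ℝ) (φ : RealTest) :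
    ContDiff ℝ ((⊤ : ℕ∞) : WithTop ℕ∞) (shiftPairing c f φ) := by
  rw [shiftPairing_eq_add_convolution]
  exact (contDiff_const.mul φ.contDiff).add <| ((hasCompactSupport_comp_neg
    φ.hasCompactSupport).contDiff_convolution_right _ hf (φ.contDiff.comp contDiff_neg)).comp
      contDiff_neg

lemma lineDeriv_test_apply (φ : RealTest) (x : ℝ) : (∂_{(1 : ℝ)} φ) x = deriv φ x := by
  rw [TestFunction.lineDerivOp_eq_lineDerivCLM ℝ, TestFunction.lineDerivCLM_apply_of_le (by simp),
    (φ.contDiff.differentiable (by simp)).differentiableAt.lineDeriv_eq_fderiv,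
    fderiv_apply_one_eq_deriv]

lemma hasDerivAt_test (φ : RealTest) (x : ℝ) : HasDerivAt φ ((∂_{(1 : ℝ)} φ) x) x := by
  rw [lineDeriv_test_apply]
  exact (φ.contDiff.differentiable (by simp)).differentiableAt.hasDerivAt

lemma hasDerivAt_shiftPairing (hf : LocallyIntegrable f) (c : ℝ) (φ : RealTest) (y : ℝ) :
    HasDerivAt (shiftPairing c f φ) (shiftPairing c f (∂_{(1 : ℝ)} φ : RealTest) y) y := by
  have h_conv := ((hasCompactSupport_comp_neg φ.hasCompactSupport).hasDerivAt_convolution_right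
    (ContinuousLinearMap.lsmul ℝ ℝ) hf ((φ.contDiff.comp contDiff_neg).of_le
      (by exact_mod_cast le_top)) (-y)).scomp y (hasDerivAt_neg y)
  simp only [shiftPairing_eq_add_convolution]
  refine (((hasDerivAt_test φ y).const_mul c).add h_conv).congr_deriv (congrArg _ ?_)
  simp only [convolution_lsmul, smul_eq_mul, neg_one_mul, ← integral_neg, lineDeriv_test_apply]
  congr with t
  rw [deriv_comp_neg, mul_neg, neg_neg]

lemma shiftPairing_eq_zero (hf : CausalLocInt f) (c : ℝ) {φ : ℝ → ℝ} {R y : ℝ}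
    (hR : ∀ x, R ≤ x → φ x = 0) (hy : R ≤ y) : shiftPairing c f φ y = 0 := by
  rw [shiftPairing, hR y hy, mul_zero, zero_add]
  refine integral_eq_zero_of_ae (.of_forall fun x => ?_)
  rcases lt_or_ge x 0 with hx | hx
  · simp [hf.eq_zero x hx]
  · simp [hR (x + y) (by linarith)]

lemma exists_test_eq_shiftPairing (hf : CausalLocInt f) (c : ℝ) (φ : RealTest) :
    ∃ ψ : RealTest, ∀ y > -1, ψ y = shiftPairing c f φ y := by
  obtain ⟨R, -, hφR⟩ := φ.hasCompactSupport.exists_pos_le_norm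
  have h_zero (y : ℝ) (hy : R ≤ y) : shiftPairing c f φ y = 0 :=
    shiftPairing_eq_zero hf c (fun x hx => hφR x (hx.trans (le_abs_self x))) hy
  have h_smooth : ContDiff ℝ ((⊤ : ℕ∞) : WithTop ℕ∞)
      fun y => Real.smoothTransition (y + 2) * shiftPairing c f φ y :=
    (Real.smoothTransition.contDiff.comp (contDiff_id.add contDiff_const)).mul
      (contDiff_shiftPairing hf.locallyIntegrable c φ)
  refine ⟨⟨fun y => Real.smoothTransition (y + 2) * shiftPairing c f φ y, h_smooth, ?_,
    fun _ _ => trivial⟩, fun y hy => ?_⟩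
  · refine .of_support_subset_isCompact (isCompact_Icc (a := -2) (b := R)) fun y hy => ?_
    contrapose! hy
    rw [Function.notMem_support]
    rcases lt_or_ge y (-2) with h | h
    · rw [Real.smoothTransition.zero_of_nonpos (by linarith), zero_mul]
    · rw [h_zero y (not_le.1 fun hyR => hy ⟨h, hyR⟩).le, mul_zero]
  · change Real.smoothTransition (y + 2) * shiftPairing c f φ y = _
    rw [Real.smoothTransition.one_of_one_le (by linarith), one_mul]

lemma isVanishingOn_atom_add_ofFun (hf : CausalLocInt f) (c : ℝ) :
    Distribution.IsVanishingOn (c • dirac0 + ofFun f) (Iio (0 : ℝ)) := by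
  intro u hu
  have h_test (x : ℝ) (hx : 0 ≤ x) : u x = 0 :=
    image_eq_zero_of_notMem_tsupport fun h => not_lt.2 hx (hu h)
  rw [atom_add_ofFun_apply hf.locallyIntegrable, h_test 0 le_rfl, mul_zero, zero_add]
  refine integral_eq_zero_of_ae (.of_forall fun x => ?_)
  rcases lt_or_ge x 0 with hx | hx
  · simp [hf.eq_zero x hx]
  · simp [h_test x hx]

lemma isVanishingOn_ofFun (hf : CausalLocInt f) :
    Distribution.IsVanishingOn (ofFun f) (Iio (0 : ℝ)) := by
  simpa only [zero_smul, zero_add] using isVanishingOn_atom_add_ofFun hf 0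

lemma isCausalConv_of_forall {S R : RealDistribution}
    (hS : Distribution.IsVanishingOn S (Iio (0 : ℝ))) (hf : CausalLocInt f)
    (h : ∀ φ ψ : RealTest, (∀ y > -1, ψ y = shiftPairing c f φ y) → R φ = S ψ) :
    IsCausalConv S (c • dirac0 + ofFun f) R := by
  refine ⟨hS, isVanishingOn_atom_add_ofFun hf c, fun φ => ?_⟩
  obtain ⟨ψ, hψ⟩ := exists_test_eq_shiftPairing hf c φ
  refine ⟨ψ, ⟨1, one_pos, fun y hy => ?_⟩, h φ ψ hψ⟩
  rw [atom_add_ofFun_shiftTest hf.locallyIntegrable, hψ y hy]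

lemma convolution_eq_intervalIntegral (hk : ∀ x < 0, k x = 0) (hf : ∀ x < 0, f x = 0) {x : ℝ}
    (hx : 0 ≤ x) : (k ⋆ f) x = ∫ τ in (0 : ℝ)..x, k (x - τ) * f τ := by
  rw [convolution_lsmul_swap, intervalIntegral.integral_of_le hx, ← integral_Icc_eq_integral_Ioc]
  refine (setIntegral_eq_integral_of_forall_compl_eq_zero fun τ hτ => ?_).symm
  rcases lt_or_ge τ 0 with h | h
  · rw [hf τ h, smul_zero]
  · rw [hk (x - τ) (sub_neg.2 (not_le.1 fun hτx => hτ ⟨h, hτx⟩)), zero_smul]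

lemma CausalLocInt.integrable_indicator (hk : CausalLocInt k) (M : ℝ) :
    Integrable ((Icc 0 M).indicator k) :=
  (hk.locallyIntegrable.integrableOn_isCompact isCompact_Icc).integrable_indicator measurableSet_Icc

lemma mul_eq_indicator_mul_indicator (hk : CausalLocInt k) (hf : CausalLocInt f) {M x y : ℝ}
    (h : x + y ≤ M) : k x * f y = (Icc 0 M).indicator k x * (Icc 0 M).indicator f y := by
  rcases lt_or_ge x 0 with hx | hx
  · rw [hk.eq_zero x hx, indicator_of_notMem fun h => not_lt.2 h.1 hx, zero_mul, zero_mul]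
  rcases lt_or_ge y 0 with hy | hy
  · rw [hf.eq_zero y hy, indicator_of_notMem (f := f) fun h => not_lt.2 h.1 hy, mul_zero, mul_zero]
  · rw [indicator_of_mem (show x ∈ Icc 0 M from ⟨hx, by linarith⟩),
      indicator_of_mem (show y ∈ Icc 0 M from ⟨hy, by linarith⟩)]

lemma convolution_eq_convolution_indicator (hk : CausalLocInt k) (hf : CausalLocInt f) {M x : ℝ}
    (hx : x ≤ M) : (k ⋆ f) x = ((Icc 0 M).indicator k ⋆ (Icc 0 M).indicator f) x := by
  simp only [convolution_lsmul, smul_eq_mul]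
  congr with y
  exact mul_eq_indicator_mul_indicator hk hf (by linarith)

lemma CausalLocInt.convolution (hk : CausalLocInt k) (hf : CausalLocInt f) :
    CausalLocInt (k ⋆ f) := by
  refine ⟨locallyIntegrable_iff.2 fun K hK => ?_, fun x hx => ?_⟩
  · obtain ⟨M, -, hKM⟩ := hK.isBounded.subset_closedBall_lt 0 0
    refine IntegrableOn.congr_fun ((hk.integrable_indicator M).integrable_convolution
      (ContinuousLinearMap.lsmul ℝ ℝ)
      (hf.integrable_indicator M)).integrableOn (fun x hx => ?_) hK.measurableSet
    have hxM := hKM hx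
    rw [Metric.mem_closedBall, dist_zero_right, Real.norm_eq_abs] at hxM
    exact (convolution_eq_convolution_indicator hk hf ((le_abs_self x).trans hxM)).symm
  · refine integral_eq_zero_of_ae (.of_forall fun y => ?_)
    rcases lt_or_ge y 0 with h | h
    · simp [hk.eq_zero y h]
    · simp [hf.eq_zero (x - y) (by linarith)]

lemma CausalLocInt.const_mul_add (hk : CausalLocInt k) (hf : CausalLocInt f) (c : ℝ) :
    CausalLocInt fun x => c * k x + f x where
  locallyIntegrable := (hk.locallyIntegrable.smul c).add hf.locallyIntegrable
  eq_zero x hx := by rw [hk.eq_zero x hx, hf.eq_zero x hx, mul_zero, zero_add]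

lemma integral_test_mul_convolution (hk : CausalLocInt k) (hf : CausalLocInt f) (φ : RealTest) :
    ∫ z, φ z * (k ⋆ f) z = ∫ y, (∫ x, φ (x + y) * f x) * k y := by
  obtain ⟨M, -, hφM⟩ := φ.hasCompactSupport.exists_pos_le_norm
  set k' := (Icc 0 M).indicator k
  set f' := (Icc 0 M).indicator f
  have h_left (z : ℝ) : φ z * (k ⋆ f) z = ∫ y, φ z * (k' y * f' (z - y)) := by
    rw [integral_const_mul]
    by_cases hz : M ≤ |z|
    · rw [hφM z hz, zero_mul, zero_mul]
    · rw [convolution_eq_convolution_indicator hk hf ((le_abs_self z).trans (not_le.1 hz).le)]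
      rfl
  have h_right (y : ℝ) : (∫ x, φ (x + y) * f x) * k y = ∫ z, φ z * (k' y * f' (z - y)) := by
    rw [← integral_add_right_eq_self (fun z => φ z * (k' y * f' (z - y))) y, ← integral_mul_const]
    congr with x
    rw [add_sub_cancel_right, mul_assoc, mul_comm (f x)]
    by_cases hz : M ≤ |x + y|
    · rw [hφM _ hz, zero_mul, zero_mul]
    · rw [mul_eq_indicator_mul_indicator hk hf
        (add_comm x y ▸ (le_abs_self _).trans (not_le.1 hz).le)]
  simp_rw [h_left, h_right]
  refine integral_integral_swap ?_
  obtain ⟨B, hB⟩ := φ.hasCompactSupport.exists_bound_of_continuous φ.continuous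
  exact ((hk.integrable_indicator M).convolution_integrand (ContinuousLinearMap.lsmul ℝ ℝ)
    (hf.integrable_indicator M)).bdd_mul (c := B)
      (φ.continuous.comp continuous_fst).aestronglyMeasurable (.of_forall fun p => hB p.1)

lemma ofFun_const_mul_add_convolution_apply (hk : CausalLocInt k) (hf : CausalLocInt f)
    {φ ψ : RealTest} (hψ : ∀ y > -1, ψ y = shiftPairing c f φ y) :
    ofFun (fun x => c * k x + (k ⋆ f) x) φ = ofFun k ψ := by
  have hkf := hk.convolution hf
  have hck : LocallyIntegrable fun x => c * k x := hk.locallyIntegrable.smul c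
  have h_pairing (y : ℝ) :
      ψ y * k y = φ y * (c * k y) + (∫ x, φ (x + y) * f x) * k y := by
    rcases lt_or_ge y 0 with h | h
    · simp only [hk.eq_zero y h, mul_zero, add_zero]
    · rw [hψ y (by linarith), shiftPairing]
      ring
  have h_int : Integrable fun y => (∫ x, φ (x + y) * f x) * k y := by
    have h_sub := (integrable_test_mul hk.locallyIntegrable ψ).sub (integrable_test_mul hck φ)
    refine h_sub.congr (.of_forall fun y => ?_)
    simp only [Pi.sub_apply, h_pairing, add_sub_cancel_left]
  rw [ofFun_apply (hk.const_mul_add hkf c).locallyIntegrable, ofFun_apply hk.locallyIntegrable]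
  simp_rw [h_pairing, mul_add]
  rw [integral_add (integrable_test_mul hck φ) (integrable_test_mul hkf.locallyIntegrable φ),
    integral_test_mul_convolution hk hf, integral_add (integrable_test_mul hck φ) h_int]

theorem isCausalConv_ofFun (hk : CausalLocInt k) (hf : CausalLocInt f) (c : ℝ) :
    IsCausalConv (ofFun k) (c • dirac0 + ofFun f) (ofFun fun x => c * k x + (k ⋆ f) x) :=
  isCausalConv_of_forall (isVanishingOn_ofFun hk) hf fun _ _ =>
    ofFun_const_mul_add_convolution_apply hk hf

lemma lineDeriv_ofFun_const_mul_add_convolution_apply (hk : CausalLocInt k)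
    (hf : CausalLocInt f) {φ ψ : RealTest} (hψ : ∀ y > -1, ψ y = shiftPairing c f φ y) :
    (∂_{(1 : ℝ)} (ofFun fun x => c * k x + (k ⋆ f) x)) φ = (∂_{(1 : ℝ)} (ofFun k)) ψ := by
  rw [Distribution.lineDerivOp_apply_apply, Distribution.lineDerivOp_apply_apply, map_neg, map_neg,
    ofFun_const_mul_add_convolution_apply hk hf (φ := ∂_{(1 : ℝ)} φ) (ψ := ∂_{(1 : ℝ)} ψ)]
  intro y hy
  rw [lineDeriv_test_apply]
  refine HasDerivAt.deriv <|
    (hasDerivAt_shiftPairing hf.locallyIntegrable c φ y).congr_of_eventuallyEq ?_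
  filter_upwards [lt_mem_nhds hy] with z hz using hψ z hz

end CausalConvolution

/-! ### The Laplacian density -/

section LaplacianDensity

lemma CausalLocInt.neg {f : ℝ → ℝ} (hf : CausalLocInt f) : CausalLocInt fun x => -f x where
  locallyIntegrable := hf.locallyIntegrable.neg
  eq_zero x hx := by rw [hf.eq_zero x hx, neg_zero]

variable {a l x : ℝ}

theorem hasDerivAt_mittagLeffler_rpow (ha : 0 < a) (hx : 0 < x) :
    HasDerivAt (fun y : ℝ => mittagLeffler a (-l * y ^ a)) (-mlDensity a l x) x := by
  have h_val : fracSeries a a (fun s => (-l) ^ (s + 1)) x = -mlDensity a l x := by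
    simp only [mlDensity_of_pos hx, fracSeries, ← tsum_neg, neg_mul, neg_neg]
  refine ((hasDerivAt_fracSeries_one ha hx (.pow (-l))).congr_deriv h_val).congr_of_eventuallyEq ?_
  filter_upwards [lt_mem_nhds hx] with y hy
  rw [← survivalFun_of_nonneg hy.le, survivalFun, if_pos hy.le]

lemma hasDerivAt_survivalFun (ha : 0 < a) (hx : 0 < x) :
    HasDerivAt (survivalFun a l) (-mlDensity a l x) x := by
  refine (hasDerivAt_mittagLeffler_rpow ha hx).congr_of_eventuallyEq ?_
  filter_upwards [lt_mem_nhds hx] with y hy using if_pos hy.le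

lemma survivalFun_zero (ha : 0 < a) : survivalFun a l 0 = 1 := by
  rw [survivalFun, if_pos le_rfl, mittagLeffler_eq_tsum_mlCoeff, tsum_mlCoeff_zero_mul ha]

lemma tendsto_survivalFun_nhdsGT (ha : 0 < a) (l : ℝ) :
    Tendsto (survivalFun a l) (𝓝[>] 0) (𝓝 1) := by
  have h_cont : ContinuousOn (survivalFun a l) (Icc 0 1) :=
    (continuousOn_Icc_fracSeries ha le_rfl one_pos (.pow (-l))).congr
      fun x hx => survivalFun_of_nonneg hx.1
  rw [← survivalFun_zero (l := l) ha]
  exact (h_cont 0 (left_mem_Icc.2 zero_le_one)).mono_of_mem_nhdsWithin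
    (mem_of_superset (Ioc_mem_nhdsGT one_pos) Ioc_subset_Icc_self)

lemma laplacianDensity_eq_atom_add_ofFun (ha : 0 < a) (l : ℝ) :
    laplacianDensity a l = (1 : ℝ) • dirac0 + ofFun fun x => -mlDensity a l x := by
  have hW := causalLocInt_mlDensity ha l
  have h_neg : (ofFun fun x => -mlDensity a l x) = -ofFun (mlDensity a l) := by
    ext φ
    change _ = -(ofFun (mlDensity a l) φ)
    simp only [ofFun_apply hW.locallyIntegrable, ofFun_apply hW.neg.locallyIntegrable, mul_neg,
      integral_neg]
  rw [h_neg, one_smul, laplacianDensity, sub_eq_add_neg]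

lemma laplacianDensity_apply (ha : 0 < a) (l : ℝ) (φ : RealTest) :
    laplacianDensity a l φ = φ 0 - ∫ x, φ x * mlDensity a l x := by
  rw [laplacianDensity_eq_atom_add_ofFun ha,
    atom_add_ofFun_apply (causalLocInt_mlDensity ha l).neg.locallyIntegrable]
  simp only [mul_neg, integral_neg, one_mul, sub_eq_add_neg]

lemma CausalLocInt.integral_mul_eq_integral_Ioi {f : ℝ → ℝ} (hf : CausalLocInt f) (φ : ℝ → ℝ) :
    ∫ x, φ x * f x = ∫ x in Ioi 0, φ x * f x := by
  rw [← integral_Ici_eq_integral_Ioi]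
  exact (setIntegral_eq_integral_of_forall_compl_eq_zero fun x hx => by
    rw [hf.eq_zero x (not_le.1 hx), mul_zero]).symm

theorem laplacianDensity_eq_lineDeriv (ha : 0 < a) (l : ℝ) :
    laplacianDensity a l = ∂_{(1 : ℝ)} (ofFun (survivalFun a l)) := by
  ext φ
  have hS := causalLocInt_survivalFun ha l
  have hW := causalLocInt_mlDensity ha l
  rw [Distribution.lineDerivOp_apply_apply, map_neg, ofFun_apply hS.locallyIntegrable,
    laplacianDensity_apply ha, hS.integral_mul_eq_integral_Ioi, hW.integral_mul_eq_integral_Ioi]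
  have h_zero : Tendsto (fun x => φ x * survivalFun a l x) (𝓝[>] 0) (𝓝 (φ 0)) := by
    simpa only [mul_one] using (φ.continuous.tendsto 0 |>.mono_left nhdsWithin_le_nhds).mul
      (tendsto_survivalFun_nhdsGT ha l)
  have h_infty : Tendsto (fun x => φ x * survivalFun a l x) atTop (𝓝 0) := by
    obtain ⟨R, -, hφR⟩ := φ.hasCompactSupport.exists_pos_le_norm
    refine tendsto_const_nhds.congr' ?_
    filter_upwards [eventually_ge_atTop R] with x hx
    rw [hφR x (hx.trans (le_abs_self x)), zero_mul]
  have h_parts := integral_Ioi_mul_deriv_eq_deriv_mul (fun x _ => hasDerivAt_test φ x)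
    (fun x hx => hasDerivAt_survivalFun (l := l) ha hx)
    (integrable_test_mul hW.locallyIntegrable.neg φ).integrableOn
    (integrable_test_mul hS.locallyIntegrable (∂_{(1 : ℝ)} φ)).integrableOn h_zero h_infty
  simp only [mul_neg, integral_neg] at h_parts
  linarith

theorem tendsto_latticeDensity_coeff (ha : 0 < a) (ha1 : a ≤ 1) (hl : 0 < l) (φ : RealTest) :
    Tendsto (fun h : ℝ => ∫ x, latticeDensity h
        (fun n => PowerSeries.coeff n (discreteLaplacian a (l * h ^ a))) x * φ x)
      (𝓝[>] 0) (𝓝 (laplacianDensity a l φ)) := by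
  have h_eq : laplacianDensity a l φ = 1 * φ 0 + ∫ x, φ x * -mlDensity a l x := by
    rw [laplacianDensity_eq_atom_add_ofFun ha,
      atom_add_ofFun_apply (causalLocInt_mlDensity ha l).neg.locallyIntegrable]
  rw [h_eq]
  refine tendsto_integral_latticeDensity ha ha1 ?_ (fun x hx => ?_) (fun x hx => ?_)
    (fun R hR => ?_) φ
  · filter_upwards [self_mem_nhdsWithin] with h (hh : 0 < h)
    simpa only [pow_one] using coeff_zero_discreteLaplacian_pow (a := a) (l := l * h ^ a)
      (by positivity) 1
  · rw [mlDensity_of_nonpos hx, neg_zero]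
  · simpa only [pow_one, prabhakarKernelReg_one] using
      tendsto_coeff_discreteLaplacian_pow_floor ha ha1 hl hx 1
  · obtain ⟨C, -, hev⟩ := exists_eventually_coeff_discreteLaplacian_pow_le ha ha1 hl hR
    refine ⟨C * 4 ^ 1, ?_⟩
    filter_upwards [hev] with h hcoeff n hn hnR
    simpa only [pow_one] using hcoeff n hn hnR 1

end LaplacianDensity

/-! ### The Laplace transform of the Laplacian density -/

section LaplaceTransform

variable {a l r x : ℝ} {s : ℂ}

lemma mlDensity_add_mul_integral_rlKernel (ha : 0 < a) (l : ℝ) (hx : 0 < x) :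
    mlDensity a l x + l * ∫ τ in (0 : ℝ)..x, rlKernel a (x - τ) * mlDensity a l τ =
      l * rlKernel a x := by
  have hw := expBounded_neg_neg_pow_succ l
  rw [intervalIntegral_congr_Ioo hx.le fun τ hτ => by rw [mlDensity_of_pos hτ.1],
    integral_rlKernel_conv_fracSeries ha ha ha hx hw, mlDensity_of_pos hx,
    fracSeries_eq_add_comp_succ ha ha hx hw, ← fracSeries_const_mul, add_assoc,
    add_eq_left.2, zero_add, pow_one, neg_neg]
  rw [fracSeries, fracSeries, ← Summable.tsum_add
    (summable_abs_mul_rlKernel ha (by positivity) hx hw.comp_succ).of_abs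
    (summable_abs_mul_rlKernel ha (by positivity) hx (hw.const_mul l)).of_abs]
  convert tsum_zero with k
  ring

lemma mlDensity_le (ha : 0 < a) (ha1 : a ≤ 1) (hl : 0 < l) (hx : 0 < x) :
    mlDensity a l x ≤ l * rlKernel a x := by
  rw [← mlDensity_add_mul_integral_rlKernel ha l hx, le_add_iff_nonneg_right]
  refine mul_nonneg hl.le (intervalIntegral.integral_nonneg hx.le fun τ hτ => ?_)
  exact mul_nonneg (rlKernel_nonneg ha.le (sub_nonneg.2 hτ.2)) (mlDensity_nonneg ha ha1 hl τ)

lemma integrableOn_exp_mul_rlKernel (ha : 0 < a) (hr : 0 < r) :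
    IntegrableOn (fun x : ℝ => Real.exp (-r * x) * rlKernel a x) (Ioi 0) := by
  have h := integrableOn_rpow_mul_exp_neg_mul_rpow (s := a - 1) (by linarith) one_pos hr
  simp only [Real.rpow_one] at h
  refine (h.div_const (Real.Gamma a)).congr (.of_forall fun x => ?_)
  simp only [rlKernel]
  ring

lemma integral_exp_mul_rlKernel (ha : 0 < a) (hr : 0 < r) :
    ∫ x in Ioi (0 : ℝ), Real.exp (-r * x) * rlKernel a x = (r ^ a)⁻¹ := by
  have h := Real.integral_rpow_mul_exp_neg_mul_Ioi ha hr
  rw [one_div, Real.inv_rpow hr.le, ← div_eq_iff (Real.Gamma_pos_of_pos ha).ne',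
    ← integral_div] at h
  rw [← h]
  congr with x
  rw [rlKernel, neg_mul]
  ring

lemma integrableOn_exp_mul_mlDensity (ha : 0 < a) (ha1 : a ≤ 1) (hl : 0 < l) (hr : 0 < r) :
    IntegrableOn (fun x : ℝ => Real.exp (-r * x) * mlDensity a l x) (Ioi 0) := by
  have h_meas := (causalLocInt_mlDensity ha l).locallyIntegrable.aestronglyMeasurable.restrict
    (s := Ioi 0)
  refine Integrable.mono' ((integrableOn_exp_mul_rlKernel ha hr).const_mul l)
    ((by fun_prop : Continuous fun x => Real.exp (-r * x)).aestronglyMeasurable.mul h_meas)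
    (ae_restrict_of_forall_mem measurableSet_Ioi fun x hx => ?_)
  rw [Real.norm_of_nonneg (mul_nonneg (Real.exp_nonneg _) (mlDensity_nonneg ha ha1 hl x)),
    mul_left_comm]
  gcongr
  exact mlDensity_le ha ha1 hl hx

lemma integral_exp_mul_mlDensity (ha : 0 < a) (ha1 : a ≤ 1) (hl : 0 < l) (hr : 0 < r) :
    ∫ x in Ioi (0 : ℝ), Real.exp (-r * x) * mlDensity a l x = l / (r ^ a + l) := by
  have h_int := integrableOn_exp_mul_mlDensity ha ha1 hl hr
  have h_int' := integrableOn_exp_mul_rlKernel ha hr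
  have h_conv : ∀ x ∈ Ioi (0 : ℝ), ∫ τ in (0 : ℝ)..x, Real.exp (-r * τ) * mlDensity a l τ *
        (Real.exp (-r * (x - τ)) * rlKernel a (x - τ)) =
      Real.exp (-r * x) * rlKernel a x - l⁻¹ * (Real.exp (-r * x) * mlDensity a l x) := by
    intro x (hx : 0 < x)
    have h_exp (τ : ℝ) : Real.exp (-r * x) = Real.exp (-r * τ) * Real.exp (-r * (x - τ)) := by
      rw [← Real.exp_add]
      ring_nf
    calc _ = ∫ τ in (0 : ℝ)..x, Real.exp (-r * x) * (rlKernel a (x - τ) * mlDensity a l τ) := by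
          congr with τ
          rw [h_exp τ]
          ring
      _ = _ := by
          rw [intervalIntegral.integral_const_mul, mul_left_comm, ← mul_sub]
          congr 1
          have h_volterra := mlDensity_add_mul_integral_rlKernel ha l hx
          field_simp
          linarith
  have h_mul := integral_posConvolution h_int h_int' (ContinuousLinearMap.mul ℝ ℝ)
  simp only [ContinuousLinearMap.mul_apply'] at h_mul
  rw [setIntegral_congr_fun measurableSet_Ioi h_conv, integral_sub h_int' (h_int.const_mul _),
    integral_const_mul, integral_exp_mul_rlKernel ha hr] at h_mul
  have : 0 < r ^ a := by positivity
  rw [eq_div_iff (by positivity)]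
  generalize ∫ x in Ioi (0 : ℝ), Real.exp (-r * x) * mlDensity a l x = A at h_mul ⊢
  field_simp at h_mul
  linarith

lemma eqOn_re_pos_of_forall_ofReal {F G : ℂ → ℂ} (hF : DifferentiableOn ℂ F {z | 0 < z.re})
    (hG : DifferentiableOn ℂ G {z | 0 < z.re}) (h : ∀ r : ℝ, 0 < r → F r = G r) :
    EqOn F G {z | 0 < z.re} := by
  have h_open : IsOpen {z : ℂ | 0 < z.re} := isOpen_lt continuous_const Complex.continuous_re
  have h_real : Tendsto (fun r : ℝ => (r : ℂ)) (𝓝[>] 1) (𝓝[≠] (1 : ℂ)) := by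
    refine tendsto_nhdsWithin_iff.2 ⟨(Complex.continuous_ofReal.tendsto' 1 1
      Complex.ofReal_one).mono_left nhdsWithin_le_nhds, ?_⟩
    filter_upwards [self_mem_nhdsWithin] with r (hr : 1 < r)
    exact Complex.ofReal_ne_one.2 hr.ne'
  have h_freq : ∃ᶠ z in 𝓝[≠] (1 : ℂ), F z = G z := by
    refine h_real.frequently (Eventually.frequently ?_)
    filter_upwards [self_mem_nhdsWithin] with r (hr : 1 < r) using h r (one_pos.trans hr)
  exact (hF.analyticOnNhd h_open).eqOn_of_preconnected_of_frequently_eq (hG.analyticOnNhd h_open)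
    (convex_halfSpace_re_gt 0).isPreconnected (by simp) h_freq

lemma differentiableOn_integral_cexp_mul {f : ℝ → ℝ} (hf0 : ∀ x, 0 ≤ f x)
    (hf : AEMeasurable f (volume.restrict (Ioi 0)))
    (hexp : ∀ r > 0, IntegrableOn (fun x : ℝ => Real.exp (-r * x) * f x) (Ioi 0)) :
    DifferentiableOn ℂ (fun s => ∫ x in Ioi (0 : ℝ), Complex.exp (-s * x) * (f x : ℂ))
      {z | 0 < z.re} := by
  set μ := (volume.restrict (Ioi 0)).withDensity fun x => ENNReal.ofReal (f x)
  have h_mgf (s : ℂ) : ∫ x in Ioi (0 : ℝ), Complex.exp (-s * x) * (f x : ℂ) =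
      ProbabilityTheory.complexMGF id μ (-s) := by
    rw [ProbabilityTheory.complexMGF, integral_withDensity_eq_integral_toReal_smul₀
      hf.ennreal_ofReal (.of_forall fun x => ENNReal.ofReal_lt_top)]
    simp only [ENNReal.toReal_ofReal (hf0 _), id, Complex.real_smul, mul_comm]
  have h_sub : Iio 0 ⊆ interior (ProbabilityTheory.integrableExpSet id μ) := by
    refine interior_maximal (fun r hr => ?_) isOpen_Iio
    refine (integrable_withDensity_iff_integrable_smul₀' hf.ennreal_ofReal
      (.of_forall fun x => ENNReal.ofReal_lt_top)).2 ?_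
    simpa only [ENNReal.toReal_ofReal (hf0 _), smul_eq_mul, neg_neg, mul_comm, id, IntegrableOn]
      using hexp (-r) (neg_pos.2 hr)
  simp only [h_mgf]
  exact ProbabilityTheory.differentiableOn_complexMGF.comp differentiableOn_id.neg
    fun z (hz : 0 < z.re) => h_sub (neg_neg_of_pos hz)

lemma cpow_ofReal_re_pos (ha : 0 < a) (ha1 : a ≤ 1) (hs : 0 < s.re) : 0 < (s ^ (a : ℂ)).re := by
  have hs0 : s ≠ 0 := fun h => by simp [h] at hs
  have h_arg : |s.arg * a| < Real.pi / 2 := by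
    rw [abs_mul, abs_of_pos ha]
    exact (mul_le_of_le_one_right (abs_nonneg _) ha1).trans_lt
      (Complex.abs_arg_lt_pi_div_two_iff.2 (.inl hs))
  rw [Complex.cpow_ofReal_re]
  exact mul_pos (Real.rpow_pos_of_pos (norm_pos_iff.2 hs0) _)
    (Real.cos_pos_of_mem_Ioo (abs_lt.1 h_arg))

lemma cpow_ofReal_add_ne_zero (ha : 0 < a) (ha1 : a ≤ 1) (hl : 0 ≤ l) (hs : 0 < s.re) :
    s ^ (a : ℂ) + (l : ℂ) ≠ 0 := by
  refine ne_of_apply_ne Complex.re (ne_of_gt ?_)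
  rw [Complex.add_re, Complex.ofReal_re, Complex.zero_re]
  exact add_pos_of_pos_of_nonneg (cpow_ofReal_re_pos ha ha1 hs) hl

theorem integral_cexp_mul_mlDensity (ha : 0 < a) (ha1 : a ≤ 1) (hl : 0 < l) (hs : 0 < s.re) :
    ∫ x in Ioi (0 : ℝ), Complex.exp (-s * x) * (mlDensity a l x : ℂ) =
      l / (s ^ (a : ℂ) + l) := by
  refine eqOn_re_pos_of_forall_ofReal (differentiableOn_integral_cexp_mul
    (mlDensity_nonneg ha ha1 hl)
    (causalLocInt_mlDensity ha l).locallyIntegrable.aestronglyMeasurable.aemeasurable.restrict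
    fun r hr => integrableOn_exp_mul_mlDensity ha ha1 hl hr)
    (G := fun z => (l : ℂ) / (z ^ (a : ℂ) + l)) (fun z hz => ?_) (fun r hr => ?_) hs
  · exact ((differentiableAt_const _).div ((differentiableAt_id.cpow_const (.inl hz)).add_const _)
      (cpow_ofReal_add_ne_zero ha ha1 hl.le hz)).differentiableWithinAt
  · rw [← Complex.ofReal_cpow hr.le]
    exact_mod_cast congrArg (fun x : ℝ => (x : ℂ)) (integral_exp_mul_mlDensity ha ha1 hl hr)

theorem hasLaplaceTransform_laplacianDensity (ha : 0 < a) (ha1 : a ≤ 1) (hl : 0 < l)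
    (hs : 0 < s.re) :
    HasLaplaceTransform (laplacianDensity a l) s (s ^ (a : ℂ) / (s ^ (a : ℂ) + (l : ℂ))) := by
  have hW := (causalLocInt_mlDensity ha l).neg
  refine ⟨1, fun x => -mlDensity a l x, hW.locallyIntegrable, hW.eq_zero,
    laplacianDensity_eq_atom_add_ofFun ha l, ?_, ?_⟩
  · refine Integrable.mono' (integrableOn_exp_mul_mlDensity ha ha1 hl hs)
      ((by fun_prop : Continuous fun x : ℝ => Complex.exp (-s * x)).aestronglyMeasurable.mul
        (Complex.continuous_ofReal.comp_aestronglyMeasurable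
          hW.locallyIntegrable.aestronglyMeasurable).restrict) (.of_forall fun x => ?_)
    rw [norm_mul, Complex.norm_exp, Complex.norm_real, norm_neg,
      Real.norm_of_nonneg (mlDensity_nonneg ha ha1 hl x)]
    simp
  · simp only [Complex.ofReal_neg, mul_neg, integral_neg, integral_cexp_mul_mlDensity ha ha1 hl hs]
    have := cpow_ofReal_add_ne_zero ha ha1 hl.le hs
    push_cast
    field_simp
    ring

end LaplaceTransform

/-! ### The state density -/

section StateDensity

open scoped Convolution

variable {a b l ξ t x : ℝ}

lemma tsum_mlCoeff (b ξ t : ℝ) : ∑' m, mlCoeff b ξ t m = mittagLeffler b (-ξ * t ^ b) := rfl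

lemma stateDensityReg_of_nonpos (hx : x ≤ 0) : stateDensityReg a b l ξ t x = 0 := by
  simp only [stateDensityReg_eq_tsum_mlCoeff, prabhakarKernelReg_of_nonpos _ hx, mul_zero,
    tsum_zero]

lemma causalLocInt_stateDensityReg (ha : 0 < a) (hb : 0 < b) (l ξ : ℝ) (ht : 0 ≤ t) :
    CausalLocInt (stateDensityReg a b l ξ t) :=
  causalLocInt_tsum_mul_prabhakarKernelReg ha (-l) (summable_abs_mlCoeff_mul_pow hb ht two_pos.le)

lemma stateDensity_apply (ha : 0 < a) (hb : 0 < b) (l ξ : ℝ) (ht : 0 ≤ t) (φ : RealTest) :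
    stateDensity a b l ξ t φ =
      mittagLeffler b (-ξ * t ^ b) * φ 0 + ∫ x, φ x * stateDensityReg a b l ξ t x :=
  atom_add_ofFun_apply (causalLocInt_stateDensityReg ha hb l ξ ht).locallyIntegrable _ φ

theorem hasSum_stateDensity (ha : 0 < a) (hb : 0 < b) (l ξ : ℝ) (ht : 0 ≤ t) (φ : RealTest) :
    HasSum (fun m : ℕ => mlCoeff b ξ t m * prabhakarKernel a m (-l) φ)
      (stateDensity a b l ξ t φ) := by
  rw [stateDensity_apply ha hb l ξ ht]
  exact hasSum_mul_prabhakarKernel_apply ha (-l)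
    (summable_abs_mlCoeff_mul_pow hb ht two_pos.le) φ

theorem tendsto_latticeDensity_stateProb (ha : 0 < a) (ha1 : a ≤ 1) (hb : 0 < b) (hl : 0 < l)
    (ht : 0 ≤ t) (φ : RealTest) :
    Tendsto (fun h : ℝ => ∫ x, latticeDensity h (fun n => stateProb a b (l * h ^ a) ξ n t) x * φ x)
      (𝓝[>] 0) (𝓝 (stateDensity a b l ξ t φ)) := by
  rw [stateDensity_apply ha hb l ξ ht]
  refine tendsto_integral_latticeDensity ha ha1 ?_ (fun _ => stateDensityReg_of_nonpos)
    (fun x hx => tendsto_stateProb_floor ha ha1 hb hl ht hx)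
    (fun R hR => exists_eventually_stateProb_le ha ha1 hb hl ht hR) φ
  filter_upwards [self_mem_nhdsWithin] with h (hh : 0 < h)
  exact stateProb_index_zero (by positivity)

theorem tendsto_latticeDensity_stateProb_pointwise (ha : 0 < a) (ha1 : a ≤ 1) (hb : 0 < b)
    (hl : 0 < l) (ht : 0 ≤ t) (hx : 0 < x) :
    Tendsto (fun h : ℝ => latticeDensity h (fun n => stateProb a b (l * h ^ a) ξ n t) x)
      (𝓝[>] 0) (𝓝 (stateDensityReg a b l ξ t x)) := by
  simp only [latticeDensity, if_pos hx.le]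
  exact tendsto_stateProb_floor ha ha1 hb hl ht hx

/-! ### The Cauchy problem -/

lemma prabhakarKernelReg_zero (a z x : ℝ) : prabhakarKernelReg a (0 : ℕ) z x = 0 := by
  rcases lt_or_ge 0 x with hx | hx
  · rw [prabhakarKernelReg_of_pos 0 hx]
    simp only [fracSeries, Nat.cast_zero, Ring.multichoose_zero_succ, zero_mul, tsum_zero]
  · exact prabhakarKernelReg_of_nonpos _ hx

theorem stateDensity_zero (ha : 0 < a) (hb : 0 < b) (l ξ : ℝ) :
    stateDensity a b l ξ 0 = dirac0 := by
  ext φ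
  rw [← (hasSum_stateDensity ha hb l ξ le_rfl φ).tsum_eq,
    tsum_mlCoeff_zero_mul (y := fun m => prabhakarKernel a m (-l) φ) hb, prabhakarKernel_apply ha]
  simp only [prabhakarKernelReg_zero, mul_zero, integral_zero, add_zero]
  rfl

lemma hasCaputoDeriv_stateDensity_apply (ha : 0 < a) (hb : 0 < b) (hb1 : b ≤ 1) (l ξ : ℝ)
    (ht : 0 < t) (φ : RealTest) :
    HasCaputoDeriv b (fun r => stateDensity a b l ξ r φ) t
      (-ξ * ∑' m : ℕ, mlCoeff b ξ t m * prabhakarKernel a (m + 1 : ℕ) (-l) φ) :=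
  (hasCaputoDeriv_tsum_mlCoeff_mul hb hb1 ht (expBounded_prabhakarKernel_apply ha (-l) φ)).congr ht
    fun _ hr => (hasSum_stateDensity ha hb l ξ hr φ).tsum_eq.symm

theorem tendsto_stateDensity_apply (ha : 0 < a) (hb : 0 < b) (hb1 : b ≤ 1) (l ξ : ℝ)
    (φ : RealTest) :
    Tendsto (fun t : ℝ => stateDensity a b l ξ t φ) (𝓝[>] 0) (𝓝 (dirac0 φ)) := by
  have h_cont := (hasCaputoDeriv_stateDensity_apply ha hb hb1 l ξ one_pos φ).1 0
    (left_mem_Icc.2 zero_le_one)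
  rw [← stateDensity_zero ha hb l ξ]
  exact h_cont.mono_of_mem_nhdsWithin (mem_of_superset (Ioc_mem_nhdsGT one_pos) Ioc_subset_Icc_self)

/-- The convolution `W * P` of the Mittag-Leffler density with the state density, which is a
function: the atom of `P` contributes `E_b(-ξ t^b) W`. -/
def jumpConv (a b l ξ t x : ℝ) : ℝ :=
  mittagLeffler b (-ξ * t ^ b) * mlDensity a l x + (mlDensity a l ⋆ stateDensityReg a b l ξ t) x

lemma causalLocInt_jumpConv (ha : 0 < a) (hb : 0 < b) (l ξ : ℝ) (ht : 0 ≤ t) :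
    CausalLocInt (jumpConv a b l ξ t) :=
  have hW := causalLocInt_mlDensity ha l
  hW.const_mul_add (hW.convolution (causalLocInt_stateDensityReg ha hb l ξ ht)) _

lemma jumpConv_of_nonneg (ha : 0 < a) (hb : 0 < b) (l ξ : ℝ) (ht : 0 ≤ t) (hx : 0 ≤ x) :
    jumpConv a b l ξ t x = mittagLeffler b (-ξ * t ^ b) * mlDensity a l x +
      ∫ τ in (0 : ℝ)..x, mlDensity a l (x - τ) * stateDensityReg a b l ξ t τ := by
  rw [jumpConv, convolution_eq_intervalIntegral (causalLocInt_mlDensity ha l).eq_zero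
    (causalLocInt_stateDensityReg ha hb l ξ ht).eq_zero hx]

lemma jumpConv_of_nonpos (ha : 0 < a) (hb : 0 < b) (l ξ : ℝ) (ht : 0 ≤ t) (hx : x ≤ 0) :
    jumpConv a b l ξ t x = 0 := by
  rcases hx.eq_or_lt with rfl | hx
  · rw [jumpConv_of_nonneg ha hb l ξ ht le_rfl, mlDensity_of_nonpos le_rfl, mul_zero,
      intervalIntegral.integral_same, add_zero]
  · exact (causalLocInt_jumpConv ha hb l ξ ht).eq_zero x hx

lemma tsum_mlCoeff_mul_prabhakarKernelReg_succ (ha : 0 < a) (hb : 0 < b) (l ξ : ℝ) (ht : 0 ≤ t)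
    (x : ℝ) :
    ∑' m : ℕ, mlCoeff b ξ t m * prabhakarKernelReg a (m + 1 : ℕ) (-l) x =
      stateDensityReg a b l ξ t x - jumpConv a b l ξ t x := by
  rcases lt_or_ge 0 x with hx | hx
  · simp only [add_comm _ 1]
    rw [tsum_mul_prabhakarKernelReg_add ha 1 (-l) hx (summable_abs_mlCoeff_mul_pow hb ht
      two_pos.le), jumpConv_of_nonneg ha hb l ξ ht hx.le, tsum_mlCoeff]
    simp only [← stateDensityReg_eq_tsum_mlCoeff, prabhakarKernelReg_one, neg_mul,
      intervalIntegral.integral_neg]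
    ring
  · simp only [prabhakarKernelReg_of_nonpos _ hx, mul_zero, tsum_zero,
      stateDensityReg_of_nonpos hx, jumpConv_of_nonpos ha hb l ξ ht hx, sub_zero]

lemma tsum_mlCoeff_mul_prabhakarKernel_succ_apply (ha : 0 < a) (hb : 0 < b) (l ξ : ℝ)
    (ht : 0 ≤ t) (φ : RealTest) :
    ∑' m : ℕ, mlCoeff b ξ t m * prabhakarKernel a (m + 1 : ℕ) (-l) φ =
      stateDensity a b l ξ t φ - ofFun (jumpConv a b l ξ t) φ := by
  have hq := (causalLocInt_stateDensityReg ha hb l ξ ht).locallyIntegrable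
  have hj := (causalLocInt_jumpConv ha hb l ξ ht).locallyIntegrable
  have hc : Summable fun m : ℕ => |mlCoeff b ξ t m| * 2 ^ (m + 1) := by
    simpa only [pow_succ, mul_assoc] using
      (summable_abs_mlCoeff_mul_pow hb ht two_pos.le).mul_right 2
  rw [(hasSum_mul_prabhakarKernel_apply ha (-l) hc φ).tsum_eq, tsum_mlCoeff,
    stateDensity_apply ha hb l ξ ht, ofFun_apply hj, add_sub_assoc,
    ← integral_sub (integrable_test_mul hq φ) (integrable_test_mul hj φ)]
  simp only [tsum_mlCoeff_mul_prabhakarKernelReg_succ ha hb l ξ ht, mul_sub]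

theorem hasCaputoDeriv_stateDensity (ha : 0 < a) (hb : 0 < b) (hb1 : b ≤ 1) (l ξ : ℝ)
    (ht : 0 < t) (φ : RealTest) :
    HasCaputoDeriv b (fun r => stateDensity a b l ξ r φ) t
      ((-ξ • (stateDensity a b l ξ t - ofFun (jumpConv a b l ξ t))) φ) := by
  have h := hasCaputoDeriv_stateDensity_apply ha hb hb1 l ξ ht φ
  rwa [tsum_mlCoeff_mul_prabhakarKernel_succ_apply ha hb l ξ ht.le] at h

/-! ### The convolutions with the state density -/

theorem isCausalConv_mlDensity_stateDensity (ha : 0 < a) (hb : 0 < b) (l ξ : ℝ) (ht : 0 ≤ t) :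
    IsCausalConv (ofFun (mlDensity a l)) (stateDensity a b l ξ t) (ofFun (jumpConv a b l ξ t)) :=
  isCausalConv_ofFun (causalLocInt_mlDensity ha l) (causalLocInt_stateDensityReg ha hb l ξ ht) _

lemma stateDensity_sub_jumpConv_apply (ha : 0 < a) (hb : 0 < b) (ht : 0 ≤ t) {φ ψ : RealTest}
    (hψ : ∀ y > -1, ψ y =
      shiftPairing (mittagLeffler b (-ξ * t ^ b)) (stateDensityReg a b l ξ t) φ y) :
    (stateDensity a b l ξ t - ofFun (jumpConv a b l ξ t)) φ = laplacianDensity a l ψ := by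
  have hW := causalLocInt_mlDensity ha l
  have hq := causalLocInt_stateDensityReg ha hb l ξ ht
  have h_atom : stateDensity a b l ξ t φ = ψ 0 := by
    rw [hψ 0 (by norm_num), stateDensity_apply ha hb l ξ ht]
    simp only [shiftPairing, add_zero]
  have h_jump : ofFun (jumpConv a b l ξ t) φ = ofFun (mlDensity a l) ψ :=
    ofFun_const_mul_add_convolution_apply hW hq hψ
  rw [laplacianDensity_apply ha, ← ofFun_apply hW.locallyIntegrable, ← h_jump, ← h_atom]
  rfl

theorem isCausalConv_laplacianDensity_stateDensity (ha : 0 < a) (hb : 0 < b) (l ξ : ℝ)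
    (ht : 0 ≤ t) :
    IsCausalConv (laplacianDensity a l) (stateDensity a b l ξ t)
      (stateDensity a b l ξ t - ofFun (jumpConv a b l ξ t)) := by
  refine isCausalConv_of_forall ?_ (causalLocInt_stateDensityReg ha hb l ξ ht)
    fun _ _ => stateDensity_sub_jumpConv_apply ha hb ht
  rw [laplacianDensity_eq_atom_add_ofFun ha]
  exact isVanishingOn_atom_add_ofFun (causalLocInt_mlDensity ha l).neg 1

/-- The convolution of the survival function `Θ(x) E_a(-l x^a)` with the state density. -/
def survivalConv (a b l ξ t x : ℝ) : ℝ :=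
  mittagLeffler b (-ξ * t ^ b) * survivalFun a l x +
    (survivalFun a l ⋆ stateDensityReg a b l ξ t) x

theorem isCausalConv_survivalFun_stateDensity (ha : 0 < a) (hb : 0 < b) (l ξ : ℝ) (ht : 0 ≤ t) :
    IsCausalConv (ofFun (survivalFun a l)) (stateDensity a b l ξ t)
      (ofFun (survivalConv a b l ξ t)) :=
  isCausalConv_ofFun (causalLocInt_survivalFun ha l) (causalLocInt_stateDensityReg ha hb l ξ ht) _

theorem lineDeriv_survivalConv (ha : 0 < a) (hb : 0 < b) (l ξ : ℝ) (ht : 0 ≤ t) :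
    ∂_{(1 : ℝ)} (ofFun (survivalConv a b l ξ t)) =
      stateDensity a b l ξ t - ofFun (jumpConv a b l ξ t) := by
  ext φ
  have hq := causalLocInt_stateDensityReg ha hb l ξ ht
  obtain ⟨ψ, hψ⟩ := exists_test_eq_shiftPairing hq (mittagLeffler b (-ξ * t ^ b)) φ
  rw [stateDensity_sub_jumpConv_apply ha hb ht hψ, laplacianDensity_eq_lineDeriv ha]
  exact lineDeriv_ofFun_const_mul_add_convolution_apply (causalLocInt_survivalFun ha l) hq hψ

lemma prabhakarFun_one (a b z : ℝ) : prabhakarFun a b 1 z = mittagLefflerGen a b z := by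
  refine tsum_congr fun s => ?_
  rw [ascPochhammer_eval_one, div_self (by positivity), one_mul]

lemma prabhakarIntegralKernel_one (hl : l ≠ 0) (x : ℝ) :
    prabhakarIntegralKernel a a 1 (-l) x = l⁻¹ * mlDensity a l x := by
  rw [prabhakarIntegralKernel, mlDensity, prabhakarFun_one]
  split_ifs
  · field_simp
  · rw [mul_zero]

lemma ofFun_const_mul_apply {f : ℝ → ℝ} (hf : LocallyIntegrable f) (c : ℝ) (φ : RealTest) :
    ofFun (fun x => c * f x) φ = c * ofFun f φ := by
  rw [ofFun_apply (show LocallyIntegrable fun x => c * f x from hf.smul c), ofFun_apply hf,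
    ← integral_const_mul]
  simp only [mul_left_comm]

theorem isPrabhakarIntegral_stateDensity (ha : 0 < a) (hb : 0 < b) (hl : l ≠ 0) (ξ : ℝ)
    (ht : 0 ≤ t) :
    IsPrabhakarIntegral a a 1 (-l) (stateDensity a b l ξ t) (l⁻¹ • ofFun (jumpConv a b l ξ t)) := by
  have hW := causalLocInt_mlDensity ha l
  have hq := causalLocInt_stateDensityReg ha hb l ξ ht
  have hk : CausalLocInt fun x => l⁻¹ * mlDensity a l x :=
    ⟨hW.locallyIntegrable.smul l⁻¹, fun x hx => by rw [hW.eq_zero x hx, mul_zero]⟩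
  rw [IsPrabhakarIntegral, funext (prabhakarIntegralKernel_one hl)]
  refine ⟨hk.locallyIntegrable,
    isCausalConv_of_forall (isVanishingOn_ofFun hk) hq fun φ ψ hψ => ?_⟩
  rw [ofFun_const_mul_apply hW.locallyIntegrable,
    ← ofFun_const_mul_add_convolution_apply hW hq hψ]
  rfl

/-! ### The density on the half-line -/

lemma expBounded_prabhakarKernelReg (ha : 0 < a) (z : ℝ) (hx : 0 < x) :
    ExpBounded fun m => prabhakarKernelReg a m z x := by
  obtain ⟨C, hC, h⟩ := exists_abs_prabhakarKernelReg_le ha z hx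
  refine ⟨C * x ^ (a - 1), 2, by positivity, two_pos, fun m => ?_⟩
  exact (h x (right_mem_Ioc.2 hx) m).trans_eq (mul_right_comm ..)

lemma mlDensity_eq_rpow_mul (a l : ℝ) (hx : 0 < x) :
    mlDensity a l x = l * x ^ (a - 1) * mittagLefflerGen a a (-l * x ^ a) :=
  if_pos hx

theorem intervalIntegrable_mlDensity_mul_stateDensityReg (ha : 0 < a) (hb : 0 < b) (l ξ : ℝ)
    (ht : 0 ≤ t) (hx : 0 < x) :
    IntervalIntegrable (fun τ => l * (x - τ) ^ (a - 1) *
      mittagLefflerGen a a (-l * (x - τ) ^ a) * stateDensityReg a b l ξ t τ) volume 0 x := by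
  have h := (hasSum_prabhakarKernelReg_conv ha 1 (-l) hx
    (summable_abs_mlCoeff_mul_pow (ξ := ξ) hb ht two_pos.le)).1.neg
  rw [intervalIntegrable_iff_integrableOn_Ioo_of_le hx.le] at h ⊢
  refine h.congr_fun (fun τ hτ => ?_) measurableSet_Ioo
  rw [← mlDensity_eq_rpow_mul a l (sub_pos.2 hτ.2), stateDensityReg_eq_tsum_mlCoeff]
  simp only [Pi.neg_apply, prabhakarKernelReg_one, neg_mul, neg_neg]

theorem hasCaputoDeriv_stateDensityReg (ha : 0 < a) (hb : 0 < b) (hb1 : b ≤ 1) (l ξ : ℝ)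
    (ht : 0 < t) (hx : 0 < x) :
    HasCaputoDeriv b (fun r : ℝ => stateDensityReg a b l ξ r x) t
      (-ξ * stateDensityReg a b l ξ t x + ξ * (mittagLeffler b (-ξ * t ^ b) *
        (l * x ^ (a - 1) * mittagLefflerGen a a (-l * x ^ a)) +
        ∫ τ in (0 : ℝ)..x, l * (x - τ) ^ (a - 1) * mittagLefflerGen a a (-l * (x - τ) ^ a) *
          stateDensityReg a b l ξ t τ)) := by
  have h := hasCaputoDeriv_tsum_mlCoeff_mul (ξ := ξ) hb hb1 ht
    (expBounded_prabhakarKernelReg ha (-l) hx)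
  rw [tsum_mlCoeff_mul_prabhakarKernelReg_succ ha hb l ξ ht.le,
    jumpConv_of_nonneg ha hb l ξ ht.le hx.le, mlDensity_eq_rpow_mul a l hx,
    intervalIntegral_congr_Ioo hx.le fun τ hτ => by
      rw [mlDensity_eq_rpow_mul a l (sub_pos.2 hτ.2)],
    mul_sub, sub_eq_add_neg, ← neg_mul, neg_neg] at h
  exact h

end StateDensity

theorem mainTheorem3_general (α β l₀ ξ : ℝ) (hα : 0 < α) (hα1 : α ≤ 1) (hβ : 0 < β) (hβ1 : β ≤ 1)
    (hl : 0 < l₀) :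
    (∀ l : ℝ, 0 < l → ∀ n : ℕ,
      stateProb α β l ξ n 0 = (if n = 0 then 1 else 0) ∧
      ∀ t : ℝ, 0 < t → HasCaputoDeriv β (stateProb α β l ξ n) t
        (-ξ * ∑ k ∈ Finset.range (n + 1), stateProb α β l ξ k t *
          PowerSeries.coeff (n - k) (discreteLaplacian α l))) ∧
    (LocallyIntegrable (mlDensity α l₀) ∧ LocallyIntegrable (survivalFun α l₀) ∧
      (∀ m : ℕ, LocallyIntegrable (prabhakarKernelReg α m (-l₀))) ∧
      ∀ t : ℝ, 0 ≤ t → LocallyIntegrable (stateDensityReg α β l₀ ξ t)) ∧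
    (∀ t : ℝ, 0 ≤ t →
      (∀ φ : RealTest, Tendsto
        (fun h : ℝ => ∫ x, latticeDensity h (fun n => stateProb α β (l₀ * h ^ α) ξ n t) x * φ x)
        (𝓝[>] 0) (𝓝 (stateDensity α β l₀ ξ t φ))) ∧
      (∀ x : ℝ, 0 < x → Tendsto
        (fun h : ℝ => latticeDensity h (fun n => stateProb α β (l₀ * h ^ α) ξ n t) x)
        (𝓝[>] 0) (𝓝 (stateDensityReg α β l₀ ξ t x))) ∧
      ∀ φ : RealTest, HasSum
        (fun m : ℕ => (-ξ * t ^ β) ^ m / Real.Gamma (β * m + 1) *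
          prabhakarKernel α m (-l₀) φ)
        (stateDensity α β l₀ ξ t φ)) ∧
    (∀ φ : RealTest, Tendsto
      (fun h : ℝ => ∫ x, latticeDensity h
        (fun n => PowerSeries.coeff n (discreteLaplacian α (l₀ * h ^ α))) x * φ x)
      (𝓝[>] 0) (𝓝 (laplacianDensity α l₀ φ))) ∧
    laplacianDensity α l₀ = ∂_{(1 : ℝ)} (ofFun (survivalFun α l₀)) ∧
    (∀ x : ℝ, 0 < x →
      HasDerivAt (fun y : ℝ => mittagLeffler α (-l₀ * y ^ α)) (-mlDensity α l₀ x) x) ∧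
    (∀ s : ℂ, 0 < s.re →
      HasLaplaceTransform (laplacianDensity α l₀) s
        (s ^ (α : ℂ) / (s ^ (α : ℂ) + (l₀ : ℂ)))) ∧
    stateDensity α β l₀ ξ 0 = dirac0 ∧
    (∀ φ : RealTest,
      Tendsto (fun t : ℝ => stateDensity α β l₀ ξ t φ) (𝓝[>] 0) (𝓝 (dirac0 φ))) ∧
    (∀ t : ℝ, 0 < t → ∃ D CG CW CE CP : RealDistribution,
      (∀ φ : RealTest,
        HasCaputoDeriv β (fun r : ℝ => stateDensity α β l₀ ξ r φ) t (D φ)) ∧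
      IsCausalConv (laplacianDensity α l₀) (stateDensity α β l₀ ξ t) CG ∧
      IsCausalConv (ofFun (mlDensity α l₀)) (stateDensity α β l₀ ξ t) CW ∧
      IsCausalConv (ofFun (survivalFun α l₀)) (stateDensity α β l₀ ξ t) CE ∧
      IsPrabhakarIntegral α α 1 (-l₀) (stateDensity α β l₀ ξ t) CP ∧
      D = (-ξ) • CG ∧
      D = (-ξ) • stateDensity α β l₀ ξ t + ξ • CW ∧
      D = (-ξ) • ∂_{(1 : ℝ)} CE ∧
      D = (-ξ) • stateDensity α β l₀ ξ t + (ξ * l₀) • CP) ∧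
    (∀ t : ℝ, 0 < t →
      HasCaputoDeriv β (fun r : ℝ => mittagLeffler β (-ξ * r ^ β)) t
        (-ξ * mittagLeffler β (-ξ * t ^ β)) ∧
      ∀ x : ℝ, 0 < x →
        IntervalIntegrable (fun τ : ℝ => l₀ * (x - τ) ^ (α - 1) *
          mittagLefflerGen α α (-l₀ * (x - τ) ^ α) * stateDensityReg α β l₀ ξ t τ) volume 0 x ∧
        HasCaputoDeriv β (fun r : ℝ => stateDensityReg α β l₀ ξ r x) t
          (-ξ * stateDensityReg α β l₀ ξ t x +
            ξ * (mittagLeffler β (-ξ * t ^ β) *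
                (l₀ * x ^ (α - 1) * mittagLefflerGen α α (-l₀ * x ^ α)) +
              ∫ τ in (0 : ℝ)..x, l₀ * (x - τ) ^ (α - 1) *
                mittagLefflerGen α α (-l₀ * (x - τ) ^ α) *
                stateDensityReg α β l₀ ξ t τ))) := by
  refine ⟨fun l _ n => ⟨stateProb_zero hβ n, fun t ht => hasCaputoDeriv_stateProb hβ hβ1 ht n⟩,
    ⟨(causalLocInt_mlDensity hα l₀).locallyIntegrable,
      (causalLocInt_survivalFun hα l₀).locallyIntegrable,
      fun m => (causalLocInt_prabhakarKernelReg hα m (-l₀)).locallyIntegrable,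
      fun t ht => (causalLocInt_stateDensityReg hα hβ l₀ ξ ht).locallyIntegrable⟩,
    fun t ht => ⟨tendsto_latticeDensity_stateProb hα hα1 hβ hl ht,
      fun x hx => tendsto_latticeDensity_stateProb_pointwise hα hα1 hβ hl ht hx,
      hasSum_stateDensity hα hβ l₀ ξ ht⟩,
    tendsto_latticeDensity_coeff hα hα1 hl, laplacianDensity_eq_lineDeriv hα l₀,
    fun x hx => hasDerivAt_mittagLeffler_rpow hα hx,
    fun s hs => hasLaplaceTransform_laplacianDensity hα hα1 hl hs,
    stateDensity_zero hα hβ l₀ ξ, tendsto_stateDensity_apply hα hβ hβ1 l₀ ξ,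
    fun t ht => ⟨_, _, _, ofFun (survivalConv α β l₀ ξ t), _,
      hasCaputoDeriv_stateDensity hα hβ hβ1 l₀ ξ ht,
      isCausalConv_laplacianDensity_stateDensity hα hβ l₀ ξ ht.le,
      isCausalConv_mlDensity_stateDensity hα hβ l₀ ξ ht.le,
      isCausalConv_survivalFun_stateDensity hα hβ l₀ ξ ht.le,
      isPrabhakarIntegral_stateDensity hα hβ hl.ne' ξ ht.le, rfl, by module,
      by rw [lineDeriv_survivalConv hα hβ l₀ ξ ht.le],
      by rw [smul_smul, mul_inv_cancel_right₀ hl.ne']; module⟩,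
    fun t ht => ⟨hasCaputoDeriv_mittagLeffler hβ hβ1 ht, fun x hx =>
      ⟨intervalIntegrable_mlDensity_mul_stateDensityReg hα hβ l₀ ξ ht.le hx,
        hasCaputoDeriv_stateDensityReg hα hβ hβ1 l₀ ξ ht hx⟩⟩⟩

end

theorem mainTheorem3 (α β l₀ ξ : ℝ) (hα : 0 < α) (hα1 : α ≤ 1) (hβ : 0 < β) (hβ1 : β ≤ 1)
    (hl : 0 < l₀) (hξ : 0 < ξ) :
    -- the state probabilities solve the Cauchy problem of the space-time Mittag-Leffler process
    (∀ l : ℝ, 0 < l → ∀ n : ℕ,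
      stateProb α β l ξ n 0 = (if n = 0 then 1 else 0) ∧
      ∀ t : ℝ, 0 < t → HasCaputoDeriv β (stateProb α β l ξ n) t
        (-ξ * ∑ k ∈ Finset.range (n + 1), stateProb α β l ξ k t *
          PowerSeries.coeff (n - k) (discreteLaplacian α l))) ∧
    -- all functions that define distributions are locally integrable
    (LocallyIntegrable (mlDensity α l₀) ∧ LocallyIntegrable (survivalFun α l₀) ∧
      (∀ m : ℕ, LocallyIntegrable (prabhakarKernelReg α m (-l₀))) ∧
      ∀ t : ℝ, 0 ≤ t → LocallyIntegrable (stateDensityReg α β l₀ ξ t)) ∧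
    -- the state density is the well-scaled limit of the state probabilities,
    -- and is given by the series of Prabhakar kernels
    (∀ t : ℝ, 0 ≤ t →
      (∀ φ : RealTest, Tendsto
        (fun h : ℝ => ∫ x, latticeDensity h (fun n => stateProb α β (l₀ * h ^ α) ξ n t) x * φ x)
        (𝓝[>] 0) (𝓝 (stateDensity α β l₀ ξ t φ))) ∧
      (∀ x : ℝ, 0 < x → Tendsto
        (fun h : ℝ => latticeDensity h (fun n => stateProb α β (l₀ * h ^ α) ξ n t) x)
        (𝓝[>] 0) (𝓝 (stateDensityReg α β l₀ ξ t x))) ∧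
      ∀ φ : RealTest, HasSum
        (fun m : ℕ => (-ξ * t ^ β) ^ m / Real.Gamma (β * m + 1) *
          prabhakarKernel α m (-l₀) φ)
        (stateDensity α β l₀ ξ t φ)) ∧
    -- the Laplacian density: well-scaled limit, derivative form, Laplace transform
    (∀ φ : RealTest, Tendsto
      (fun h : ℝ => ∫ x, latticeDensity h
        (fun n => PowerSeries.coeff n (discreteLaplacian α (l₀ * h ^ α))) x * φ x)
      (𝓝[>] 0) (𝓝 (laplacianDensity α l₀ φ))) ∧
    laplacianDensity α l₀ = ∂_{(1 : ℝ)} (ofFun (survivalFun α l₀)) ∧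
    (∀ x : ℝ, 0 < x →
      HasDerivAt (fun y : ℝ => mittagLeffler α (-l₀ * y ^ α)) (-mlDensity α l₀ x) x) ∧
    (∀ s : ℂ, 0 < s.re →
      HasLaplaceTransform (laplacianDensity α l₀) s
        (s ^ (α : ℂ) / (s ^ (α : ℂ) + (l₀ : ℂ)))) ∧
    -- initial condition
    stateDensity α β l₀ ξ 0 = dirac0 ∧
    (∀ φ : RealTest,
      Tendsto (fun t : ℝ => stateDensity α β l₀ ξ t φ) (𝓝[>] 0) (𝓝 (dirac0 φ))) ∧
    -- the evolution equation in the sense of distributions, in all its forms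
    (∀ t : ℝ, 0 < t → ∃ D CG CW CE CP : RealDistribution,
      (∀ φ : RealTest,
        HasCaputoDeriv β (fun r : ℝ => stateDensity α β l₀ ξ r φ) t (D φ)) ∧
      IsCausalConv (laplacianDensity α l₀) (stateDensity α β l₀ ξ t) CG ∧
      IsCausalConv (ofFun (mlDensity α l₀)) (stateDensity α β l₀ ξ t) CW ∧
      IsCausalConv (ofFun (survivalFun α l₀)) (stateDensity α β l₀ ξ t) CE ∧
      IsPrabhakarIntegral α α 1 (-l₀) (stateDensity α β l₀ ξ t) CP ∧
      D = (-ξ) • CG ∧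
      D = (-ξ) • stateDensity α β l₀ ξ t + ξ • CW ∧
      D = (-ξ) • ∂_{(1 : ℝ)} CE ∧
      D = (-ξ) • stateDensity α β l₀ ξ t + (ξ * l₀) • CP) ∧
    -- the evolution equation pointwise: mass of the atom at the origin, and density on `x > 0`
    (∀ t : ℝ, 0 < t →
      HasCaputoDeriv β (fun r : ℝ => mittagLeffler β (-ξ * r ^ β)) t
        (-ξ * mittagLeffler β (-ξ * t ^ β)) ∧
      ∀ x : ℝ, 0 < x →
        IntervalIntegrable (fun τ : ℝ => l₀ * (x - τ) ^ (α - 1) *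
          mittagLefflerGen α α (-l₀ * (x - τ) ^ α) * stateDensityReg α β l₀ ξ t τ) volume 0 x ∧
        HasCaputoDeriv β (fun r : ℝ => stateDensityReg α β l₀ ξ r x) t
          (-ξ * stateDensityReg α β l₀ ξ t x +
            ξ * (mittagLeffler β (-ξ * t ^ β) *
                (l₀ * x ^ (α - 1) * mittagLefflerGen α α (-l₀ * x ^ α)) +
              ∫ τ in (0 : ℝ)..x, l₀ * (x - τ) ^ (α - 1) *
                mittagLefflerGen α α (-l₀ * (x - τ) ^ α) *
                stateDensityReg α β l₀ ξ t τ))) :=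
  mainTheorem3_general α β l₀ ξ hα hα1 hβ hβ1 hl
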